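/- **Setting.** Let $N\in\{2,3\}$, $0<T<\infty$, $Q_T=(0,T)\times\mathbb R^N$, and consider vector fields $\mathbf E,\mathbf H$ on $Q_T$ with values in $\mathbb R^3$ (for $N=2$ they depend on $x_1,x_2$ only), with $w=|\mathbf E|^2+|\mathbf H|^2$ and $\nabla w = 2(\mathbf E\cdot\nabla\mathbf E+\mathbf H\cdot\nabla\mathbf H)$, and the Cauchy problem $$(M)\qquad \mathbf E_t+a_1\mathbf E-b_1\,\mathrm{curl}\,\mathbf H=0,\quad \mathbf H_t+a_2\mathbf H+b_2\,\mathrm{curl}\,\mathbf E=0 \ \text{ in } Q_T,\quad \mathbf E(0,\cdot)=\mathbf E_0,\ \mathbf H(0,\cdot)=\mathbf H_0,$$ where the coefficients $a_i,b_i$ are functions of $(x,t,\mathbf E,\mathbf H,\nabla\mathbf E,\nabla\mathbf H)$. With constants $d_1,d_2,d_3>0$ and exponents $p,n,m$, they satisfy, along the fields and almost everywhere in $Q_T$, * (c1) $a_i\ge d_1w^{m-1}|\nabla w|^p$ (where $w>0$), $i=1,2$; * (c2) $b_1=b_2$; * (c3) $|b_i|\le d_2w^{n-1}$, $i=1,2$;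 * (c4) for a.e. $t$ the function $x\mapsto b_i(x,t,\mathbf E(t,x),\dots)$ has a weak gradient, and $|\nabla b_i|\le d_3w^{n-2}|\nabla w|$ (where $w>0$), $i=1,2$. **Generalized solution.** $(\mathbf E,\mathbf H)$ is a generalized solution of $(M)$ if $\mathbf E(t,\cdot),\mathbf H(t,\cdot)$ have locally integrable weak spatial gradients for a.e. $t$ (jointly measurable in $(t,x)$), $\mathbf E(0,\cdot)=\mathbf E_0$ and $\mathbf H(0,\cdot)=\mathbf H_0$ a.e., $$w\in C([0,T];L^1(\mathbb R^N)),\qquad w^{\frac{m+p}{p}}\in L^p(0,T;W^{1,p}(\mathbb R^N)),\qquad w_t\in L^1(Q_T),$$ and for a.e. $t\in(0,T)$ and every compactly supported $\eta\in C^1(\mathbb R\times\mathbb R^N)$ the integrals below exist and $$\tfrac12\!\int_{\mathbb R^N}\!|\mathbf E(t)|^2\eta(t)\,dx-\tfrac12\!\iint_{Q_t}\!|\mathbf E|^2\eta_t+\iint_{Q_t}\!a_1|\mathbf E|^2\eta-\iint_{Q_t}\!b_1\,\mathbf E\cdot\mathrm{curl}\,\mathbf H\,\eta=\tfrac12\!\int_{\mathbb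 R^N}\!|\mathbf E_0|^2\eta(0)\,dx,$$ $$\tfrac12\!\int_{\mathbb R^N}\!|\mathbf H(t)|^2\eta(t)\,dx-\tfrac12\!\iint_{Q_t}\!|\mathbf H|^2\eta_t+\iint_{Q_t}\!a_2|\mathbf H|^2\eta+\iint_{Q_t}\!b_2\,\mathbf H\cdot\mathrm{curl}\,\mathbf E\,\eta=\tfrac12\!\int_{\mathbb R^N}\!|\mathbf H_0|^2\eta(0)\,dx.$$ **Theorem 1.** Let $p>1$, $n>1$, and $n<1+\frac{(p-1)(p+N)}{pN(2-p)}$ if $p<2$; let $$\max\Bigl\{-p,\ -p\bigl(1+\tfrac1N-\tfrac np\bigr),\ -p\bigl(1+\tfrac1N-\tfrac{n-1}{p-1}\bigr)\Bigr\}<m<p(n-2)+1,$$ and let moreover $m>n-p-\frac{p-1}{N}$. Put $$\alpha=\frac{p+N(m+p-n)}{p+N(m+p-1)},\qquad \kappa=\frac{p\,(p-1+N(m+p-n))\,[np+N(m+p-1)]}{(p+N(m+p-1))\,[p(p(n-1)-m)+N(p-1)(m+p-1)]}$$ (the last condition on $m$ says that $\kappa>0$). For every $M\ge 0$ there are $T^*>0$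 and $K>0$, depending only on $N,p,n,m,d_1,d_2,d_3$ and $M$, such that the function $$\Gamma(t)=K\max\{t^{\alpha},t^{\kappa}\}$$ is continuous on $[0,\infty)$ with $\Gamma(0)=0$, and the following holds. For every $T>0$, all coefficients with (c1)–(c4) and every generalized solution $(\mathbf E,\mathbf H)$ of $(M)$ on $Q_T$ with $\operatorname{supp}w(0,\cdot)\subset\{x_N<0\}$ and $\|w(0,\cdot)\|_{L^1(\mathbb R^N)}=M$, $$\operatorname{supp}w(t,\cdot)\subset\{x\in\mathbb R^N: x_N<\Gamma(t)\}\qquad\text{for all } 0<t<\min\{T^*,T\},$$ that is, $\mathbf E(t,x)=\mathbf H(t,x)=0$ for almost every $x$ with $x_N\ge\Gamma(t)$. (Supports are essential supports.) -/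

import Mathlib

open MeasureTheory Set Filter
open scoped Topology ContDiff

noncomputable section

/-- The space `ℝ^N` of points `x = (x', x_N)`. -/
abbrev Space (N : ℕ) : Type := EuclideanSpace ℝ (Fin N)

/-- The values of the electric and of the magnetic field.  For `N = 2` the fields still have three
components and depend on `(x₁, x₂)` only. -/
abbrev Vec3 : Type := EuclideanSpace ℝ (Fin 3)

/-- The value of the full spatial gradient of a field: `G j` is the partial derivative `∂_j`. -/
abbrev GradVal (N : ℕ) : Type := Fin N → Vec3

/-- A coefficient `a = a(x, t, E, H, ∇E, ∇H)`. -/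
abbrev Coeff (N : ℕ) : Type := Space N → ℝ → Vec3 → Vec3 → GradVal N → GradVal N → ℝ

/-- The last coordinate `x_N` (the value `0` for `N = 0` is never used). -/
def lastCoord {N : ℕ} (x : Space N) : ℝ :=
  if h : 0 < N then x ⟨N - 1, by omega⟩ else 0

/-- The cylinder `Q_T = (0,T) × ℝ^N`. -/
def cyl (N : ℕ) (T : ℝ) : Set (ℝ × Space N) := Ioo 0 T ×ˢ univ

/-- `G` is the weak gradient of `u` on `ℝ^N`, both locally integrable. -/
def HasWeakGrad {N : ℕ} (u : Space N → ℝ) (G : Space N → Space N) : Prop :=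
  LocallyIntegrable u ∧ LocallyIntegrable G ∧
    ∀ φ : Space N → ℝ, ContDiff ℝ ∞ φ → HasCompactSupport φ → ∀ j : Fin N,
      ∫ x, u x * fderiv ℝ φ x (EuclideanSpace.single j 1) = - ∫ x, G x j * φ x

/-- `G` is the full weak spatial gradient of the vector field `u`, component by component. -/
def HasWeakVecGrad {N : ℕ} (u : Space N → Vec3) (G : Space N → GradVal N) : Prop :=
  ∀ k : Fin 3, HasWeakGrad (fun x => u x k) (fun x => WithLp.toLp 2 fun j => G x j k)

/-- The partial derivative in the direction `j ∈ {0,1,2}` read off a gradient value; it vanishes in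
the directions on which the fields do not depend. -/
def GradVal.partial {N : ℕ} (G : GradVal N) (j : ℕ) : Vec3 :=
  if h : j < N then G ⟨j, h⟩ else 0

/-- The curl read off a gradient value. -/
def GradVal.curl {N : ℕ} (G : GradVal N) : Vec3 :=
  !₂[G.partial 1 2 - G.partial 2 1, G.partial 2 0 - G.partial 0 2, G.partial 0 1 - G.partial 1 0]

/-- A pair of time dependent fields together with their spatial gradients. -/
structure EMField (N : ℕ) where
  /-- the electric field -/
  E : ℝ → Space N → Vec3
  /-- the magnetic field -/
  H : ℝ → Space N → Vec3
  /-- the spatial gradient of the electric field -/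
  gradE : ℝ → Space N → GradVal N
  /-- the spatial gradient of the magnetic field -/
  gradH : ℝ → Space N → GradVal N

namespace EMField

variable {N : ℕ} (F : EMField N)

/-- The energy density `w = E² + H²`. -/
def w (t : ℝ) (x : Space N) : ℝ := ‖F.E t x‖ ^ 2 + ‖F.H t x‖ ^ 2

/-- `∇w = 2 (E · ∇E + H · ∇H)`. -/
def gradw (t : ℝ) (x : Space N) : Space N :=
  WithLp.toLp 2 fun j =>
    2 * (inner ℝ (F.E t x) (F.gradE t x j) + inner ℝ (F.H t x) (F.gradH t x j))

/-- A coefficient evaluated along the fields. -/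
def along (a : Coeff N) (t : ℝ) (x : Space N) : ℝ :=
  a x t (F.E t x) (F.H t x) (F.gradE t x) (F.gradH t x)

end EMField

/-- The structural conditions on the coefficients along the fields, on `Q_T`.  Powers of `w` whose
exponent may be negative are used only where `w > 0`. -/
structure StructuralConditions {N : ℕ} (T p n m d₁ d₂ d₃ : ℝ) (a₁ a₂ b₁ b₂ : Coeff N)
    (F : EMField N) : Prop where
  lower : ∀ a ∈ ({a₁, a₂} : Set (Coeff N)), ∀ᵐ z ∂(volume.restrict (cyl N T)),
    0 < F.w z.1 z.2 →
      d₁ * F.w z.1 z.2 ^ (m - 1) * ‖F.gradw z.1 z.2‖ ^ p ≤ F.along a z.1 z.2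
  equal : ∀ᵐ z ∂(volume.restrict (cyl N T)), F.along b₁ z.1 z.2 = F.along b₂ z.1 z.2
  bound : ∀ b ∈ ({b₁, b₂} : Set (Coeff N)), ∀ᵐ z ∂(volume.restrict (cyl N T)),
    |F.along b z.1 z.2| ≤ d₂ * F.w z.1 z.2 ^ (n - 1)
  /-- The gradient is that of the composite function `x ↦ b(x, t, E(t,x), …)`. -/
  gradBound : ∀ b ∈ ({b₁, b₂} : Set (Coeff N)), ∃ G : ℝ → Space N → Space N,
    (∀ᵐ t ∂(volume.restrict (Ioo 0 T)), HasWeakGrad (F.along b t) (G t)) ∧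
    ∀ᵐ z ∂(volume.restrict (cyl N T)), 0 < F.w z.1 z.2 →
      ‖G z.1 z.2‖ ≤ d₃ * F.w z.1 z.2 ^ (n - 2) * ‖F.gradw z.1 z.2‖

/-- The energy identity at time `t` for one field `u` with initial value `u₀`, damping
coefficient `a`, exchange term `g` and test function `η`; the integrals in it exist. -/
def EnergyIdentity {N : ℕ} (u : ℝ → Space N → Vec3) (u₀ : Space N → Vec3)
    (a g : ℝ → Space N → ℝ) (η : ℝ × Space N → ℝ) (t : ℝ) : Prop :=
  IntegrableOn (fun z : ℝ × Space N => a z.1 z.2 * ‖u z.1 z.2‖ ^ 2 * η z) (cyl N t) ∧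
  IntegrableOn (fun z : ℝ × Space N => g z.1 z.2 * η z) (cyl N t) ∧
  1 / 2 * (∫ x, ‖u t x‖ ^ 2 * η (t, x))
      - 1 / 2 * (∫ z in cyl N t, ‖u z.1 z.2‖ ^ 2 * fderiv ℝ η z (1, 0))
      + (∫ z in cyl N t, a z.1 z.2 * ‖u z.1 z.2‖ ^ 2 * η z)
      + (∫ z in cyl N t, g z.1 z.2 * η z)
    = 1 / 2 * ∫ x, ‖u₀ x‖ ^ 2 * η (0, x)

/-- Generalized solutions on `Q_T` of the Cauchy problem
`E_t + a₁ E - b₁ curl H = 0`, `H_t + a₂ H + b₂ curl E = 0`, `E(0) = E₀`, `H(0) = H₀`. -/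
structure IsGeneralizedSolution {N : ℕ} (T p m : ℝ) (a₁ a₂ b₁ b₂ : Coeff N)
    (E₀ H₀ : Space N → Vec3) (F : EMField N) : Prop where
  measE : AEStronglyMeasurable (fun z : ℝ × Space N => F.E z.1 z.2) (volume.restrict (cyl N T))
  measH : AEStronglyMeasurable (fun z : ℝ × Space N => F.H z.1 z.2) (volume.restrict (cyl N T))
  measGradE :
    AEStronglyMeasurable (fun z : ℝ × Space N => F.gradE z.1 z.2) (volume.restrict (cyl N T))
  measGradH :
    AEStronglyMeasurable (fun z : ℝ × Space N => F.gradH z.1 z.2) (volume.restrict (cyl N T))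
  measSliceE : ∀ t ∈ Icc 0 T, AEStronglyMeasurable (F.E t) volume
  measSliceH : ∀ t ∈ Icc 0 T, AEStronglyMeasurable (F.H t) volume
  weakGradE : ∀ᵐ t ∂(volume.restrict (Ioo 0 T)), HasWeakVecGrad (F.E t) (F.gradE t)
  weakGradH : ∀ᵐ t ∂(volume.restrict (Ioo 0 T)), HasWeakVecGrad (F.H t) (F.gradH t)
  initE : F.E 0 =ᵐ[volume] E₀
  initH : F.H 0 =ᵐ[volume] H₀
  /-- `w ∈ C([0,T]; L¹(ℝ^N))` -/
  energyIntegrable : ∀ t ∈ Icc 0 T, Integrable (F.w t)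
  energyContinuous : ∀ s ∈ Icc 0 T,
    Tendsto (fun t => ∫ x, |F.w t x - F.w s x|) (𝓝[Icc 0 T] s) (𝓝 0)
  /-- `w^((m+p)/p) ∈ L^p(0,T; W^{1,p}(ℝ^N))` -/
  powerSobolev : ∃ G : ℝ → Space N → Space N,
    (∀ᵐ t ∂(volume.restrict (Ioo 0 T)), HasWeakGrad (fun x => F.w t x ^ ((m + p) / p)) (G t)) ∧
    MemLp (fun z : ℝ × Space N => F.w z.1 z.2 ^ ((m + p) / p)) (ENNReal.ofReal p)
      (volume.restrict (cyl N T)) ∧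
    MemLp (fun z : ℝ × Space N => G z.1 z.2) (ENNReal.ofReal p) (volume.restrict (cyl N T))
  /-- `w_t ∈ L¹(Q_T)` -/
  energyTimeDeriv : ∃ g : ℝ × Space N → ℝ, IntegrableOn g (cyl N T) ∧
    ∀ φ : ℝ × Space N → ℝ, ContDiff ℝ ∞ φ → HasCompactSupport φ → tsupport φ ⊆ cyl N T →
      ∫ z in cyl N T, F.w z.1 z.2 * fderiv ℝ φ z (1, 0) = - ∫ z in cyl N T, g z * φ z
  identities : ∀ᵐ t ∂(volume.restrict (Ioo 0 T)), ∀ η : ℝ × Space N → ℝ,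
    ContDiff ℝ 1 η → HasCompactSupport η →
      EnergyIdentity F.E E₀ (F.along a₁)
        (fun s x => -(F.along b₁ s x * inner ℝ (F.E s x) (F.gradH s x).curl)) η t ∧
      EnergyIdentity F.H H₀ (F.along a₂)
        (fun s x => F.along b₂ s x * inner ℝ (F.H s x) (F.gradE s x).curl) η t

/-- The (closed) support of a class of functions modulo null sets: the complement of the largest
open set on which `u` vanishes almost everywhere. -/
def essSupport {N : ℕ} (u : Space N → ℝ) : Set (Space N) :=
  (volume.restrict {x | u x ≠ 0}).support

/-- The exponent `(p + N(m+p-n)) / (p + N(m+p-1))`. -/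
def alphaExp (N : ℕ) (p n m : ℝ) : ℝ := (p + N * (m + p - n)) / (p + N * (m + p - 1))

/-- The exponent `κ`. -/
def kappaExp (N : ℕ) (p n m : ℝ) : ℝ :=
  (p * (p - 1 + N * (m + p - n)) * (n * p + N * (m + p - 1))) /
    ((p + N * (m + p - 1)) * (p * (p * (n - 1) - m) + N * (p - 1) * (m + p - 1)))

end

/-! The two energy identities are added for a weight ζ depending on x only. Since b₁ = b₂ = b, the
exchange terms combine to b (H·curl E − E·curl H) = b div(E × H). Integration by parts moves the
derivative onto b and ζ. The components of E × H are at most w, so (c3) and (c4) leave only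
w^(n-1)|∇w| ζ and w^n |∇ζ| (`exists_exchange_bound`, `exists_energy_inequality`). Young's inequality
hides the first term in the dissipation w^m |∇w|^p supplied by (c1), at the price of w^q with q =
(p(n-1)-m)/(p-1) (`exists_weighted_energy_inequality`).

The remaining powers are controlled by ∫ w^R ≤ C ∫ w^m |∇w|^p (∫ w)^(p/N), R = m+p+p/N, valid on
every half-space with the same constant (`exists_gagliardo_nirenberg`). Consequently, if mass and
dissipation on a half-space are at most a up to time t, then ∬ w^r ≤ C a · a^((p/N)θ) t^(1-θ) with θ
= (r-1)/(R-1) (`exists_parabolic_interpolation`). This is used for r = q and r = n, and the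
conditions on m enter as m+p > 0, 1 < q < R and n < R.

With ζ = 1 a continuity argument bounds mass and dissipation by some Y on a short time interval
(`exists_global_bound`). Next take the levels s_i = h(1 - 2^(-i)). A cutoff between s_i and s_(i+1)
has slope of order 2^i/h and sees no initial energy, so with ν = (n-1)/(R-1) the energies a_i above
s_i obey a_(i+1) ≤ C a_i (a_i^((p/N)θ) t^(1-θ) + (2^i/h) a_i^((p/N)ν) t^(1-ν)). Here θ belongs to r
= q. The first summand is small for short times. If a_i ≤ Y ρ^i with ρ^((p/N)ν) = 1/2, the decay of
a_i compensates the growth of the slope, and the second summand is small once h is a large multiple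
of t^(1-ν). Hence a_i tends to 0 and no energy lies above h (`exists_propagation_bound`). Since 1-ν
= α, the front stays below K t^α; the maximum with t^κ only enlarges Γ, and κ > 0 serves its
continuity at 0.

Two technical points shape the proof. No weak differentiability of w itself is assumed and m may be
negative, so the calculus is done for primitives of weights vanishing near 0 and near infinity
(`HasTruncatedGrad`), by a chain rule proved through mollification (`IsWeakDeriv.comp`). The energy
inequality holds at almost every time only; continuity of w in L¹ carries the conclusions to every
time. -/

/-! ### Mollification and weak directional derivatives -/

set_option linter.unusedSectionVars false

section Mollification

open ContinuousLinearMap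

open scoped Convolution ENNReal

variable {X V : Type*} [NormedAddCommGroup X] [InnerProductSpace ℝ X] [FiniteDimensional ℝ X]
  [MeasurableSpace X] [BorelSpace X] [NormedAddCommGroup V] [NormedSpace ℝ V]
  [CompleteSpace V]

/-- A bump function of radius `1 / (k + 1)`. -/
noncomputable def mollBump (X : Type*) [NormedAddCommGroup X] (k : ℕ) : ContDiffBump (0 : X) where
  rIn := 1 / (2 * ((k : ℝ) + 1))
  rOut := 1 / ((k : ℝ) + 1)
  rIn_pos := by positivity
  rIn_lt_rOut := by
    apply one_div_lt_one_div_of_lt <;> linarith [(Nat.cast_nonneg k : (0 : ℝ) ≤ k)]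

/-- The normalised mollifier. -/
noncomputable def mollifier (X : Type*) [NormedAddCommGroup X] [InnerProductSpace ℝ X]
    [FiniteDimensional ℝ X] [MeasurableSpace X] [BorelSpace X] (k : ℕ) : X → ℝ :=
  (mollBump X k).normed volume

/-- The mollification of a function. -/
noncomputable def mollify (k : ℕ) (g : X → V) : X → V :=
  mollifier X k ⋆[lsmul ℝ ℝ, volume] g

lemma tendsto_mollBump_rOut : Tendsto (fun k => (mollBump X k).rOut) atTop (𝓝 0) :=
  tendsto_one_div_add_atTop_nhds_zero_nat

lemma mollifier_nonneg (k : ℕ) (x : X) : 0 ≤ mollifier X k x :=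
  (mollBump X k).nonneg_normed x

lemma mollifier_contDiff (k : ℕ) {n : ℕ∞} : ContDiff ℝ n (mollifier X k) :=
  (mollBump X k).contDiff_normed

lemma mollifier_hasCompactSupport (k : ℕ) : HasCompactSupport (mollifier X k) :=
  (mollBump X k).hasCompactSupport_normed

lemma mollifier_eq_zero {k : ℕ} {x : X} (hx : 1 ≤ ‖x‖) : mollifier X k x = 0 := by
  have h : x ∉ Function.support (mollifier X k) := by
    rw [mollifier, (mollBump X k).support_normed_eq]
    have : (mollBump X k).rOut ≤ 1 := by
      change 1 / ((k : ℝ) + 1) ≤ 1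
      rw [div_le_one (by positivity)]
      linarith [(Nat.cast_nonneg k : (0 : ℝ) ≤ k)]
    simp only [Metric.mem_ball, dist_zero_right, not_lt]
    linarith
  simpa using h

lemma integral_mollifier (k : ℕ) : ∫ x, mollifier X k x = 1 :=
  (mollBump X k).integral_normed

lemma mollifier_continuous (k : ℕ) : Continuous (mollifier X k) :=
  (mollifier_contDiff k (n := 0)).continuous

lemma lintegral_mollifier (k : ℕ) : ∫⁻ x, ‖mollifier X k x‖ₑ = 1 := by
  have h1 : Integrable (mollifier X k) :=
    (mollifier_continuous k).integrable_of_hasCompactSupport (mollifier_hasCompactSupport k)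
  have := ofReal_integral_eq_lintegral_ofReal h1 (Eventually.of_forall (mollifier_nonneg k))
  rw [integral_mollifier] at this
  simp only [ENNReal.ofReal_one] at this
  rw [this]
  refine lintegral_congr fun x => ?_
  rw [Real.enorm_of_nonneg (mollifier_nonneg k x)]

lemma mollify_apply (k : ℕ) (g : X → V) (x : X) :
    mollify k g x = ∫ y, mollifier X k y • g (x - y) := rfl

lemma mollify_eq_swap (k : ℕ) (g : X → V) (x : X) :
    mollify k g x = ∫ y, mollifier X k (x - y) • g y := by
  rw [mollify, convolution_eq_swap]; rfl

lemma mollify_contDiff (k : ℕ) {g : X → V} (hg : LocallyIntegrable g) :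
    ContDiff ℝ 1 (mollify k g) :=
  HasCompactSupport.contDiff_convolution_left (n := 1) _ (mollifier_hasCompactSupport k)
    (mollifier_contDiff k) hg

lemma mollify_integrand_integrable (k : ℕ) {g : X → V} (hg : LocallyIntegrable g) (x : X) :
    Integrable (fun y => mollifier X k y • g (x - y)) :=
  (mollifier_hasCompactSupport k).convolutionExists_left (lsmul ℝ ℝ) (mollifier_continuous k) hg x

/-- By Tonelli and translation invariance: the kernel has mass one, so mollification is a
contraction of L¹. -/
lemma lintegral_mollify_le (k : ℕ) {g : X → V} (hg : LocallyIntegrable g) :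
    ∫⁻ x, ‖mollify k g x‖ₑ ≤ ∫⁻ x, ‖g x‖ₑ := by
  have hm : AEStronglyMeasurable g volume := hg.aestronglyMeasurable
  calc ∫⁻ x, ‖mollify k g x‖ₑ
      ≤ ∫⁻ x, ∫⁻ y, ‖mollifier X k y‖ₑ * ‖g (x - y)‖ₑ := by
        refine lintegral_mono fun x => ?_
        rw [mollify_apply]
        refine (enorm_integral_le_lintegral_enorm _).trans (le_of_eq ?_)
        refine lintegral_congr fun y => ?_
        rw [enorm_smul]
    _ = ∫⁻ y, ∫⁻ x, ‖mollifier X k y‖ₑ * ‖g (x - y)‖ₑ := by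
        rw [lintegral_lintegral_swap]
        have h1 : AEMeasurable (fun z : X × X => ‖mollifier X k z.2‖ₑ) (volume.prod volume) :=
          ((mollifier_continuous k).enorm.measurable.comp measurable_snd).aemeasurable
        have h2 : AEMeasurable (fun z : X × X => ‖g (z.1 - z.2)‖ₑ) (volume.prod volume) :=
          (hm.comp_quasiMeasurePreserving (quasiMeasurePreserving_sub_of_right_invariant
            (volume : Measure X) (volume : Measure X))).enorm
        exact h1.mul h2
    _ = ∫⁻ y, ‖mollifier X k y‖ₑ * ∫⁻ x, ‖g x‖ₑ := by
        refine lintegral_congr fun y => ?_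
        have := (hm.comp_measurePreserving (measurePreserving_sub_right volume y)).enorm
        simp only [Function.comp_def] at this
        rw [lintegral_const_mul'' _ this, lintegral_sub_right_eq_self (fun x => ‖g x‖ₑ) y]
    _ = ∫⁻ x, ‖g x‖ₑ := by
        rw [lintegral_mul_const _ (mollifier_continuous k).enorm.measurable, lintegral_mollifier,
          one_mul]

lemma mollify_sub (k : ℕ) {f g : X → V} (hf : LocallyIntegrable f) (hg : LocallyIntegrable g) :
    mollify k (f - g) = mollify k f - mollify k g := by
  ext x
  simp only [mollify_apply, Pi.sub_apply, smul_sub]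
  exact integral_sub (mollify_integrand_integrable k hf x) (mollify_integrand_integrable k hg x)

lemma tendsto_mollify_of_hasCompactSupport {g : X → V} (hg : Continuous g)
    (hc : HasCompactSupport g) :
    Tendsto (fun k => ∫⁻ x, ‖mollify k g x - g x‖ₑ) atTop (𝓝 0) := by
  obtain ⟨R, hR⟩ := hc.isCompact.isBounded.subset_closedBall (0 : X)
  have hzero : ∀ x : X, R + 1 < ‖x‖ → ∀ k, mollify k g x - g x = 0 := by
    intro x hx k
    have h1 : ∀ y : X, R < ‖y‖ → g y = 0 := fun y hy => image_eq_zero_of_notMem_tsupport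
      fun h => by have := hR h; simp at this; linarith
    rw [h1 x (by linarith), sub_zero, mollify_apply]
    refine integral_eq_zero_of_ae (Eventually.of_forall fun y => ?_)
    simp only [Pi.zero_apply]
    by_cases hy : 1 ≤ ‖y‖
    · rw [mollifier_eq_zero hy, zero_smul]
    · rw [h1 (x - y), smul_zero]
      have := norm_sub_norm_le x y
      linarith
  obtain ⟨C, hC⟩ := hg.bounded_above_of_compact_support hc
  have hbd : ∀ k x, ‖mollify k g x‖ ≤ C := by
    intro k x
    rw [mollify_apply]
    refine (norm_integral_le_integral_norm _).trans ?_
    calc ∫ y, ‖mollifier X k y • g (x - y)‖ ≤ ∫ y, mollifier X k y * C := by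
          refine integral_mono_of_nonneg (Eventually.of_forall fun _ => norm_nonneg _) ?_ ?_
          · exact ((mollifier_continuous k).integrable_of_hasCompactSupport
              (mollifier_hasCompactSupport k)).mul_const C
          · refine Eventually.of_forall fun y => ?_
            simp only [norm_smul, Real.norm_of_nonneg (mollifier_nonneg k y)]
            exact mul_le_mul_of_nonneg_left (hC _) (mollifier_nonneg k y)
      _ = C := by rw [integral_mul_const, integral_mollifier, one_mul]
  have hzz : (0 : ℝ≥0∞) = ∫⁻ _ : X, 0 := by simp
  rw [hzz]
  refine tendsto_lintegral_of_dominated_convergence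
    ((Metric.closedBall (0 : X) (R + 1)).indicator fun _ => ENNReal.ofReal (2 * C)) ?_ ?_ ?_ ?_
  · intro k
    exact ((mollify_contDiff k hg.locallyIntegrable).continuous.sub hg).enorm.measurable
  · intro k
    refine Eventually.of_forall fun x => ?_
    beta_reduce
    by_cases hx : x ∈ Metric.closedBall (0 : X) (R + 1)
    · rw [indicator_of_mem hx, ← ofReal_norm]
      refine ENNReal.ofReal_le_ofReal ((norm_sub_le _ _).trans ?_)
      linarith [hbd k x, hC x]
    · rw [indicator_of_notMem hx, hzero x (by simpa using hx) k]
      simp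
  · rw [lintegral_indicator measurableSet_closedBall, setLIntegral_const]
    exact ENNReal.mul_ne_top ENNReal.ofReal_ne_top measure_closedBall_lt_top.ne
  · refine Eventually.of_forall fun x => ?_
    have : Tendsto (fun k => mollify k g x) atTop (𝓝 (g x)) :=
      ContDiffBump.convolution_tendsto_right_of_continuous (μ := (volume : Measure X))
        (tendsto_mollBump_rOut (X := X)) hg x
    have h2 := (this.sub_const (g x)).enorm
    simpa using h2

/-- Density of continuous compactly supported functions combined with the L¹ contraction, which
makes the error ε/3 uniform in k. -/
lemma tendsto_mollify_of_integrable {g : X → V} (hg : Integrable g) :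
    Tendsto (fun k => ∫⁻ x, ‖mollify k g x - g x‖ₑ) atTop (𝓝 0) := by
  rw [ENNReal.tendsto_nhds_zero]
  intro ε hε
  have hε3 : ε / 3 ≠ 0 := (ENNReal.div_pos hε.ne' (by simp)).ne'
  obtain ⟨h, hhc, hgh, hh, hhi⟩ := hg.exists_hasCompactSupport_lintegral_sub_le hε3
  have h1 := (ENNReal.tendsto_nhds_zero.1 (tendsto_mollify_of_hasCompactSupport hh hhc)) (ε / 3)
    (pos_iff_ne_zero.2 hε3)
  filter_upwards [h1] with k hk
  have hmk : Continuous (mollify k h) := (mollify_contDiff k hh.locallyIntegrable).continuous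
  have hmg : Continuous (mollify k g) := (mollify_contDiff k hg.locallyIntegrable).continuous
  calc ∫⁻ x, ‖mollify k g x - g x‖ₑ
      ≤ ∫⁻ x, (‖mollify k (g - h) x‖ₑ + ‖mollify k h x - h x‖ₑ + ‖g x - h x‖ₑ) := by
        refine lintegral_mono fun x => ?_
        have : mollify k g x - g x
            = mollify k (g - h) x + (mollify k h x - h x) + (- (g x - h x)) := by
          rw [mollify_sub k hg.locallyIntegrable hh.locallyIntegrable, Pi.sub_apply]; abel
        rw [this]
        refine (enorm_add_le _ _).trans ?_
        rw [enorm_neg]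
        gcongr
        exact enorm_add_le _ _
    _ = (∫⁻ x, ‖mollify k (g - h) x‖ₑ) + (∫⁻ x, ‖mollify k h x - h x‖ₑ)
          + ∫⁻ x, ‖g x - h x‖ₑ := by
        have := (hg.sub hhi).aestronglyMeasurable.enorm
        simp only [Pi.sub_apply] at this
        rw [lintegral_add_right' _ this,
          lintegral_add_right (g := fun x => ‖mollify k h x - h x‖ₑ) _
            (hmk.sub hh).enorm.measurable]
    _ ≤ ε / 3 + ε / 3 + ε / 3 := by
        exact add_le_add (add_le_add
          ((lintegral_mollify_le k (hg.sub hhi).locallyIntegrable).trans hgh) hk) hgh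
    _ = ε := ENNReal.add_thirds ε

/-- The kernels live in the unit ball, so on the ball of radius R only values on the ball of radius
R + 1 matter, where the function is integrable. -/
lemma tendsto_mollify_of_locallyIntegrable {g : X → V} (hg : LocallyIntegrable g)
    (R : ℝ) :
    Tendsto (fun k => ∫⁻ x in Metric.closedBall 0 R, ‖mollify k g x - g x‖ₑ) atTop (𝓝 0) := by
  set B := Metric.closedBall (0 : X) (R + 1) with hB
  have hi : Integrable (B.indicator g) :=
    (integrable_indicator_iff measurableSet_closedBall).2
      (hg.integrableOn_isCompact (isCompact_closedBall _ _))
  refine tendsto_of_tendsto_of_tendsto_of_le_of_le tendsto_const_nhds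
    (tendsto_mollify_of_integrable hi) (fun _ => zero_le) fun k => ?_
  refine le_trans (le_of_eq ?_) (setLIntegral_le_lintegral (Metric.closedBall 0 R) _)
  refine setLIntegral_congr_fun measurableSet_closedBall fun x hx => ?_
  have hx' : ‖x‖ ≤ R := by simpa using hx
  have h1 : B.indicator g x = g x := indicator_of_mem (by simp [hB]; linarith) g
  have h2 : mollify k (B.indicator g) x = mollify k g x := by
    simp only [mollify_apply]
    refine integral_congr_ae (Eventually.of_forall fun y => ?_)
    by_cases hy : 1 ≤ ‖y‖
    · simp [mollifier_eq_zero hy]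
    · have : x - y ∈ B := by
        simp only [hB, Metric.mem_closedBall, dist_zero_right]
        linarith [norm_sub_le x y]
      simp only [indicator_of_mem this]
  simp only [h1, h2]

lemma ae_tendsto_mollify {g : X → V} (hg : LocallyIntegrable g) :
    ∀ᵐ x, Tendsto (fun k => mollify k g x) atTop (𝓝 (g x)) := by
  refine ContDiffBump.ae_convolution_tendsto_right_of_locallyIntegrable (K := 2)
    (tendsto_mollBump_rOut (X := X)) (Eventually.of_forall fun k => ?_) hg
  -- The bounded ratio of outer to inner radius is what differentiation of integrals at almost every
  -- point requires.
  change 1 / ((k : ℝ) + 1) ≤ 2 * (1 / (2 * ((k : ℝ) + 1)))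
  rw [one_div, one_div, mul_inv]
  linarith

/-- `du` is the weak derivative of `u` in the direction `v`. -/
def IsWeakDeriv (v : X) (u du : X → V) : Prop :=
  LocallyIntegrable u ∧ LocallyIntegrable du ∧
    ∀ φ : X → ℝ, ContDiff ℝ ∞ φ → HasCompactSupport φ →
      ∫ x, fderiv ℝ φ x v • u x = - ∫ x, φ x • du x

/-- The derivative falls on the kernel, and the reflected kernel centred at x is an admissible test
function; the sign from the reflection cancels the one from the integration by parts. -/
lemma IsWeakDeriv.fderiv_mollify {v : X} {u du : X → V} (h : IsWeakDeriv v u du) (k : ℕ) (x : X) :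
    fderiv ℝ (mollify k u) x v = mollify k du x := by
  have h1 := (HasCompactSupport.hasFDerivAt_convolution_right (lsmul ℝ ℝ).flip
    (mollifier_hasCompactSupport (X := X) k) h.1 (mollifier_contDiff k (n := 1)) x).fderiv
  rw [convolution_flip] at h1
  have h2 := congrArg (fun A : X →L[ℝ] V => A v) h1
  beta_reduce at h2
  rw [convolution_precompR_apply _ h.1 ((mollifier_hasCompactSupport k).fderiv (𝕜 := ℝ))
    ((mollifier_contDiff k (n := 1)).continuous_fderiv (by simp)), convolution_def] at h2
  refine h2.trans ?_
  rw [mollify_eq_swap]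
  have key := h.2.2 (fun y => mollifier X k (x - y))
    ((mollifier_contDiff k (n := ⊤)).comp (contDiff_const.sub contDiff_id))
    ((mollifier_hasCompactSupport k).comp_homeomorph (Homeomorph.subLeft x))
  rw [← neg_eq_iff_eq_neg, ← integral_neg] at key
  rw [← key]
  refine integral_congr_ae (Eventually.of_forall fun y => ?_)
  have : fderiv ℝ (fun y => mollifier X k (x - y)) y v = - fderiv ℝ (mollifier X k) (x - y) v := by
    have h1 := ((mollifier_contDiff (X := X) k (n := 1)).differentiable (by simp)
      (x - y)).hasFDerivAt.comp y ((hasFDerivAt_id y).const_sub x)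
    have := h1.fderiv
    simp only [Function.comp_def] at this
    rw [this]; simp
  simp [this]

/-- The chain rule for weak derivatives and `C¹` functions with bounded derivative. -/
lemma IsWeakDeriv.comp [FiniteDimensional ℝ V] {v : X} {u du : X → V} (h : IsWeakDeriv v u du)
    {F : V → ℝ} (hF : ContDiff ℝ 1 F) {C L : ℝ} (hC : ∀ z, |F z| ≤ C)
    (hL : ∀ z, ‖fderiv ℝ F z‖ ≤ L) :
    IsWeakDeriv v (fun x => F (u x)) (fun x => fderiv ℝ F (u x) (du x)) := by
  have hFm : AEStronglyMeasurable (fun x => F (u x)) volume :=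
    hF.continuous.comp_aestronglyMeasurable h.1.aestronglyMeasurable
  have hdm : AEStronglyMeasurable (fun x => fderiv ℝ F (u x) (du x)) volume :=
    (ContinuousLinearMap.id ℝ (V →L[ℝ] ℝ)).aestronglyMeasurable_comp₂
      ((hF.continuous_fderiv (by simp)).comp_aestronglyMeasurable h.1.aestronglyMeasurable)
      h.2.1.aestronglyMeasurable
  have hL0 : 0 ≤ L := (norm_nonneg _).trans (hL 0)
  have hdL : ∀ x, ‖fderiv ℝ F (u x) (du x)‖ ≤ L * ‖du x‖ := fun x =>
    (ContinuousLinearMap.le_opNorm _ _).trans (mul_le_mul_of_nonneg_right (hL _) (norm_nonneg _))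
  have hFloc : LocallyIntegrable (fun x => F (u x)) :=
    (locallyIntegrable_const C).mono hFm (Eventually.of_forall fun x =>
      (hC _).trans (le_abs_self C))
  have hdloc : LocallyIntegrable (fun x => fderiv ℝ F (u x) (du x)) :=
    (LocallyIntegrable.smul (f := fun x => ‖du x‖) (fun x => (h.2.1 x).norm) L).mono hdm (Eventually.of_forall fun x => by
      simpa [abs_of_nonneg hL0] using hdL x)
  refine ⟨hFloc, hdloc, fun φ hφ hφc => ?_⟩
  have hdφ : Continuous (fun x => fderiv ℝ φ x v) :=
    (hφ.continuous_fderiv (by simp)).clm_apply continuous_const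
  have hdφc : HasCompactSupport (fun x => fderiv ℝ φ x v) :=
    (hφc.fderiv (𝕜 := ℝ)).comp_left (g := fun A : X →L[ℝ] ℝ => A v) (by simp)
  have hmc : ∀ k, ContDiff ℝ 1 (fun x => F (mollify k u x)) := fun k =>
    hF.comp (mollify_contDiff k h.1)
  have hfd : ∀ k x, fderiv ℝ (fun x => F (mollify k u x)) x v
      = fderiv ℝ F (mollify k u x) (mollify k du x) := by
    intro k x
    have := ((hF.differentiable (by simp) (mollify k u x)).hasFDerivAt.comp x
      ((mollify_contDiff k h.1).differentiable (by simp) x).hasFDerivAt).fderiv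
    simp only [Function.comp_def] at this
    rw [this, ContinuousLinearMap.comp_apply, h.fderiv_mollify]
  have hparts : ∀ k, ∫ x, fderiv ℝ φ x v * F (mollify k u x)
      = - ∫ x, φ x * fderiv ℝ F (mollify k u x) (mollify k du x) := by
    intro k
    have hc1 : Continuous fun x => fderiv ℝ (fun x => F (mollify k u x)) x v :=
      ((hmc k).continuous_fderiv (by simp)).clm_apply continuous_const
    have := integral_mul_fderiv_eq_neg_fderiv_mul_of_integrable (μ := (volume : Measure X))
      (f := fun x => F (mollify k u x)) (g := φ) (v := v)
      ((hc1.mul hφ.continuous).integrable_of_hasCompactSupport hφc.mul_left)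
      (((hmc k).continuous.mul hdφ).integrable_of_hasCompactSupport hdφc.mul_left)
      (((hmc k).continuous.mul hφ.continuous).integrable_of_hasCompactSupport hφc.mul_left)
      (fun x _ => (hmc k).differentiable (by simp) x)
      (fun x _ => hφ.differentiable (by simp) x)
    simp only [hfd] at this
    simpa only [mul_comm] using this
  have hlim1 : Tendsto (fun k => ∫ x, fderiv ℝ φ x v * F (mollify k u x)) atTop
      (𝓝 (∫ x, fderiv ℝ φ x v * F (u x))) := by
    refine tendsto_integral_of_dominated_convergence (fun x => ‖fderiv ℝ φ x v‖ * C) ?_ ?_ ?_ ?_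
    · exact fun k => (hdφ.mul (hmc k).continuous).aestronglyMeasurable
    · exact (hdφ.norm.integrable_of_hasCompactSupport hdφc.norm).mul_const C
    · intro k
      refine Eventually.of_forall fun x => ?_
      rw [norm_mul]
      exact mul_le_mul_of_nonneg_left (hC _) (norm_nonneg _)
    · filter_upwards [ae_tendsto_mollify h.1] with x hx
      exact ((hF.continuous.tendsto _).comp hx).const_mul _
  obtain ⟨R, hR⟩ := hφc.isCompact.isBounded.subset_closedBall (0 : X)
  obtain ⟨Cφ, hCφ⟩ := hφ.continuous.bounded_above_of_compact_support hφc
  have hφR : ∀ x, x ∉ Metric.closedBall (0 : X) R → φ x = 0 := fun x hx =>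
    image_eq_zero_of_notMem_tsupport fun h => hx (hR h)
  have hduR : IntegrableOn du (Metric.closedBall (0 : X) R) :=
    h.2.1.integrableOn_isCompact (isCompact_closedBall _ _)
  have hcF : ∀ k, Continuous fun x => fderiv ℝ F (mollify k u x) := fun k =>
    (hF.continuous_fderiv (by simp)).comp (mollify_contDiff k h.1).continuous
  -- In the product the mollified derivative converges in L¹ on compact sets, while the derivative
  -- of F is only bounded and convergent almost everywhere. Hence the splitting du_k = du + (du_k −
  -- du): dominated convergence treats the first part, the bound L the second.
  have hlim2 : Tendsto (fun k => ∫ x, φ x * fderiv ℝ F (mollify k u x) (du x)) atTop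
      (𝓝 (∫ x, φ x * fderiv ℝ F (u x) (du x))) := by
    refine tendsto_integral_of_dominated_convergence
      ((Metric.closedBall (0 : X) R).indicator fun x => Cφ * (L * ‖du x‖)) ?_ ?_ ?_ ?_
    · exact fun k => hφ.continuous.aestronglyMeasurable.mul
        ((ContinuousLinearMap.id ℝ (V →L[ℝ] ℝ)).aestronglyMeasurable_comp₂
          (hcF k).aestronglyMeasurable h.2.1.aestronglyMeasurable)
    · exact (integrable_indicator_iff measurableSet_closedBall).2
        ((hduR.norm.const_mul L).const_mul Cφ)
    · intro k
      refine Eventually.of_forall fun x => ?_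
      by_cases hx : x ∈ Metric.closedBall (0 : X) R
      · rw [indicator_of_mem hx, norm_mul]
        exact mul_le_mul (hCφ x) ((ContinuousLinearMap.le_opNorm _ _).trans
          (mul_le_mul_of_nonneg_right (hL _) (norm_nonneg _))) (norm_nonneg _)
          ((norm_nonneg _).trans (hCφ x))
      · rw [indicator_of_notMem hx, hφR x hx]; simp
    · filter_upwards [ae_tendsto_mollify h.1] with x hx
      have : Tendsto (fun k => fderiv ℝ F (mollify k u x)) atTop (𝓝 (fderiv ℝ F (u x))) :=
        ((hF.continuous_fderiv (by simp)).tendsto _).comp hx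
      exact (((ContinuousLinearMap.apply ℝ ℝ (du x)).continuous.tendsto _).comp this).const_mul _
  have hlim3 : Tendsto (fun k => ∫ x, φ x * fderiv ℝ F (mollify k u x) (mollify k du x - du x))
      atTop (𝓝 0) := by
    rw [tendsto_zero_iff_enorm_tendsto_zero]
    have hz : Tendsto (fun k => ENNReal.ofReal (Cφ * L) *
        ∫⁻ x in Metric.closedBall 0 R, ‖mollify k du x - du x‖ₑ) atTop (𝓝 0) := by
      have := ENNReal.Tendsto.const_mul (tendsto_mollify_of_locallyIntegrable h.2.1 R)
        (a := ENNReal.ofReal (Cφ * L)) (Or.inr ENNReal.ofReal_ne_top)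
      simpa using this
    refine tendsto_of_tendsto_of_tendsto_of_le_of_le tendsto_const_nhds hz
      (fun _ => zero_le) fun k => ?_
    refine (enorm_integral_le_lintegral_enorm _).trans ?_
    rw [← lintegral_const_mul' _ _ ENNReal.ofReal_ne_top,
      ← lintegral_indicator measurableSet_closedBall]
    refine lintegral_mono fun x => ?_
    beta_reduce
    by_cases hx : x ∈ Metric.closedBall (0 : X) R
    · rw [indicator_of_mem hx, ← ofReal_norm, ← ofReal_norm,
        ← ENNReal.ofReal_mul' (norm_nonneg _), norm_mul]
      refine ENNReal.ofReal_le_ofReal ?_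
      rw [mul_assoc]
      exact mul_le_mul (hCφ x) ((ContinuousLinearMap.le_opNorm _ _).trans
          (mul_le_mul_of_nonneg_right (hL _) (norm_nonneg _))) (norm_nonneg _)
          ((norm_nonneg _).trans (hCφ x))
    · rw [indicator_of_notMem hx, hφR x hx]; simp
  have hint : ∀ (k : ℕ) (g : X → V), LocallyIntegrable g →
      Integrable (fun x => φ x * fderiv ℝ F (mollify k u x) (g x)) := by
    intro k g hg
    have hgR : IntegrableOn g (Metric.closedBall (0 : X) R) :=
      hg.integrableOn_isCompact (isCompact_closedBall _ _)
    refine Integrable.mono' ((integrable_indicator_iff measurableSet_closedBall).2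
        ((hgR.norm.const_mul L).const_mul Cφ)) (hφ.continuous.aestronglyMeasurable.mul
        ((ContinuousLinearMap.id ℝ (V →L[ℝ] ℝ)).aestronglyMeasurable_comp₂
          (hcF k).aestronglyMeasurable hg.aestronglyMeasurable))
        (Eventually.of_forall fun x => ?_)
    by_cases hx : x ∈ Metric.closedBall (0 : X) R
    · rw [indicator_of_mem hx, norm_mul]
      exact mul_le_mul (hCφ x) ((ContinuousLinearMap.le_opNorm _ _).trans
          (mul_le_mul_of_nonneg_right (hL _) (norm_nonneg _))) (norm_nonneg _)
          ((norm_nonneg _).trans (hCφ x))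
    · rw [indicator_of_notMem hx, hφR x hx]; simp
  have hsum : ∀ k, ∫ x, φ x * fderiv ℝ F (mollify k u x) (mollify k du x)
      = (∫ x, φ x * fderiv ℝ F (mollify k u x) (mollify k du x - du x))
        + ∫ x, φ x * fderiv ℝ F (mollify k u x) (du x) := by
    intro k
    rw [← integral_add]
    · refine integral_congr_ae (Eventually.of_forall fun x => ?_)
      simp only [map_sub]; ring
    · exact hint k _ ((mollify_contDiff k h.2.1).continuous.locallyIntegrable.sub h.2.1)
    · exact hint k _ h.2.1
  simp only [smul_eq_mul]
  refine tendsto_nhds_unique hlim1 ?_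
  simp only [hparts, hsum]
  simpa using (hlim3.add hlim2).neg

end Mollification

/-! ### Rules for weak derivatives and the Sobolev inequality in W^{1,1} -/

section WeakDeriv

open scoped ENNReal NNReal

variable {X V W : Type*} [NormedAddCommGroup X] [InnerProductSpace ℝ X] [FiniteDimensional ℝ X]
  [MeasurableSpace X] [BorelSpace X] [NormedAddCommGroup V] [NormedSpace ℝ V]
  [CompleteSpace V] [NormedAddCommGroup W] [NormedSpace ℝ W] [CompleteSpace W]

lemma integrable_test_smul {u : X → V} (hu : LocallyIntegrable u) {φ : X → ℝ} (hφ : Continuous φ)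
    (hc : HasCompactSupport φ) : Integrable (fun x => φ x • u x) :=
  hu.integrable_smul_left_of_hasCompactSupport hφ hc

lemma continuous_fderiv_test {φ : X → ℝ} (hφ : ContDiff ℝ 1 φ) (v : X) :
    Continuous (fun x => fderiv ℝ φ x v) :=
  (hφ.continuous_fderiv (by simp)).clm_apply continuous_const

lemma hasCompactSupport_fderiv_test {φ : X → ℝ} (hc : HasCompactSupport φ) (v : X) :
    HasCompactSupport (fun x => fderiv ℝ φ x v) :=
  (hc.fderiv (𝕜 := ℝ)).comp_left (g := fun A : X →L[ℝ] ℝ => A v) (by simp)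

lemma IsWeakDeriv.congr {v : X} {u u' du du' : X → V} (h : IsWeakDeriv v u du)
    (hu : u =ᵐ[volume] u') (hd : du =ᵐ[volume] du') : IsWeakDeriv v u' du' := by
  refine ⟨?_, ?_, fun φ hφ hc => ?_⟩
  · exact (locallyIntegrable_congr hu).1 h.1
  · exact (locallyIntegrable_congr hd).1 h.2.1
  · have h1 := h.2.2 φ hφ hc
    rw [integral_congr_ae (g := fun x => fderiv ℝ φ x v • u' x)
        (by filter_upwards [hu] with x hx; rw [hx]),
      integral_congr_ae (f := fun x => φ x • du x) (g := fun x => φ x • du' x)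
        (by filter_upwards [hd] with x hx; rw [hx])] at h1
    exact h1

lemma IsWeakDeriv.ae_unique {v : X} {u d₁ d₂ : X → V} (h₁ : IsWeakDeriv v u d₁)
    (h₂ : IsWeakDeriv v u d₂) : ∀ᵐ x, d₁ x = d₂ x := by
  refine ae_eq_of_integral_contDiff_smul_eq h₁.2.1 h₂.2.1 fun φ hφ hc => ?_
  have := (h₁.2.2 φ hφ hc).symm.trans (h₂.2.2 φ hφ hc)
  exact neg_injective this

/-- Pairing makes the chain rule `IsWeakDeriv.comp` available for functions of both fields and of a
coefficient at once, which replaces a product rule for weakly differentiable factors. -/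
lemma IsWeakDeriv.prodMk {v : X} {u du : X → V} {u' du' : X → W} (h : IsWeakDeriv v u du)
    (h' : IsWeakDeriv v u' du') :
    IsWeakDeriv v (fun x => (u x, u' x)) (fun x => (du x, du' x)) := by
  have hl : ∀ {f : X → V} {g : X → W}, LocallyIntegrable f → LocallyIntegrable g →
      LocallyIntegrable (fun x => (f x, g x)) := by
    intro f g hf hg
    rw [locallyIntegrable_iff] at hf hg ⊢
    exact fun K hK => (hf K hK).prodMk (hg K hK)
  refine ⟨hl h.1 h'.1, hl h.2.1 h'.2.1, fun φ hφ hc => ?_⟩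
  have hφ1 : ContDiff ℝ 1 φ := hφ.of_le (by simp)
  have e1 : ∀ x, fderiv ℝ φ x v • (u x, u' x) = (fderiv ℝ φ x v • u x, fderiv ℝ φ x v • u' x) :=
    fun x => rfl
  have e2 : ∀ x, φ x • (du x, du' x) = (φ x • du x, φ x • du' x) := fun x => rfl
  simp only [e1, e2]
  rw [integral_pair, integral_pair, h.2.2 φ hφ hc, h'.2.2 φ hφ hc]
  · rfl
  · exact integrable_test_smul h.2.1 hφ.continuous hc
  · exact integrable_test_smul h'.2.1 hφ.continuous hc
  · exact integrable_test_smul h.1 (continuous_fderiv_test hφ1 v)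
      (hasCompactSupport_fderiv_test hc v)
  · exact integrable_test_smul h'.1 (continuous_fderiv_test hφ1 v)
      (hasCompactSupport_fderiv_test hc v)

lemma fderiv_mul_apply' {φ ψ : X → ℝ} (hφ : Differentiable ℝ φ) (hψ : Differentiable ℝ ψ) (x v : X) :
    fderiv ℝ (fun x => φ x * ψ x) x v = φ x * fderiv ℝ ψ x v + ψ x * fderiv ℝ φ x v := by
  have := ((hφ x).hasFDerivAt.mul (hψ x).hasFDerivAt).fderiv
  have h2 := congrArg (fun A : X →L[ℝ] ℝ => A v) this
  simpa [Pi.mul_def] using h2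

/-- The product rule for a weakly differentiable and a smooth function. -/
lemma IsWeakDeriv.smooth_mul {v : X} {u du : X → ℝ} (h : IsWeakDeriv v u du) {ψ : X → ℝ}
    (hψ : ContDiff ℝ ∞ ψ) :
    IsWeakDeriv v (fun x => ψ x * u x) (fun x => ψ x * du x + fderiv ℝ ψ x v * u x) := by
  have hψ1 : ContDiff ℝ 1 ψ := hψ.of_le (by simp)
  have hl : ∀ {f g : X → ℝ}, LocallyIntegrable f → Continuous g →
      LocallyIntegrable (fun x => g x * f x) := by
    intro f g hf hg
    rw [locallyIntegrable_iff] at hf ⊢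
    exact fun K hK => (hf K hK).continuousOn_mul hg.continuousOn hK
  have l2 := hl h.1 (continuous_fderiv_test hψ1 v)
  have l1 := hl h.2.1 hψ.continuous
  refine ⟨hl h.1 hψ.continuous, l1.add l2, fun φ hφ hc => ?_⟩
  have hφ1 : ContDiff ℝ 1 φ := hφ.of_le (by simp)
  have key := h.2.2 (fun x => φ x * ψ x) (hφ.mul hψ) hc.mul_right
  simp only [smul_eq_mul] at key ⊢
  simp only [fderiv_mul_apply' (hφ.differentiable (by simp)) (hψ.differentiable (by simp))] at key
  have i1 : Integrable fun x => fderiv ℝ φ x v * (ψ x * u x) :=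
    integrable_test_smul (hl h.1 hψ.continuous) (continuous_fderiv_test hφ1 v)
      (hasCompactSupport_fderiv_test hc v)
  have i2 : Integrable fun x => φ x * (fderiv ℝ ψ x v * u x) :=
    integrable_test_smul l2 hφ.continuous hc
  have i3 : Integrable fun x => φ x * (ψ x * du x) := integrable_test_smul l1 hφ.continuous hc
  have e1 : ∫ x, (φ x * fderiv ℝ ψ x v + ψ x * fderiv ℝ φ x v) * u x
      = (∫ x, φ x * (fderiv ℝ ψ x v * u x)) + ∫ x, fderiv ℝ φ x v * (ψ x * u x) := by
    rw [← integral_add i2 i1]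
    exact integral_congr_ae (Eventually.of_forall fun x => by ring)
  have e2 : ∫ x, φ x * (ψ x * du x + fderiv ℝ ψ x v * u x)
      = (∫ x, φ x * (ψ x * du x)) + ∫ x, φ x * (fderiv ℝ ψ x v * u x) := by
    rw [← integral_add i3 i2]
    exact integral_congr_ae (Eventually.of_forall fun x => by ring)
  have e3 : ∫ x, φ x * ψ x * du x = ∫ x, φ x * (ψ x * du x) :=
    integral_congr_ae (Eventually.of_forall fun x => by ring)
  rw [e1, e3] at key
  rw [e2]
  linarith

/-- A bump function on the ball of radius `2`. -/
noncomputable def unitBump (X : Type*) [NormedAddCommGroup X] : ContDiffBump (0 : X) where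
  rIn := 1
  rOut := 2
  rIn_pos := one_pos
  rIn_lt_rOut := one_lt_two

/-- A smooth cutoff function which is `1` on the ball of radius `k + 1`. -/
noncomputable def cutoff (X : Type*) [NormedAddCommGroup X] [InnerProductSpace ℝ X] (k : ℕ)
    (x : X) : ℝ :=
  unitBump X ((1 / ((k : ℝ) + 1)) • x)

lemma cutoff_contDiff (k : ℕ) : ContDiff ℝ ∞ (cutoff X k) :=
  (unitBump X).contDiff.comp (contDiff_const_smul _)

lemma cutoff_nonneg (k : ℕ) (x : X) : 0 ≤ cutoff X k x := (unitBump X).nonneg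

lemma cutoff_le_one (k : ℕ) (x : X) : cutoff X k x ≤ 1 := (unitBump X).le_one

lemma cutoff_hasCompactSupport (k : ℕ) : HasCompactSupport (cutoff X k) :=
  (unitBump X).hasCompactSupport.comp_smul (by positivity)

lemma cutoff_tendsto (x : X) : Tendsto (fun k => cutoff X k x) atTop (𝓝 1) := by
  refine tendsto_const_nhds.congr' ?_
  obtain ⟨n, hn⟩ := exists_nat_ge ‖x‖
  filter_upwards [eventually_ge_atTop n] with k hk
  refine ((unitBump X).one_of_mem_closedBall ?_).symm
  have hk' : (n : ℝ) ≤ k := by exact_mod_cast hk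
  have : (0 : ℝ) < (k : ℝ) + 1 := by positivity
  simp only [Metric.mem_closedBall, dist_zero_right, norm_smul, norm_div, norm_one,
    Real.norm_of_nonneg this.le]
  change 1 / ((k : ℝ) + 1) * ‖x‖ ≤ 1
  rw [one_div, inv_mul_le_iff₀ this]
  linarith

lemma exists_cutoff_fderiv_bound (X : Type*) [NormedAddCommGroup X] [InnerProductSpace ℝ X]
    [FiniteDimensional ℝ X] :
    ∃ B : ℝ, 0 ≤ B ∧ ∀ (k : ℕ) (x : X), ‖fderiv ℝ (cutoff X k) x‖ ≤ B / ((k : ℝ) + 1) := by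
  have hc : Continuous (fderiv ℝ (unitBump X)) :=
    ((unitBump X).contDiff (n := 1)).continuous_fderiv (by simp)
  obtain ⟨B, hB⟩ := hc.bounded_above_of_compact_support
    ((unitBump X).hasCompactSupport.fderiv (𝕜 := ℝ))
  refine ⟨B, (norm_nonneg _).trans (hB 0), fun k x => ?_⟩
  have h1 := (((unitBump X).contDiff (n := 1)).differentiable (by simp)
    ((1 / ((k : ℝ) + 1)) • x)).hasFDerivAt.comp x
    (((ContinuousLinearMap.id ℝ X).hasFDerivAt (x := x)).const_smul (1 / ((k : ℝ) + 1)))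
  have h2 : fderiv ℝ (cutoff X k) x = _ := h1.fderiv
  rw [h2, ContinuousLinearMap.comp_smul, ContinuousLinearMap.comp_id, norm_smul, Real.norm_of_nonneg
    (by positivity), div_eq_mul_inv B, mul_comm, one_div]
  exact mul_le_mul_of_nonneg_right (hB _) (by positivity)

lemma tendsto_mul_cutoff_integral {f : X → ℝ} (hf : Integrable f) :
    Tendsto (fun k => ∫ x, f x * cutoff X k x) atTop (𝓝 (∫ x, f x)) := by
  refine tendsto_integral_of_dominated_convergence (fun x => ‖f x‖) ?_ hf.norm ?_ ?_
  · exact fun k => hf.aestronglyMeasurable.mul (cutoff_contDiff k).continuous.aestronglyMeasurable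
  · refine fun k => Eventually.of_forall fun x => ?_
    rw [norm_mul, Real.norm_of_nonneg (cutoff_nonneg k x)]
    exact mul_le_of_le_one_right (norm_nonneg _) (cutoff_le_one k x)
  · exact Eventually.of_forall fun x => by simpa using (cutoff_tendsto x).const_mul (f x)

/-- Integrable weak derivatives may be tested with bounded smooth functions. -/
lemma IsWeakDeriv.integral_of_bounded {v : X} {u du : X → ℝ} (h : IsWeakDeriv v u du)
    (hu : Integrable u) (hd : Integrable du) {ψ : X → ℝ} (hψ : ContDiff ℝ ∞ ψ) {C L : ℝ}
    (hC : ∀ x, |ψ x| ≤ C) (hL : ∀ x, |fderiv ℝ ψ x v| ≤ L) :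
    ∫ x, fderiv ℝ ψ x v * u x = - ∫ x, ψ x * du x := by
  have hψ1 : ContDiff ℝ 1 ψ := hψ.of_le (by simp)
  obtain ⟨B, hB0, hB⟩ := exists_cutoff_fderiv_bound X
  have i1 : Integrable (fun x => fderiv ℝ ψ x v * u x) :=
    hu.bdd_mul (continuous_fderiv_test hψ1 v).aestronglyMeasurable (Eventually.of_forall hL)
  have i2 : Integrable (fun x => ψ x * du x) :=
    hd.bdd_mul hψ.continuous.aestronglyMeasurable (Eventually.of_forall hC)
  have i3 : ∀ k, Integrable (fun x => fderiv ℝ (cutoff X k) x v * (ψ x * u x)) := fun k =>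
    integrable_test_smul (hu.bdd_mul hψ.continuous.aestronglyMeasurable
      (Eventually.of_forall hC)).locallyIntegrable
      (continuous_fderiv_test ((cutoff_contDiff k).of_le (by simp)) v)
      (hasCompactSupport_fderiv_test (cutoff_hasCompactSupport k) v)
  have key : ∀ k, (∫ x, (fderiv ℝ ψ x v * u x) * cutoff X k x)
      + (∫ x, fderiv ℝ (cutoff X k) x v * (ψ x * u x)) = - ∫ x, (ψ x * du x) * cutoff X k x := by
    intro k
    have := h.2.2 (fun x => ψ x * cutoff X k x) (hψ.mul (cutoff_contDiff k))
      (cutoff_hasCompactSupport k).mul_left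
    simp only [smul_eq_mul, fderiv_mul_apply' (hψ.differentiable (by simp))
      ((cutoff_contDiff k).differentiable (by simp))] at this
    have i1k : Integrable (fun x => (fderiv ℝ ψ x v * u x) * cutoff X k x) :=
      i1.mul_bdd (c := 1) (cutoff_contDiff k).continuous.aestronglyMeasurable
        (Eventually.of_forall fun x => by
          rw [Real.norm_of_nonneg (cutoff_nonneg k x)]; exact cutoff_le_one k x)
    rw [← integral_add i1k (i3 k)]
    have e : ∫ x, (ψ x * du x) * cutoff X k x = ∫ x, ψ x * cutoff X k x * du x :=
      integral_congr_ae (Eventually.of_forall fun x => by ring)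
    rw [e, ← this]
    exact integral_congr_ae (Eventually.of_forall fun x => by ring)
  -- The gradient of the cutoff is of size B/(k+1) and is tested against an integrable function.
  have l3 : Tendsto (fun k => ∫ x, fderiv ℝ (cutoff X k) x v * (ψ x * u x)) atTop (𝓝 0) := by
    have hz : Tendsto (fun k : ℕ => B * ‖v‖ * C * (∫ x, |u x|) * (1 / ((k : ℝ) + 1))) atTop
        (𝓝 0) := by
      simpa using (tendsto_one_div_add_atTop_nhds_zero_nat (𝕜 := ℝ)).const_mul
        (B * ‖v‖ * C * ∫ x, |u x|)
    refine squeeze_zero_norm (fun k => ?_) hz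
    refine (norm_integral_le_integral_norm _).trans ?_
    rw [mul_right_comm, ← integral_const_mul]
    refine integral_mono (i3 k).norm (hu.norm.const_mul _) fun x => ?_
    simp only [norm_mul, Real.norm_eq_abs]
    have h1 : |fderiv ℝ (cutoff X k) x v| ≤ B / ((k : ℝ) + 1) * ‖v‖ :=
      (ContinuousLinearMap.le_opNorm _ _).trans
        (mul_le_mul_of_nonneg_right (hB k x) (norm_nonneg _))
    calc |fderiv ℝ (cutoff X k) x v| * (|ψ x| * |u x|)
        ≤ (B / ((k : ℝ) + 1) * ‖v‖) * (C * |u x|) := by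
          refine mul_le_mul h1 (mul_le_mul_of_nonneg_right (hC x) (abs_nonneg _)) (by positivity)
            (by positivity)
      _ = _ := by ring
  have := ((tendsto_mul_cutoff_integral i1).add l3)
  simp only [key, add_zero] at this
  exact tendsto_nhds_unique this (tendsto_mul_cutoff_integral i2).neg

/-- The Sobolev inequality in `W^{1,1}`. -/
lemma eLpNorm_le_of_isWeakDeriv {ι : Type*} [Fintype ι] (b : OrthonormalBasis ι ℝ X) {p : ℝ≥0}
    (hp : NNReal.HolderConjugate (Module.finrank ℝ X) p) {u : X → ℝ} {d : ι → X → ℝ}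
    (hd : ∀ i, IsWeakDeriv (b i) u (d i)) (hu : Integrable u) :
    eLpNorm u p volume ≤ eLpNormLESNormFDerivOneConst (volume : Measure X) p *
      ∑ i, ∫⁻ x, ‖d i x‖ₑ := by
  obtain ⟨B, hB0, hB⟩ := exists_cutoff_fderiv_bound X
  set C := eLpNormLESNormFDerivOneConst (volume : Measure X) p with hCdef
  -- These approximants are C¹ with compact support, so the classical inequality applies to them;
  -- Fatou's lemma gives the limit.
  set U : ℕ → X → ℝ := fun k x => cutoff X k x * mollify k u x with hU
  have hUc : ∀ k, ContDiff ℝ 1 (U k) := fun k =>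
    ((cutoff_contDiff k).of_le (by simp)).mul (mollify_contDiff k hu.locallyIntegrable)
  have hUs : ∀ k, HasCompactSupport (U k) := fun k => (cutoff_hasCompactSupport k).mul_right
  have hopn : ∀ A : X →L[ℝ] ℝ, ‖A‖ₑ ≤ ∑ i, ‖A (b i)‖ₑ := by
    intro A
    have h1 : ‖A‖ ≤ ∑ i, ‖A (b i)‖ := by
      refine A.opNorm_le_bound (Finset.sum_nonneg fun _ _ => norm_nonneg _) fun x => ?_
      calc ‖A x‖ = ‖∑ i, inner ℝ (b i) x * A (b i)‖ := by
            conv_lhs => rw [← b.sum_repr' x]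
            simp [map_sum]
        _ ≤ ∑ i, ‖inner ℝ (b i) x * A (b i)‖ := norm_sum_le _ _
        _ ≤ ∑ i, ‖A (b i)‖ * ‖x‖ := by
            refine Finset.sum_le_sum fun i _ => ?_
            rw [norm_mul, mul_comm]
            refine mul_le_mul_of_nonneg_left ?_ (norm_nonneg _)
            simpa using norm_inner_le_norm (𝕜 := ℝ) (b i) x
        _ = _ := by rw [Finset.sum_mul]
    calc ‖A‖ₑ = ENNReal.ofReal ‖A‖ := (ofReal_norm A).symm
      _ ≤ ENNReal.ofReal (∑ i, ‖A (b i)‖) := ENNReal.ofReal_le_ofReal h1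
      _ = _ := by
        rw [ENNReal.ofReal_sum_of_nonneg fun _ _ => norm_nonneg _]
        simp only [ofReal_norm]
  have hder : ∀ k i, ∫⁻ x, ‖fderiv ℝ (U k) x (b i)‖ₑ ≤ (∫⁻ x, ‖d i x‖ₑ) +
      ENNReal.ofReal (B / ((k : ℝ) + 1)) * ∫⁻ x, ‖u x‖ₑ := by
    intro k i
    have hm1 := mollify_contDiff k hu.locallyIntegrable
    have hm2 := mollify_contDiff k (hd i).2.1
    calc ∫⁻ x, ‖fderiv ℝ (U k) x (b i)‖ₑ
        ≤ ∫⁻ x, (‖mollify k (d i) x‖ₑ + ENNReal.ofReal (B / ((k : ℝ) + 1)) * ‖mollify k u x‖ₑ) := by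
          refine lintegral_mono fun x => ?_
          rw [hU]
          beta_reduce
          rw [fderiv_mul_apply' ((cutoff_contDiff k).differentiable (by simp))
            (hm1.differentiable (by simp)), (hd i).fderiv_mollify]
          refine (enorm_add_le _ _).trans (add_le_add ?_ ?_)
          · rw [enorm_mul]
            refine mul_le_of_le_one_left' ?_
            rw [Real.enorm_of_nonneg (cutoff_nonneg k x)]
            exact ENNReal.ofReal_le_one.2 (cutoff_le_one k x)
          · rw [enorm_mul, mul_comm]
            refine mul_le_mul_left ?_ _
            rw [← ofReal_norm]
            refine ENNReal.ofReal_le_ofReal ((ContinuousLinearMap.le_opNorm _ _).trans ?_)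
            simpa using hB k x
      _ = (∫⁻ x, ‖mollify k (d i) x‖ₑ) +
          ENNReal.ofReal (B / ((k : ℝ) + 1)) * ∫⁻ x, ‖mollify k u x‖ₑ := by
          rw [lintegral_add_left hm2.continuous.enorm.measurable,
            lintegral_const_mul _ hm1.continuous.enorm.measurable]
      _ ≤ _ := by
          exact add_le_add (lintegral_mollify_le k (hd i).2.1)
            (mul_le_mul_right (lintegral_mollify_le k hu.locallyIntegrable) _)
  have hUk : ∀ k, eLpNorm (U k) p volume ≤ C * ∑ i, ((∫⁻ x, ‖d i x‖ₑ) +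
      ENNReal.ofReal (B / ((k : ℝ) + 1)) * ∫⁻ x, ‖u x‖ₑ) := by
    intro k
    refine (eLpNorm_le_eLpNorm_fderiv_one volume (hUc k) (hUs k) hp).trans ?_
    refine mul_le_mul_right ?_ _
    rw [eLpNorm_one_eq_lintegral_enorm]
    calc ∫⁻ x, ‖fderiv ℝ (U k) x‖ₑ ≤ ∫⁻ x, ∑ i, ‖fderiv ℝ (U k) x (b i)‖ₑ :=
          lintegral_mono fun x => hopn _
      _ = ∑ i, ∫⁻ x, ‖fderiv ℝ (U k) x (b i)‖ₑ :=
          lintegral_finsetSum _ fun i _ => (continuous_fderiv_test (hUc k) _).enorm.measurable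
      _ ≤ _ := Finset.sum_le_sum fun i _ => hder k i
  have hlim : ∀ᵐ x, Tendsto (fun k => U k x) atTop (𝓝 (u x)) := by
    filter_upwards [ae_tendsto_mollify hu.locallyIntegrable] with x hx
    simpa using (cutoff_tendsto x).mul hx
  refine (Lp.eLpNorm_lim_le_liminf_eLpNorm
    (fun k => (hUc k).continuous.aestronglyMeasurable) u hlim).trans ?_
  refine (liminf_le_liminf (Eventually.of_forall hUk)).trans (le_of_eq ?_)
  refine Tendsto.liminf_eq ?_
  have hi : ∫⁻ x, ‖u x‖ₑ ≠ ⊤ := hu.2.ne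
  refine ENNReal.Tendsto.const_mul ?_ (Or.inr ENNReal.coe_ne_top)
  refine tendsto_finsetSum _ fun i _ => ?_
  have h0 : Tendsto (fun k : ℕ => ENNReal.ofReal (B / ((k : ℝ) + 1)) * ∫⁻ x, ‖u x‖ₑ) atTop
      (𝓝 0) := by
    have : Tendsto (fun k : ℕ => ENNReal.ofReal (B / ((k : ℝ) + 1))) atTop (𝓝 0) := by
      have h := (tendsto_one_div_add_atTop_nhds_zero_nat (𝕜 := ℝ)).const_mul B
      have h2 := ENNReal.tendsto_ofReal h
      simpa [div_eq_mul_inv] using h2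
    simpa using ENNReal.Tendsto.mul_const this (Or.inr hi)
  simpa using h0.const_add (∫⁻ x, ‖d i x‖ₑ)

end WeakDeriv

/-! ### Functions whose truncations are weakly differentiable -/

section Truncated

variable {N : ℕ}

/-- The `j`-th coordinate direction. -/
noncomputable abbrev coordDir (j : Fin N) : Space N := EuclideanSpace.single j 1

/-- `g` plays the role of the gradient of `w` after truncating `w` away from `0` and from `∞`. -/
def HasTruncatedGrad (w : Space N → ℝ) (g : Space N → Space N) : Prop :=
  ∀ (h : ℝ → ℝ) (ε K : ℝ), Continuous h → 0 < ε → (∀ s ≤ ε, h s = 0) → (∀ s, K ≤ s → h s = 0) →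
    ∀ j, IsWeakDeriv (coordDir j) (fun x => ∫ s in (0 : ℝ)..w x, h s) (fun x => h (w x) * g x j)

lemma HasWeakGrad.isWeakDeriv {u : Space N → ℝ} {G : Space N → Space N} (h : HasWeakGrad u G)
    (j : Fin N) : IsWeakDeriv (coordDir j) u (fun x => G x j) := by
  refine ⟨h.1, ?_, fun φ hφ hc => ?_⟩
  · have h2 := h.2.1
    rw [locallyIntegrable_iff] at h2 ⊢
    exact fun K hK => (EuclideanSpace.proj (𝕜 := ℝ) j).integrable_comp (h2 K hK)
  · have := h.2.2 φ hφ hc j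
    simpa [mul_comm] using this

lemma HasWeakVecGrad.isWeakDeriv {u : Space N → Vec3} {G : Space N → GradVal N}
    (h : HasWeakVecGrad u G) (j : Fin N) : IsWeakDeriv (coordDir j) u (fun x => G x j) := by
  have hk := fun k => (h k).isWeakDeriv j
  have hl : ∀ f : Space N → Vec3, (∀ k, LocallyIntegrable (fun x => f x k)) →
      LocallyIntegrable f := by
    intro f hf
    simp only [locallyIntegrable_iff] at hf ⊢
    intro K hK
    have : IntegrableOn (fun x => (EuclideanSpace.equiv (Fin 3) ℝ) (f x)) K :=
      Integrable.of_eval fun k => hf k K hK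
    exact ((EuclideanSpace.equiv (Fin 3) ℝ).integrable_comp_iff).1 this
  have l1 := hl u fun k => (hk k).1
  have l2 := hl (fun x => G x j) fun k => (hk k).2.1
  refine ⟨l1, l2, fun φ hφ hc => ?_⟩
  have hφ1 : ContDiff ℝ 1 φ := hφ.of_le (by simp)
  have i1 := integrable_test_smul l1 (continuous_fderiv_test hφ1 (coordDir j))
      (hasCompactSupport_fderiv_test hc _)
  have i2 := integrable_test_smul l2 hφ.continuous hc
  ext k
  have e1 := (EuclideanSpace.proj (𝕜 := ℝ) k).integral_comp_comm i1
  have e2 := (EuclideanSpace.proj (𝕜 := ℝ) k).integral_comp_comm i2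
  have := (hk k).2.2 φ hφ hc
  exact e1.symm.trans (this.trans (congrArg Neg.neg e2))

lemma contDiff_primitive {h : ℝ → ℝ} (hh : Continuous h) :
    ContDiff ℝ 1 (fun y => ∫ s in (0 : ℝ)..y, h s) := by
  have hd : ∀ y, HasDerivAt (fun y => ∫ s in (0 : ℝ)..y, h s) (h y) y := fun y =>
    hh.integral_hasStrictDerivAt 0 y |>.hasDerivAt
  refine contDiff_one_iff_deriv.2 ⟨fun y => (hd y).differentiableAt, by
    rw [show deriv (fun y => ∫ s in (0 : ℝ)..y, h s) = h from funext fun y => (hd y).deriv]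
    exact hh⟩

lemma hasDerivAt_primitive {h : ℝ → ℝ} (hh : Continuous h) (y : ℝ) :
    HasDerivAt (fun y => ∫ s in (0 : ℝ)..y, h s) (h y) y :=
  (hh.integral_hasStrictDerivAt 0 y).hasDerivAt

lemma hasCompactSupport_of_zero {h : ℝ → ℝ} {ε K : ℝ} (h0 : ∀ s ≤ ε, h s = 0)
    (hK : ∀ s, K ≤ s → h s = 0) : HasCompactSupport h :=
  HasCompactSupport.intro (isCompact_Icc (a := ε) (b := K)) fun s hs => by
    simp only [mem_Icc, not_and_or, not_le] at hs
    rcases hs with hs | hs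
    · exact h0 s hs.le
    · exact hK s hs.le

lemma abs_primitive_le {h : ℝ → ℝ} (hh : Continuous h) (hc : HasCompactSupport h) (y : ℝ) :
    |∫ s in (0 : ℝ)..y, h s| ≤ ∫ s, |h s| := by
  have := intervalIntegral.norm_integral_le_integral_norm_uIoc (f := h) (a := 0) (b := y)
    (μ := volume)
  refine this.trans ?_
  exact setIntegral_le_integral (hh.integrable_of_hasCompactSupport hc).norm
    (Eventually.of_forall fun _ => norm_nonneg _)

/-- The energy density of a pair of weakly differentiable fields. -/
lemma hasTruncatedGrad_energy {u v : Space N → Vec3} {Gu Gv : Space N → GradVal N}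
    (hu : HasWeakVecGrad u Gu) (hv : HasWeakVecGrad v Gv) :
    HasTruncatedGrad (fun x => ‖u x‖ ^ 2 + ‖v x‖ ^ 2) (fun x => WithLp.toLp 2 fun j =>
      2 * (inner ℝ (u x) (Gu x j) + inner ℝ (v x) (Gv x j))) := by
  intro h ε K hh hε h0 hK j
  have hc := hasCompactSupport_of_zero h0 hK
  set f : ℝ → ℝ := fun y => ∫ s in (0 : ℝ)..y, h s with hf
  set Q : Vec3 × Vec3 → ℝ := fun z => ‖z.1‖ ^ 2 + ‖z.2‖ ^ 2 with hQ
  have hQc : ContDiff ℝ 1 Q := (contDiff_fst.norm_sq ℝ).add (contDiff_snd.norm_sq ℝ)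
  have hF : ContDiff ℝ 1 (fun z => f (Q z)) := (contDiff_primitive hh).comp hQc
  have hQd : ∀ z, HasFDerivAt Q (2 • (innerSL ℝ z.1).comp (ContinuousLinearMap.fst ℝ Vec3 Vec3)
      + 2 • (innerSL ℝ z.2).comp (ContinuousLinearMap.snd ℝ Vec3 Vec3)) z := by
    intro z
    exact ((hasStrictFDerivAt_norm_sq z.1).hasFDerivAt.comp z hasFDerivAt_fst).add
      ((hasStrictFDerivAt_norm_sq z.2).hasFDerivAt.comp z hasFDerivAt_snd)
  have hFd : ∀ z, fderiv ℝ (fun z => f (Q z)) z = h (Q z) •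
      (2 • (innerSL ℝ z.1).comp (ContinuousLinearMap.fst ℝ Vec3 Vec3)
      + 2 • (innerSL ℝ z.2).comp (ContinuousLinearMap.snd ℝ Vec3 Vec3)) := fun z =>
    ((hasDerivAt_primitive hh (Q z)).comp_hasFDerivAt z (hQd z)).fderiv
  -- Outside the ball of radius K + 1 one field has norm r > K + 1, and r² ≥ r − 1 puts the energy
  -- above K, where h vanishes. This gives the bounded derivative required by the chain rule
  -- although the quadratic energy has none.
  have hsupp : HasCompactSupport (fderiv ℝ (fun z => f (Q z))) := by
    refine HasCompactSupport.intro (K := Metric.closedBall 0 (K + 1))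
      (isCompact_closedBall _ _) fun z hz => ?_
    rw [hFd, hK, zero_smul]
    have hz1 : K + 1 < max ‖z.1‖ ‖z.2‖ := by
      rw [Metric.mem_closedBall, dist_zero_right, not_le] at hz
      exact hz
    rcases lt_max_iff.1 hz1 with h1 | h1
    · have : ‖z.1‖ ≤ ‖z.1‖ ^ 2 + 1 := by nlinarith [sq_nonneg (‖z.1‖ - 1)]
      simp only [hQ]; nlinarith [sq_nonneg ‖z.2‖]
    · have : ‖z.2‖ ≤ ‖z.2‖ ^ 2 + 1 := by nlinarith [sq_nonneg (‖z.2‖ - 1)]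
      simp only [hQ]; nlinarith [sq_nonneg ‖z.1‖]
  obtain ⟨L, hL⟩ := (hF.continuous_fderiv (by simp)).bounded_above_of_compact_support hsupp
  have key := ((hu.isWeakDeriv j).prodMk (hv.isWeakDeriv j)).comp hF
    (fun z => abs_primitive_le hh hc _) hL
  refine key.congr Filter.EventuallyEq.rfl (Eventually.of_forall fun x => ?_)
  beta_reduce
  rw [hFd]
  simp [hQ, two_mul]
  ring

/-- Identification of the weak gradient of a power. -/
lemma HasTruncatedGrad.grad_rpow {w : Space N → ℝ} {g G : Space N → Space N}
    (hg : HasTruncatedGrad w g) (hw : ∀ x, 0 ≤ w x) {c : ℝ} (hc : 0 < c)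
    (hG : HasWeakGrad (fun x => w x ^ c) G) :
    ∀ᵐ x, 0 < w x → ∀ j, G x j = c * w x ^ (c - 1) * g x j := by
  -- The primitive of h evaluated at w^c is differentiated twice: from G by the chain rule, and from
  -- g after the substitution s ↦ s^c. Uniqueness of weak derivatives equates the results. The
  -- weight h is positive exactly on (1/(k+1), k+1), and these intervals exhaust (0, ∞).
  have main : ∀ (k : ℕ) (j : Fin N), ∀ᵐ x,
      max 0 ((w x ^ c - 1 / ((k : ℝ) + 1)) * ((k : ℝ) + 1 - w x ^ c)) * G x j =
      max 0 ((w x ^ c - 1 / ((k : ℝ) + 1)) * ((k : ℝ) + 1 - w x ^ c)) *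
        (c * w x ^ (c - 1) * g x j) := by
    intro k j
    set ε : ℝ := 1 / ((k : ℝ) + 1) with hε
    set K : ℝ := (k : ℝ) + 1 with hK
    have hK0 : 0 < K := by positivity
    have hε0 : 0 < ε := by positivity
    have hεK : ε ≤ K := by
      have h1 : ε ≤ 1 := by
        rw [hε, div_le_one hK0]; simp [hK]
      have h2 : 1 ≤ K := by simp [hK]
      linarith
    set h : ℝ → ℝ := fun s => max 0 ((s - ε) * (K - s)) with hh
    have hhc : Continuous h := by fun_prop
    have h0 : ∀ s ≤ ε, h s = 0 := fun s hs => max_eq_left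
      (mul_nonpos_of_nonpos_of_nonneg (by linarith) (by linarith))
    have hK' : ∀ s, K ≤ s → h s = 0 := fun s hs => max_eq_left
      (mul_nonpos_of_nonneg_of_nonpos (by linarith) (by linarith))
    have hcs := hasCompactSupport_of_zero h0 hK'
    have hfd : ∀ z, fderiv ℝ (fun y => ∫ s in (0 : ℝ)..y, h s) z
        = ContinuousLinearMap.toSpanSingleton ℝ (h z) := fun z =>
      (hasDerivAt_primitive hhc z).hasFDerivAt.fderiv
    obtain ⟨L, hL⟩ := hhc.bounded_above_of_compact_support hcs
    have k1 := (hG.isWeakDeriv j).comp (contDiff_primitive hhc)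
      (fun z => abs_primitive_le hhc hcs z) (L := L) (fun z => by rw [hfd]; simpa using hL z)
    set ε' : ℝ := ε ^ (1 / c) with hε'
    have hε'0 : 0 < ε' := Real.rpow_pos_of_pos hε0 _
    -- The substituted weight h(s^c) c s^(c-1). The maximum with ε' keeps it continuous at 0 when c
    -- < 1 and changes nothing for s ≥ 0, since h(s^c) vanishes for 0 ≤ s ≤ ε'.
    set h1 : ℝ → ℝ := fun s => h ((max s ε') ^ c) * (c * (max s ε') ^ (c - 1)) with hh1
    have hpos : ∀ s, 0 < max s ε' := fun s => lt_max_of_lt_right hε'0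
    have hm : Continuous fun s : ℝ => max s ε' := by fun_prop
    have hh1c : Continuous h1 := by
      refine (hhc.comp (hm.rpow_const fun s => Or.inl (hpos s).ne')).mul
        (continuous_const.mul (hm.rpow_const fun s => Or.inl (hpos s).ne'))
    have hε'c : ε' ^ c = ε := by
      rw [hε', ← Real.rpow_mul hε0.le, one_div_mul_cancel hc.ne', Real.rpow_one]
    have h10 : ∀ s ≤ ε', h1 s = 0 := by
      intro s hs
      simp only [hh1, max_eq_right hs, hε'c, h0 ε le_rfl, zero_mul]
    have h1K : ∀ s, K ^ (1 / c) ≤ s → h1 s = 0 := by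
      intro s hs
      have : K ≤ (max s ε') ^ c := by
        have h2 : (K ^ (1 / c)) ^ c = K := by
          rw [← Real.rpow_mul hK0.le, one_div_mul_cancel hc.ne', Real.rpow_one]
        rw [← h2]
        exact Real.rpow_le_rpow (Real.rpow_nonneg hK0.le _) (hs.trans (le_max_left _ _)) hc.le
      simp only [hh1, hK' _ this, zero_mul]
    have k2 := hg h1 ε' _ hh1c hε'0 h10 h1K j
    have hval : ∀ y, 0 ≤ y → h1 y = h (y ^ c) * (c * y ^ (c - 1)) := by
      intro y hy
      rcases le_total y ε' with h' | h'
      · rw [h10 y h', h0, zero_mul]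
        rw [← hε'c]
        exact Real.rpow_le_rpow hy h' hc.le
      · simp only [hh1, max_eq_left h']
    have hprim : ∀ y, 0 ≤ y → ∫ s in (0 : ℝ)..y, h1 s = ∫ s in (0 : ℝ)..y ^ c, h s := by
      intro y hy
      have hcont : ContinuousOn (fun y : ℝ => ∫ s in (0 : ℝ)..y ^ c, h s) (Icc 0 y) :=
        ((contDiff_primitive hhc).continuous.comp
          (continuous_id.rpow_const fun _ => Or.inr hc.le)).continuousOn
      have := intervalIntegral.integral_eq_sub_of_hasDeriv_right_of_le hy hcont
        (f' := h1) (fun x hx => ?_) (hh1c.intervalIntegrable _ _)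
      · rw [this, Real.zero_rpow hc.ne']; simp
      · rw [hval x hx.1.le]
        exact ((hasDerivAt_primitive hhc (x ^ c)).comp x
          (Real.hasDerivAt_rpow_const (p := c) (Or.inl hx.1.ne'))).hasDerivWithinAt
    have k3 := k2.congr (u' := fun x => ∫ s in (0 : ℝ)..w x ^ c, h s)
      (du' := fun x => h (w x ^ c) * (c * w x ^ (c - 1)) * g x j)
      (Eventually.of_forall fun x => hprim _ (hw x))
      (Eventually.of_forall fun x => by beta_reduce; rw [hval _ (hw x)])
    filter_upwards [k1.ae_unique k3] with x hx
    rw [hfd] at hx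
    simp only [ContinuousLinearMap.toSpanSingleton_apply, smul_eq_mul] at hx
    change h (w x ^ c) * _ = h (w x ^ c) * _
    rw [mul_comm, hx]; ring
  filter_upwards [ae_all_iff.2 fun k => ae_all_iff.2 (main k)] with x hx hpos j
  have hwc : 0 < w x ^ c := Real.rpow_pos_of_pos hpos c
  obtain ⟨n1, hn1⟩ := exists_nat_gt (w x ^ c)
  obtain ⟨n2, hn2⟩ := exists_nat_one_div_lt hwc
  set k := max n1 n2
  have e1 : w x ^ c < (k : ℝ) + 1 := by
    have : (n1 : ℝ) ≤ k := by exact_mod_cast le_max_left n1 n2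
    linarith
  have e2 : 1 / ((k : ℝ) + 1) < w x ^ c := by
    refine lt_of_le_of_lt ?_ hn2
    have : (n2 : ℝ) ≤ k := by exact_mod_cast le_max_right n1 n2
    exact one_div_le_one_div_of_le (by positivity) (by linarith)
  have hpos' : 0 < (w x ^ c - 1 / ((k : ℝ) + 1)) * ((k : ℝ) + 1 - w x ^ c) :=
    mul_pos (by linarith) (by linarith)
  have := hx k j
  rw [max_eq_right hpos'.le] at this
  exact mul_left_cancel₀ hpos'.ne' this

end Truncated

/-! ### Gagliardo–Nirenberg inequality on half spaces -/

section HalfSpace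

open scoped ENNReal NNReal

variable {N : ℕ}

/-- The open half space `{x_N > s}`. -/
def upperHalf (N : ℕ) (s : ℝ) : Set (Space N) := {x | s < lastCoord x}

/-- The last coordinate as a continuous linear functional. -/
noncomputable def lastCoordCLM (N : ℕ) : Space N →L[ℝ] ℝ :=
  if h : 0 < N then EuclideanSpace.proj ⟨N - 1, by omega⟩ else 0

lemma lastCoordCLM_apply (x : Space N) : lastCoordCLM N x = lastCoord x := by
  unfold lastCoordCLM lastCoord
  split_ifs <;> simp

lemma continuous_lastCoord : Continuous (lastCoord : Space N → ℝ) := by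
  simp only [← funext lastCoordCLM_apply]
  exact (lastCoordCLM N).continuous

lemma isOpen_upperHalf (s : ℝ) : IsOpen (upperHalf N s) :=
  isOpen_lt continuous_const continuous_lastCoord

lemma measurableSet_upperHalf (s : ℝ) : MeasurableSet (upperHalf N s) :=
  (isOpen_upperHalf s).measurableSet

lemma lastCoordCLM_coordDir_nonneg (j : Fin N) : 0 ≤ lastCoordCLM N (coordDir j) := by
  unfold lastCoordCLM
  split_ifs
  · change 0 ≤ (EuclideanSpace.single j (1 : ℝ) : Space N) _
    rw [PiLp.single_apply]
    split_ifs <;> simp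
  · simp

lemma norm_lastCoordCLM_le : ‖lastCoordCLM N‖ ≤ 1 := by
  refine ContinuousLinearMap.opNorm_le_bound _ zero_le_one fun x => ?_
  rw [one_mul]
  unfold lastCoordCLM
  split_ifs
  · exact PiLp.norm_apply_le x _
  · simp

lemma deriv_smoothTransition_nonneg (y : ℝ) : 0 ≤ deriv Real.smoothTransition y :=
  Real.smoothTransition.monotone.deriv_nonneg

lemma deriv_smoothTransition_of_nonpos {y : ℝ} (hy : y ≤ 0) :
    deriv Real.smoothTransition y = 0 := by
  refine IsLocalMin.deriv_eq_zero (Eventually.of_forall fun z => ?_)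
  rw [Real.smoothTransition.zero_of_nonpos hy]
  exact Real.smoothTransition.nonneg z

lemma deriv_smoothTransition_of_one_le {y : ℝ} (hy : 1 ≤ y) :
    deriv Real.smoothTransition y = 0 := by
  refine IsLocalMax.deriv_eq_zero (Eventually.of_forall fun z => ?_)
  rw [Real.smoothTransition.one_of_one_le hy]
  exact Real.smoothTransition.le_one z

lemma exists_deriv_smoothTransition_le :
    ∃ B : ℝ, 0 ≤ B ∧ ∀ y, deriv Real.smoothTransition y ≤ B := by
  have hc : Continuous (deriv Real.smoothTransition) :=
    (Real.smoothTransition.contDiff (n := 1)).continuous_deriv (by simp)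
  obtain ⟨B, hB⟩ := hc.bounded_above_of_compact_support
    (HasCompactSupport.intro (isCompact_Icc (a := 0) (b := 1)) fun y hy => by
      simp only [mem_Icc, not_and_or, not_le] at hy
      rcases hy with hy | hy
      · exact deriv_smoothTransition_of_nonpos hy.le
      · exact deriv_smoothTransition_of_one_le hy.le)
  exact ⟨B, (norm_nonneg _).trans (hB 0), fun y => (le_abs_self _).trans (hB y)⟩

/-- A smooth function increasing in the last coordinate from `0` on `{x_N ≤ s}` to `1` on
`{x_N ≥ s + h}`. -/
noncomputable def halfCutoff (N : ℕ) (s h : ℝ) (x : Space N) : ℝ :=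
  Real.smoothTransition ((lastCoordCLM N x - s) / h)

lemma halfCutoff_contDiff (s h : ℝ) : ContDiff ℝ ∞ (halfCutoff N s h) :=
  Real.smoothTransition.contDiff.comp
    (((lastCoordCLM N).contDiff.sub contDiff_const).div_const h)

lemma halfCutoff_nonneg (s h : ℝ) (x : Space N) : 0 ≤ halfCutoff N s h x :=
  Real.smoothTransition.nonneg _

lemma halfCutoff_le_one (s h : ℝ) (x : Space N) : halfCutoff N s h x ≤ 1 :=
  Real.smoothTransition.le_one _

lemma halfCutoff_eq_zero {s h : ℝ} (hh : 0 < h) {x : Space N} (hx : lastCoord x ≤ s) :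
    halfCutoff N s h x = 0 :=
  Real.smoothTransition.zero_of_nonpos
    (div_nonpos_of_nonpos_of_nonneg (by rw [lastCoordCLM_apply]; linarith) hh.le)

lemma halfCutoff_eq_one {s h : ℝ} (hh : 0 < h) {x : Space N} (hx : s + h ≤ lastCoord x) :
    halfCutoff N s h x = 1 := by
  refine Real.smoothTransition.one_of_one_le ?_
  rw [le_div_iff₀ hh, lastCoordCLM_apply]
  linarith

lemma fderiv_halfCutoff (s h : ℝ) (x : Space N) : fderiv ℝ (halfCutoff N s h) x =
    (deriv Real.smoothTransition ((lastCoordCLM N x - s) / h) / h) • lastCoordCLM N := by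
  have h1 : HasFDerivAt (fun x => (lastCoordCLM N x - s) / h) (h⁻¹ • lastCoordCLM N) x := by
    simpa [div_eq_inv_mul] using
      ((lastCoordCLM N).hasFDerivAt (x := x) |>.sub_const s).const_mul h⁻¹
  have h2 := ((Real.smoothTransition.contDiff (n := 1)).differentiable (by simp)
    ((lastCoordCLM N x - s) / h)).hasDerivAt.comp_hasFDerivAt x h1
  have h3 : fderiv ℝ (halfCutoff N s h) x = _ := h2.fderiv
  rw [h3, smul_smul]; rfl

/-- This sign makes half-space estimates independent of the width h of the transition layer. -/
lemma fderiv_halfCutoff_coordDir_nonneg {s h : ℝ} (hh : 0 < h) (x : Space N) (j : Fin N) :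
    0 ≤ fderiv ℝ (halfCutoff N s h) x (coordDir j) := by
  rw [fderiv_halfCutoff]
  exact mul_nonneg (div_nonneg (deriv_smoothTransition_nonneg _) hh.le)
    (lastCoordCLM_coordDir_nonneg j)

lemma fderiv_halfCutoff_eq_zero {s h : ℝ} (hh : 0 < h) {x : Space N} (hx : lastCoord x ≤ s) :
    fderiv ℝ (halfCutoff N s h) x = 0 := by
  rw [fderiv_halfCutoff, deriv_smoothTransition_of_nonpos, zero_div, zero_smul]
  exact div_nonpos_of_nonpos_of_nonneg (by rw [lastCoordCLM_apply]; linarith) hh.le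

lemma exists_fderiv_halfCutoff_bound (N : ℕ) :
    ∃ B : ℝ, 0 ≤ B ∧ ∀ (s h : ℝ), 0 < h → ∀ x, ‖fderiv ℝ (halfCutoff N s h) x‖ ≤ B / h := by
  obtain ⟨B, hB0, hB⟩ := exists_deriv_smoothTransition_le
  refine ⟨B, hB0, fun s h hh x => ?_⟩
  rw [fderiv_halfCutoff, norm_smul, Real.norm_of_nonneg
    (div_nonneg (deriv_smoothTransition_nonneg _) hh.le)]
  calc _ ≤ B / h * 1 := mul_le_mul (div_le_div_of_nonneg_right (hB _) hh.le)
          norm_lastCoordCLM_le (norm_nonneg _) (by positivity)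
    _ = _ := mul_one _

lemma tendsto_halfCutoff (s : ℝ) (x : Space N) :
    Tendsto (fun k : ℕ => halfCutoff N s (1 / ((k : ℝ) + 1)) x) atTop
      (𝓝 ((upperHalf N s).indicator 1 x)) := by
  by_cases hx : s < lastCoord x
  · rw [indicator_of_mem (show x ∈ upperHalf N s from hx)]
    refine tendsto_const_nhds.congr' ?_
    obtain ⟨n, hn⟩ := exists_nat_one_div_lt (sub_pos.2 hx)
    filter_upwards [eventually_ge_atTop n] with k hk
    refine (halfCutoff_eq_one (by positivity) ?_).symm
    have : 1 / ((k : ℝ) + 1) ≤ 1 / ((n : ℝ) + 1) :=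
      one_div_le_one_div_of_le (by positivity) (by simpa using hk)
    linarith
  · rw [indicator_of_notMem (show x ∉ upperHalf N s from hx)]
    refine tendsto_const_nhds.congr fun k => ?_
    exact (halfCutoff_eq_zero (by positivity) (not_lt.1 hx)).symm

/-- The `W^{1,1}` Sobolev inequality on a half space for a truncated function. -/
lemma eLpNorm_indicator_primitive_le {p : ℝ≥0} (hp : NNReal.HolderConjugate (N : ℝ≥0) p)
    {w : Space N → ℝ} {g : Space N → Space N} (hg : HasTruncatedGrad w g) (hw : ∀ x, 0 ≤ w x)
    (hwi : Integrable w) {h : ℝ → ℝ} {ε K : ℝ} (hh : Continuous h) (hε : 0 < ε)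
    (h0 : ∀ s ≤ ε, h s = 0) (hK : ∀ s, K ≤ s → h s = 0) (hpos : ∀ s, 0 ≤ h s)
    (hgi : Integrable (fun x => h (w x) * ‖g x‖)) (s : ℝ) :
    eLpNorm ((upperHalf N s).indicator fun x => ∫ r in (0 : ℝ)..w x, h r) p volume ≤
      eLpNormLESNormFDerivOneConst (volume : Measure (Space N)) p *
        (2 * N * ∫⁻ x in upperHalf N s, ENNReal.ofReal (h (w x) * ‖g x‖)) := by
  set u : Space N → ℝ := fun x => ∫ r in (0 : ℝ)..w x, h r with hu
  have hwd : ∀ j, IsWeakDeriv (coordDir j) u (fun x => h (w x) * g x j) :=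
    fun j => hg h ε K hh hε h0 hK j
  have hu0 : ∀ x, 0 ≤ u x := fun x =>
    intervalIntegral.integral_nonneg (hw x) fun r _ => hpos r
  obtain ⟨Ch, hCh⟩ := hh.bounded_above_of_compact_support (hasCompactSupport_of_zero h0 hK)
  rcases Nat.eq_zero_or_pos N with hN | hN
  · subst hN; have := hp.coe.lt; simp at this; norm_num at this
  have hui : Integrable u := by
    refine (hwi.const_mul Ch).mono' (hwd ⟨0, hN⟩).1.aestronglyMeasurable
      (Eventually.of_forall fun x => ?_)
    have := intervalIntegral.norm_integral_le_of_norm_le_const (f := h) (C := Ch) (a := 0)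
      (b := w x) fun r _ => hCh r
    simpa [abs_of_nonneg (hw x)] using this
  have hgj : ∀ j x, ‖h (w x) * g x j‖ ≤ h (w x) * ‖g x‖ := fun j x => by
    rw [norm_mul, Real.norm_of_nonneg (hpos _)]
    exact mul_le_mul_of_nonneg_left (PiLp.norm_apply_le (g x) j) (hpos _)
  have hdi : ∀ j, Integrable (fun x => h (w x) * g x j) := fun j =>
    hgi.mono' (hwd j).2.1.aestronglyMeasurable (Eventually.of_forall fun x => hgj j x)
  obtain ⟨B, hB0, hB⟩ := exists_fderiv_halfCutoff_bound N
  set I := ∫⁻ x in upperHalf N s, ENNReal.ofReal (h (w x) * ‖g x‖) with hI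
  set δ : ℕ → ℝ := fun k => 1 / ((k : ℝ) + 1)
  have hδ : ∀ k, 0 < δ k := fun k => by positivity
  have hcut : ∀ k x, ENNReal.ofReal (halfCutoff N s (δ k) x * (h (w x) * ‖g x‖)) ≤
      (upperHalf N s).indicator (fun x => ENNReal.ofReal (h (w x) * ‖g x‖)) x := by
    intro k x
    by_cases hx : s < lastCoord x
    · rw [indicator_of_mem (show x ∈ upperHalf N s from hx)]
      exact ENNReal.ofReal_le_ofReal (mul_le_of_le_one_left
        (mul_nonneg (hpos _) (norm_nonneg _)) (halfCutoff_le_one _ _ _))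
    · rw [halfCutoff_eq_zero (hδ k) (not_lt.1 hx)]; simp
  have hstep : ∀ k, eLpNorm (fun x => halfCutoff N s (δ k) x * u x) p volume ≤
      eLpNormLESNormFDerivOneConst (volume : Measure (Space N)) p * (2 * N * I) := by
    intro k
    have hfr : Module.finrank ℝ (Space N) = N := by simp
    have hp' : NNReal.HolderConjugate (Module.finrank ℝ (Space N)) p := by rw [hfr]; exact hp
    have h1 := eLpNorm_le_of_isWeakDeriv (EuclideanSpace.basisFun (Fin N) ℝ) hp'
      (u := fun x => halfCutoff N s (δ k) x * u x)
      (d := fun j x => halfCutoff N s (δ k) x * (h (w x) * g x j) +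
        fderiv ℝ (halfCutoff N s (δ k)) x (coordDir j) * u x)
      (fun j => by
        rw [EuclideanSpace.basisFun_apply]
        exact (hwd j).smooth_mul (halfCutoff_contDiff s (δ k)))
      (hui.bdd_mul (c := 1) (halfCutoff_contDiff s (δ k)).continuous.aestronglyMeasurable
        (Eventually.of_forall fun x => by
          rw [Real.norm_of_nonneg (halfCutoff_nonneg _ _ _)]; exact halfCutoff_le_one _ _ _))
    refine h1.trans (mul_le_mul_right ?_ _)
    have hA : ∀ j, ∫⁻ x, ‖halfCutoff N s (δ k) x * (h (w x) * g x j)‖ₑ ≤ I := by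
      intro j
      rw [hI, ← lintegral_indicator (measurableSet_upperHalf s)]
      refine lintegral_mono fun x => (le_trans ?_ (hcut k x))
      rw [← ofReal_norm, norm_mul, Real.norm_of_nonneg (halfCutoff_nonneg _ _ _)]
      exact ENNReal.ofReal_le_ofReal
        (mul_le_mul_of_nonneg_left (hgj j x) (halfCutoff_nonneg _ _ _))
    have hdz : ∀ j x, |fderiv ℝ (halfCutoff N s (δ k)) x (coordDir j)| ≤ B / δ k := fun j x =>
      (ContinuousLinearMap.le_opNorm (fderiv ℝ (halfCutoff N s (δ k)) x) (coordDir j)).trans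
        (by simpa using hB s (δ k) (hδ k) x)
    -- The cutoff has slope of order 1/δ, but its derivative and u are nonnegative. The L¹ norm of
    -- their product is therefore the integral itself, which integration by parts turns into an
    -- integral of the derivative of u above level s. No power of δ appears, and no trace or
    -- extension theorem is needed.
    have hBj : ∀ j, ∫⁻ x, ‖fderiv ℝ (halfCutoff N s (δ k)) x (coordDir j) * u x‖ₑ ≤ I := by
      intro j
      have e1 := (hwd j).integral_of_bounded hui (hdi j) (halfCutoff_contDiff s (δ k)) (C := 1)
        (L := B / δ k) (fun x => by
          rw [abs_of_nonneg (halfCutoff_nonneg _ _ _)]; exact halfCutoff_le_one _ _ _) (hdz j)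
      have i1 : Integrable (fun x => fderiv ℝ (halfCutoff N s (δ k)) x (coordDir j) * u x) :=
        hui.bdd_mul (continuous_fderiv_test
          ((halfCutoff_contDiff s (δ k)).of_le (by simp)) _).aestronglyMeasurable
          (Eventually.of_forall (hdz j))
      have nn : ∀ x, 0 ≤ fderiv ℝ (halfCutoff N s (δ k)) x (coordDir j) * u x := fun x =>
        mul_nonneg (fderiv_halfCutoff_coordDir_nonneg (hδ k) x j) (hu0 x)
      calc ∫⁻ x, ‖fderiv ℝ (halfCutoff N s (δ k)) x (coordDir j) * u x‖ₑ
          = ∫⁻ x, ENNReal.ofReal (fderiv ℝ (halfCutoff N s (δ k)) x (coordDir j) * u x) :=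
            lintegral_congr fun x => Real.enorm_of_nonneg (nn x)
        _ = ENNReal.ofReal (∫ x, fderiv ℝ (halfCutoff N s (δ k)) x (coordDir j) * u x) :=
            (ofReal_integral_eq_lintegral_ofReal i1 (Eventually.of_forall nn)).symm
        _ ≤ ‖∫ x, halfCutoff N s (δ k) x * (h (w x) * g x j)‖ₑ := by
            rw [e1, ← ofReal_norm]
            exact ENNReal.ofReal_le_ofReal (neg_le_abs _)
        _ ≤ ∫⁻ x, ‖halfCutoff N s (δ k) x * (h (w x) * g x j)‖ₑ :=
            enorm_integral_le_lintegral_enorm _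
        _ ≤ I := hA j
    calc ∑ j, ∫⁻ x, ‖halfCutoff N s (δ k) x * (h (w x) * g x j) +
          fderiv ℝ (halfCutoff N s (δ k)) x (coordDir j) * u x‖ₑ
        ≤ ∑ _j : Fin N, (I + I) := by
          refine Finset.sum_le_sum fun j _ => ?_
          refine (lintegral_mono fun x => enorm_add_le _ _).trans ?_
          rw [lintegral_add_left']
          · exact add_le_add (hA j) (hBj j)
          · exact ((halfCutoff_contDiff s (δ k)).continuous.aestronglyMeasurable.mul
              (hdi j).aestronglyMeasurable).enorm
      _ = 2 * N * I := by
          rw [Finset.sum_const, Finset.card_univ, Fintype.card_fin, nsmul_eq_mul]; ring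
  have hlim : ∀ᵐ x, Tendsto (fun k => halfCutoff N s (δ k) x * u x) atTop
      (𝓝 ((upperHalf N s).indicator u x)) := by
    refine Eventually.of_forall fun x => ?_
    have := (tendsto_halfCutoff s x).mul_const (u x)
    by_cases hx : x ∈ upperHalf N s
    · simpa only [indicator_of_mem hx, Pi.one_apply, one_mul] using this
    · simpa only [indicator_of_notMem hx, zero_mul] using this
  refine (Lp.eLpNorm_lim_le_liminf_eLpNorm (fun k =>
    ((halfCutoff_contDiff s (δ k)).continuous.aestronglyMeasurable.mul
      hui.aestronglyMeasurable)) _ hlim).trans ?_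
  exact (liminf_le_liminf (Eventually.of_forall hstep)).trans (by simp)

end HalfSpace

/-! ### Truncated powers, choice of exponents and the Gagliardo–Nirenberg inequality -/

section GagliardoNirenberg

open scoped ENNReal NNReal

variable {N : ℕ}

/-- A continuous function increasing with `k` to the indicator function of `(0, K)`. -/
noncomputable def rampFun (K : ℝ) (k : ℕ) (s : ℝ) : ℝ :=
  max 0 (min 1 (min (((k : ℝ) + 1) * s - 1) (((k : ℝ) + 1) * (K - s))))

lemma rampFun_nonneg (K : ℝ) (k : ℕ) (s : ℝ) : 0 ≤ rampFun K k s := le_max_left _ _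

lemma rampFun_le_one (K : ℝ) (k : ℕ) (s : ℝ) : rampFun K k s ≤ 1 :=
  max_le zero_le_one (min_le_left _ _)

lemma rampFun_eq_zero_of_le {K : ℝ} {k : ℕ} {s : ℝ} (hs : s ≤ 1 / ((k : ℝ) + 1)) :
    rampFun K k s = 0 := by
  have hk : (0 : ℝ) < (k : ℝ) + 1 := by positivity
  rw [le_div_iff₀ hk] at hs
  exact max_eq_left ((min_le_right _ _).trans ((min_le_left _ _).trans (by linarith)))

lemma rampFun_eq_zero_of_ge {K : ℝ} {k : ℕ} {s : ℝ} (hs : K ≤ s) : rampFun K k s = 0 :=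
  max_eq_left ((min_le_right _ _).trans ((min_le_right _ _).trans
    (mul_nonpos_of_nonneg_of_nonpos (by positivity) (by linarith))))

lemma continuous_rampFun (K : ℝ) (k : ℕ) : Continuous (rampFun K k) := by
  unfold rampFun; fun_prop

lemma tendsto_rampFun {K s : ℝ} (hs : 0 < s) (hK : s < K) :
    Tendsto (fun k => rampFun K k s) atTop (𝓝 1) := by
  refine tendsto_const_nhds.congr' ?_
  obtain ⟨n1, hn1⟩ := exists_nat_ge (2 / s)
  obtain ⟨n2, hn2⟩ := exists_nat_ge (1 / (K - s))
  filter_upwards [eventually_ge_atTop n1, eventually_ge_atTop n2] with k h1 h2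
  have h1' : (n1 : ℝ) ≤ k := by exact_mod_cast h1
  have h2' : (n2 : ℝ) ≤ k := by exact_mod_cast h2
  rw [div_le_iff₀ hs] at hn1
  rw [div_le_iff₀ (by linarith)] at hn2
  have e1 : 1 ≤ ((k : ℝ) + 1) * s - 1 := by nlinarith
  have e2 : 1 ≤ ((k : ℝ) + 1) * (K - s) := by nlinarith
  rw [rampFun, min_eq_left (le_min e1 e2), max_eq_right zero_le_one]

/-- The integrand of the truncated power `min (·) K ^ ρ`. -/
noncomputable def powerRamp (ρ K : ℝ) (k : ℕ) (s : ℝ) : ℝ :=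
  ρ * (max s (1 / ((k : ℝ) + 1))) ^ (ρ - 1) * rampFun K k s

lemma powerRamp_nonneg {ρ : ℝ} (hρ : 0 < ρ) (K : ℝ) (k : ℕ) (s : ℝ) : 0 ≤ powerRamp ρ K k s :=
  mul_nonneg (mul_nonneg hρ.le (Real.rpow_nonneg (le_max_of_le_right (by positivity)) _))
    (rampFun_nonneg _ _ _)

lemma continuous_powerRamp (ρ K : ℝ) (k : ℕ) : Continuous (powerRamp ρ K k) := by
  refine (continuous_const.mul (Continuous.rpow_const (by fun_prop) fun s => Or.inl ?_)).mul
    (continuous_rampFun K k)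
  exact (lt_max_of_lt_right (by positivity)).ne'

lemma powerRamp_eq {ρ K : ℝ} {k : ℕ} {s : ℝ} :
    powerRamp ρ K k s = ρ * s ^ (ρ - 1) * rampFun K k s := by
  rcases le_total s (1 / ((k : ℝ) + 1)) with h | h
  · rw [powerRamp, rampFun_eq_zero_of_le h, mul_zero, mul_zero]
  · rw [powerRamp, max_eq_left h]

/-- The integrands are dominated by ρ s^(ρ-1), which is integrable at 0 because ρ > 0; pointwise
convergence fails at most at s = K. -/
lemma tendsto_primitive_powerRamp {ρ K y : ℝ} (hρ : 0 < ρ) (hK : 0 < K) (hy : 0 ≤ y) :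
    Tendsto (fun k => ∫ s in (0 : ℝ)..y, powerRamp ρ K k s) atTop (𝓝 ((min y K) ^ ρ)) := by
  have hii : ∀ z, IntervalIntegrable (fun s : ℝ => ρ * s ^ (ρ - 1)) volume 0 z := fun z =>
    (intervalIntegral.intervalIntegrable_rpow' (by linarith)).const_mul ρ
  have hval : ∫ s in (0 : ℝ)..y, {s | s ≤ min y K}.indicator (fun s => ρ * s ^ (ρ - 1)) s
      = (min y K) ^ ρ := by
    rw [intervalIntegral.integral_indicator ⟨le_min hy hK.le, min_le_left _ _⟩,
      intervalIntegral.integral_const_mul, integral_rpow (Or.inl (by linarith)),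
      sub_add_cancel, Real.zero_rpow hρ.ne', sub_zero]
    field_simp
  rw [← hval]
  refine intervalIntegral.tendsto_integral_filter_of_dominated_convergence
    (fun s => ρ * s ^ (ρ - 1)) ?_ ?_ (hii y) ?_
  · exact Eventually.of_forall fun k => (continuous_powerRamp ρ K k).aestronglyMeasurable
  · refine Eventually.of_forall fun k => Eventually.of_forall fun s hs => ?_
    rw [uIoc_of_le hy] at hs
    rw [Real.norm_of_nonneg (powerRamp_nonneg hρ K k s), powerRamp_eq]
    exact mul_le_of_le_one_right (mul_nonneg hρ.le (Real.rpow_nonneg hs.1.le _))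
      (rampFun_le_one _ _ _)
  · have hne : ∀ᵐ s : ℝ, s ≠ K := by
      rw [ae_iff]; simp
    filter_upwards [hne] with s hsK hs
    rw [uIoc_of_le hy] at hs
    by_cases h : s < K
    · rw [indicator_of_mem (show s ∈ {s | s ≤ min y K} from le_min hs.2 h.le)]
      simp only [powerRamp_eq]
      simpa using (tendsto_rampFun hs.1 h).const_mul (ρ * s ^ (ρ - 1))
    · have h' : K < s := lt_of_le_of_ne (not_lt.1 h) hsK.symm
      rw [indicator_of_notMem (show s ∉ {s | s ≤ min y K} from fun hh =>
        absurd (hh.trans (min_le_right _ _)) (not_le.2 h'))]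
      refine tendsto_const_nhds.congr fun k => ?_
      rw [powerRamp_eq, rampFun_eq_zero_of_ge h'.le, mul_zero]

/-- Where h(w) is nonzero, w lies between ε and K, so 1 ≤ w/ε and w^(-m) is bounded. With |g| ≤ 1 +
|g|^p the product is dominated by a combination of w and w^m |g|^p, whatever the sign of m. -/
lemma integrable_truncated_grad {w : Space N → ℝ} {g : Space N → Space N} {p m : ℝ} (hp : 1 < p)
    (hw : ∀ x, 0 ≤ w x) (hwi : Integrable w) (hgm : AEStronglyMeasurable g volume)
    (hJ : Integrable (fun x => w x ^ m * ‖g x‖ ^ p)) {h : ℝ → ℝ} {ε K : ℝ} (hh : Continuous h)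
    (hε : 0 < ε) (h0 : ∀ s ≤ ε, h s = 0) (hK : ∀ s, K ≤ s → h s = 0) :
    Integrable (fun x => h (w x) * ‖g x‖) := by
  obtain ⟨Ch, hCh⟩ := hh.bounded_above_of_compact_support (hasCompactSupport_of_zero h0 hK)
  have hCh0 : 0 ≤ Ch := (norm_nonneg _).trans (hCh 0)
  obtain ⟨B, hB⟩ := (isCompact_Icc (a := ε) (b := K)).exists_bound_of_continuousOn
    (f := fun s : ℝ => s ^ (-m)) (fun s hs => (Real.continuousAt_rpow_const _ _
      (Or.inl (hε.trans_le hs.1).ne')).continuousWithinAt)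
  refine ((hwi.const_mul (Ch / ε)).add (hJ.const_mul (Ch * |B|))).mono'
    ((hh.comp_aestronglyMeasurable hwi.aestronglyMeasurable).mul hgm.norm)
    (Eventually.of_forall fun x => ?_)
  have hJ0 : 0 ≤ w x ^ m * ‖g x‖ ^ p :=
    mul_nonneg (Real.rpow_nonneg (hw x) _) (Real.rpow_nonneg (norm_nonneg _) _)
  have hrhs : 0 ≤ Ch / ε * w x + Ch * |B| * (w x ^ m * ‖g x‖ ^ p) := by
    have := hw x; positivity
  simp only [Pi.add_apply]
  rcases le_or_gt (w x) ε with h1 | h1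
  · rw [h0 _ h1]; simpa using hrhs
  rcases le_or_gt K (w x) with h2 | h2
  · rw [hK _ h2]; simpa using hrhs
  have hwx : 0 < w x := hε.trans h1
  have e1 : ‖g x‖ ≤ 1 + ‖g x‖ ^ p := by
    rcases le_total ‖g x‖ 1 with h | h
    · have : 0 ≤ ‖g x‖ ^ p := Real.rpow_nonneg (norm_nonneg _) _
      linarith
    · have := Real.rpow_le_rpow_of_exponent_le h hp.le
      rw [Real.rpow_one] at this; linarith
  have e2 : ‖g x‖ ^ p ≤ |B| * (w x ^ m * ‖g x‖ ^ p) := by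
    have h3 : w x ^ (-m) ≤ |B| := ((le_abs_self _).trans (hB (w x) ⟨h1.le, h2.le⟩)).trans
      (le_abs_self _)
    have h4 : ‖g x‖ ^ p = w x ^ (-m) * (w x ^ m * ‖g x‖ ^ p) := by
      rw [← mul_assoc, ← Real.rpow_add hwx, neg_add_cancel, Real.rpow_zero, one_mul]
    exact h4.trans_le (mul_le_mul_of_nonneg_right h3 hJ0)
  have e3 : 1 ≤ 1 / ε * w x := by
    rw [one_div, inv_mul_eq_div, le_div_iff₀ hε]; linarith
  rw [norm_mul, norm_norm]
  calc ‖h (w x)‖ * ‖g x‖ ≤ Ch * (1 / ε * w x + |B| * (w x ^ m * ‖g x‖ ^ p)) :=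
        mul_le_mul (hCh _) (by linarith) (norm_nonneg _) hCh0
    _ = _ := by ring

/-- The Sobolev inequality for the truncated power `min w K ^ ρ`. -/
lemma eLpNorm_indicator_min_rpow_le {q : ℝ≥0} (hq : NNReal.HolderConjugate (N : ℝ≥0) q)
    {w : Space N → ℝ} {g : Space N → Space N} {p m : ℝ} (hp : 1 < p)
    (hg : HasTruncatedGrad w g) (hw : ∀ x, 0 ≤ w x)
    (hwi : Integrable w) (hgm : AEStronglyMeasurable g volume)
    (hJ : Integrable (fun x => w x ^ m * ‖g x‖ ^ p)) {ρ K : ℝ} (hρ : 0 < ρ) (hK : 0 < K) (s : ℝ) :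
    eLpNorm ((upperHalf N s).indicator fun x => (min (w x) K) ^ ρ) q volume ≤
      eLpNormLESNormFDerivOneConst (volume : Measure (Space N)) q *
        (2 * N * ∫⁻ x in upperHalf N s, (Ioo 0 K).indicator
          (fun r => ENNReal.ofReal (ρ * r ^ (ρ - 1) * ‖g x‖)) (w x)) := by
  have hz : ∀ k : ℕ, ∀ r ≤ 1 / ((k : ℝ) + 1), powerRamp ρ K k r = 0 := fun k r hr => by
    rw [powerRamp, rampFun_eq_zero_of_le hr, mul_zero]
  have hz' : ∀ k r, K ≤ r → powerRamp ρ K k r = 0 := fun k r hr => by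
    rw [powerRamp, rampFun_eq_zero_of_ge hr, mul_zero]
  have hstep : ∀ k : ℕ, eLpNorm ((upperHalf N s).indicator
      fun x => ∫ r in (0 : ℝ)..w x, powerRamp ρ K k r) q volume ≤
      eLpNormLESNormFDerivOneConst (volume : Measure (Space N)) q *
        (2 * N * ∫⁻ x in upperHalf N s, (Ioo 0 K).indicator
          (fun r => ENNReal.ofReal (ρ * r ^ (ρ - 1) * ‖g x‖)) (w x)) := by
    intro k
    refine (eLpNorm_indicator_primitive_le hq hg hw hwi (continuous_powerRamp ρ K k)
      (by positivity) (hz k) (hz' k) (powerRamp_nonneg hρ K k)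
      (integrable_truncated_grad hp hw hwi hgm hJ (continuous_powerRamp ρ K k) (by positivity)
        (hz k) (hz' k)) s).trans ?_
    refine mul_le_mul_right (mul_le_mul_right (lintegral_mono fun x => ?_) _) _
    by_cases hx : w x ∈ Ioo 0 K
    · rw [indicator_of_mem hx, powerRamp_eq]
      refine ENNReal.ofReal_le_ofReal (mul_le_mul_of_nonneg_right ?_ (norm_nonneg _))
      exact mul_le_of_le_one_right (mul_nonneg hρ.le (Real.rpow_nonneg hx.1.le _))
        (rampFun_le_one _ _ _)
    · have : powerRamp ρ K k (w x) = 0 := by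
        simp only [mem_Ioo, not_and_or, not_lt] at hx
        rcases hx with hx | hx
        · exact hz k _ (hx.trans (by positivity))
        · exact hz' k _ hx
      rw [this]; simp
  have hlim : ∀ᵐ x, Tendsto (fun k => (upperHalf N s).indicator
      (fun x => ∫ r in (0 : ℝ)..w x, powerRamp ρ K k r) x) atTop
      (𝓝 ((upperHalf N s).indicator (fun x => (min (w x) K) ^ ρ) x)) := by
    refine Eventually.of_forall fun x => ?_
    by_cases hx : x ∈ upperHalf N s
    · simpa only [indicator_of_mem hx] using tendsto_primitive_powerRamp hρ hK (hw x)
    · simp only [indicator_of_notMem hx]; exact tendsto_const_nhds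
  refine (Lp.eLpNorm_lim_le_liminf_eLpNorm (fun k => AEStronglyMeasurable.indicator
    ((contDiff_primitive (continuous_powerRamp ρ K k)).continuous.comp_aestronglyMeasurable
      hwi.aestronglyMeasurable) (measurableSet_upperHalf s)) _ hlim).trans ?_
  exact (liminf_le_liminf (Eventually.of_forall hstep)).trans (by simp)

/-- The choice of the exponent in the Gagliardo–Nirenberg inequality. -/
lemma exists_interpolation_exponent (hN : N = 2 ∨ N = 3) {p σ : ℝ} (hp : 1 < p) (hσ : 0 < σ)
    (hr : 1 < σ + p / N) :
    ∃ l l' : ℝ, σ + p / N ≤ l ∧ 1 ≤ l' ∧ l' ≤ l ∧ p * l * ((N - 1) / N) = σ + (p - 1) * l' := by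
  have hN0 : (0 : ℝ) < N := by rcases hN with rfl | rfl <;> norm_num
  -- For p < N the choice l = l' in the last identity forces l = Nσ/(N-p), the Sobolev exponent. For
  -- p ≥ N that is unavailable; there l is the target exponent itself and the identity defines l'.
  rcases lt_or_ge p N with hpN | hpN
  · have hd : (0 : ℝ) < N - p := by linarith
    have h1 : (N : ℝ) < N * σ + p := by
      have := mul_lt_mul_of_pos_left hr hN0
      rw [mul_add, mul_div_cancel₀ _ hN0.ne'] at this
      linarith
    refine ⟨N * σ / (N - p), N * σ / (N - p), ?_, ?_, le_rfl, ?_⟩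
    · rw [le_div_iff₀ hd, ← sub_nonneg]
      have : N * σ - (σ + p / N) * (N - p) = p * (N * σ + p - N) / N := by field_simp; ring
      rw [this]
      exact div_nonneg (mul_nonneg (by linarith) (by linarith)) hN0.le
    · rw [le_div_iff₀ hd]; linarith
    · field_simp; ring
  · refine ⟨σ + p / N, (p * (σ + p / N) * ((N - 1) / N) - σ) / (p - 1), le_rfl, ?_, ?_, ?_⟩
    · rw [le_div_iff₀ (by linarith)]
      rcases hN with rfl | rfl
      · norm_num at hr hpN ⊢
        nlinarith
      · norm_num at hr hpN ⊢
        nlinarith [mul_nonneg hσ.le (by linarith : (0:ℝ) ≤ p - 3), mul_nonneg (by linarith : (0:ℝ) ≤ p - 3) (by linarith : (0:ℝ) ≤ p - 3)]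
    · rw [div_le_iff₀ (by linarith)]
      rcases hN with rfl | rfl
      · norm_num at hr hpN ⊢
        nlinarith
      · norm_num at hr hpN ⊢
        nlinarith
    · have : p - 1 ≠ 0 := by linarith
      field_simp; ring

/-- Insert `h2` into `h1`, divide by the power of X on the right, and raise to the power p: by `haν`
what remains on the left is exactly X^ν, which `h3` needs. The division requires X to be finite,
which is why the Gagliardo–Nirenberg inequality is first proved for truncations. -/
lemma ennreal_absorb {X Y E A Z c : ℝ≥0∞} {a p μ ν : ℝ} (hX : X ≠ ⊤) (hp : 1 < p)
    (hμ1 : μ ≤ 1) (hν0 : 0 < ν) (hν1 : ν ≤ 1)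
    (haν : (a - μ * (1 - 1 / p)) * p = ν) (h1 : X ^ a ≤ c * (A ^ (1 / p) * Y ^ (1 - 1 / p)))
    (h2 : Y ≤ X ^ μ * E ^ (1 - μ)) (h3 : Z ≤ X ^ ν * E ^ (1 - ν)) :
    Z ≤ c ^ p * A * E ^ ((1 - μ) * (p - 1) + (1 - ν)) := by
  have hp0 : 0 < p := by linarith
  have hpi : 0 ≤ 1 - 1 / p := by rw [sub_nonneg, div_le_one hp0]; exact hp.le
  rcases eq_or_ne X 0 with hX0 | hX0
  · rw [hX0, ENNReal.zero_rpow_of_pos hν0, zero_mul] at h3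
    exact h3.trans zero_le
  set b := μ * (1 - 1 / p) with hb
  have h4 : X ^ (a - b) ≤ c * (A ^ (1 / p) * E ^ ((1 - μ) * (1 - 1 / p))) := by
    calc X ^ (a - b) = X ^ a * X ^ (-b) := by
          rw [← ENNReal.rpow_add _ _ hX0 hX, sub_eq_add_neg]
      _ ≤ (c * (A ^ (1 / p) * (X ^ μ * E ^ (1 - μ)) ^ (1 - 1 / p))) * X ^ (-b) := by
          gcongr
          exact h1.trans (by gcongr)
      _ = c * (A ^ (1 / p) * E ^ ((1 - μ) * (1 - 1 / p))) * (X ^ b * X ^ (-b)) := by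
          rw [ENNReal.mul_rpow_of_nonneg _ _ hpi, ← ENNReal.rpow_mul, ← ENNReal.rpow_mul]
          ring
      _ = _ := by
          rw [← ENNReal.rpow_add _ _ hX0 hX, add_neg_cancel, ENNReal.rpow_zero, mul_one]
  have h5 : X ^ ν ≤ c ^ p * (A * E ^ ((1 - μ) * (p - 1))) := by
    have := ENNReal.rpow_le_rpow h4 hp0.le
    rw [← ENNReal.rpow_mul, haν, ENNReal.mul_rpow_of_nonneg _ _ hp0.le,
      ENNReal.mul_rpow_of_nonneg _ _ hp0.le, ← ENNReal.rpow_mul, ← ENNReal.rpow_mul,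
      one_div_mul_cancel hp0.ne', ENNReal.rpow_one] at this
    refine this.trans (le_of_eq ?_)
    congr 3
    field_simp
  calc Z ≤ X ^ ν * E ^ (1 - ν) := h3
    _ ≤ c ^ p * (A * E ^ ((1 - μ) * (p - 1))) * E ^ (1 - ν) := by gcongr
    _ = c ^ p * A * (E ^ ((1 - μ) * (p - 1)) * E ^ (1 - ν)) := by ring
    _ = _ := by
      rw [ENNReal.rpow_add_of_nonneg]
      · exact mul_nonneg (by linarith) (by linarith)
      · linarith

/-- Hölder's inequality for W^r = (W^l)^θ W^(1-θ) with θ = (r-1)/(l-1). -/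
lemma lintegral_rpow_interpolate {α : Type*} [MeasurableSpace α] {μ : Measure α} {W : α → ℝ≥0∞}
    (hW : AEMeasurable W μ) {l r : ℝ} (hr : 1 ≤ r) (hrl : r ≤ l) (hl : 1 < l) :
    ∫⁻ x, W x ^ r ∂μ ≤ (∫⁻ x, W x ^ l ∂μ) ^ ((r - 1) / (l - 1)) *
      (∫⁻ x, W x ∂μ) ^ (1 - (r - 1) / (l - 1)) := by
  have hl0 : 0 < l - 1 := by linarith
  have h0 : 0 ≤ (r - 1) / (l - 1) := div_nonneg (by linarith) hl0.le
  have h1 : (r - 1) / (l - 1) ≤ 1 := by rw [div_le_one hl0]; linarith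
  refine le_trans (le_of_eq (lintegral_congr fun x => ?_))
    (ENNReal.lintegral_mul_norm_pow_le (hW.pow_const l) hW h0 (sub_nonneg.2 h1) (by ring))
  rw [← ENNReal.rpow_mul, ← ENNReal.rpow_add_of_nonneg _ _ (mul_nonneg (by linarith) h0)
    (sub_nonneg.2 h1)]
  congr 1
  field_simp
  ring

/-- The Gagliardo–Nirenberg inequality on half spaces. -/
theorem exists_gagliardo_nirenberg (hN : N = 2 ∨ N = 3) {p m : ℝ} (hp : 1 < p) (hσ : 0 < m + p)
    (hr : 1 < m + p + p / N) :
    ∃ C : ℝ≥0∞, C ≠ ⊤ ∧ ∀ (w : Space N → ℝ) (g : Space N → Space N),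
      HasTruncatedGrad w g → (∀ x, 0 ≤ w x) → Integrable w → AEStronglyMeasurable g volume →
      Integrable (fun x => w x ^ m * ‖g x‖ ^ p) → ∀ s : ℝ,
      ∫⁻ x in upperHalf N s, ENNReal.ofReal (w x) ^ (m + p + p / N) ≤
        C * (∫⁻ x in upperHalf N s, ENNReal.ofReal (w x ^ m * ‖g x‖ ^ p)) *
          (∫⁻ x in upperHalf N s, ENNReal.ofReal (w x)) ^ (p / N) := by
  have hN0 : (0 : ℝ) < N := by rcases hN with rfl | rfl <;> norm_num
  have hN1 : (1 : ℝ) < N := by rcases hN with rfl | rfl <;> norm_num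
  have hp0 : 0 < p := by linarith
  obtain ⟨l, l', hrl, hl'1, hl'l, hll⟩ := exists_interpolation_exponent hN hp hσ hr
  have hl1 : 1 < l := hr.trans_le hrl
  set q : ℝ≥0 := NNReal.conjExponent (N : ℝ≥0) with hq
  have hconj : NNReal.HolderConjugate (N : ℝ≥0) q :=
    NNReal.HolderConjugate.conjExponent (by exact_mod_cast hN1)
  have hqv : (q : ℝ) = N / (N - 1) := by
    have := hconj.coe.conjugate_eq
    simpa using this
  have hq0 : (0 : ℝ) < q := by rw [hqv]; exact div_pos hN0 (by linarith)
  -- The power is chosen so that the Sobolev exponent N/(N-1) turns w^ρ into w^l.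
  set ρ : ℝ := l * ((N - 1) / N) with hρ
  have hρ0 : 0 < ρ := mul_pos (by linarith) (div_pos (by linarith) hN0)
  have hρq : ρ * q = l := by
    rw [hρ, hqv]
    have : (N : ℝ) - 1 ≠ 0 := by linarith
    field_simp
  set c : ℝ≥0∞ := eLpNormLESNormFDerivOneConst (volume : Measure (Space N)) q *
    (2 * N * ENNReal.ofReal ρ) with hc
  have hctop : c ≠ ⊤ := by
    refine ENNReal.mul_ne_top ENNReal.coe_ne_top (ENNReal.mul_ne_top ?_ ENNReal.ofReal_ne_top)
    exact ENNReal.mul_ne_top (by simp) (by simp)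
  refine ⟨c ^ p, ENNReal.rpow_ne_top_of_nonneg hp0.le hctop, fun w g hg hw hwi hgm hJ s => ?_⟩
  set S := upperHalf N s with hS
  set A := ∫⁻ x in S, ENNReal.ofReal (w x ^ m * ‖g x‖ ^ p) with hA
  set E := ∫⁻ x in S, ENNReal.ofReal (w x) with hE
  have hwm : AEMeasurable w volume := hwi.aestronglyMeasurable.aemeasurable
  have trunc : ∀ K : ℝ, 0 < K →
      ∫⁻ x in S, ENNReal.ofReal (min (w x) K) ^ (m + p + p / N) ≤ c ^ p * A * E ^ (p / N) := by
    intro K hK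
    set W : Space N → ℝ≥0∞ := fun x => ENNReal.ofReal (min (w x) K) with hW
    have hWm : AEMeasurable W (volume.restrict S) :=
      (hwm.min aemeasurable_const).ennreal_ofReal.restrict
    set E' := ∫⁻ x in S, W x with hE'
    have hE'E : E' ≤ E := lintegral_mono fun x => ENNReal.ofReal_le_ofReal (min_le_left _ _)
    have hEtop : E ≠ ⊤ := ((setLIntegral_le_lintegral _ _).trans_lt hwi.lintegral_lt_top).ne
    have hXtop : ∫⁻ x in S, W x ^ l ≠ ⊤ := by
      have : ∫⁻ x in S, W x ^ l ≤ ENNReal.ofReal K ^ (l - 1) * E' := by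
        rw [hE', ← lintegral_const_mul'' _ hWm]
        refine lintegral_mono fun x => ?_
        calc W x ^ l = W x ^ (l - 1) * W x ^ (1 : ℝ) := by
              rw [← ENNReal.rpow_add_of_nonneg _ _ (by linarith) zero_le_one, sub_add_cancel]
          _ ≤ _ := by
              rw [ENNReal.rpow_one]
              refine mul_le_mul_left (ENNReal.rpow_le_rpow ?_ (by linarith)) _
              exact ENNReal.ofReal_le_ofReal (min_le_right _ _)
      refine (this.trans_lt (ENNReal.mul_lt_top ?_ (hE'E.trans_lt hEtop.lt_top))).ne
      exact (ENNReal.rpow_ne_top_of_nonneg (by linarith) ENNReal.ofReal_ne_top).lt_top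
    have hsob := eLpNorm_indicator_min_rpow_le hconj hp hg hw hwi hgm hJ hρ0 hK s
    have hlhs : eLpNorm (S.indicator fun x => (min (w x) K) ^ ρ) q volume
        = (∫⁻ x in S, W x ^ l) ^ (1 / (q : ℝ)) := by
      rw [eLpNorm_indicator_eq_eLpNorm_restrict (measurableSet_upperHalf s),
        eLpNorm_eq_lintegral_rpow_enorm_toReal (by simpa using hconj.symm.ne_zero) (by simp)]
      simp only [ENNReal.coe_toReal]
      congr 1
      refine lintegral_congr fun x => ?_
      have hmin : 0 ≤ min (w x) K := le_min (hw x) hK.le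
      rw [Real.enorm_of_nonneg (Real.rpow_nonneg hmin _),
        ← ENNReal.ofReal_rpow_of_nonneg hmin hρ0.le, ← ENNReal.rpow_mul, hρq]
    rw [hlhs] at hsob
    -- Hölder's inequality for w^(ρ-1)|g| = (w^m |g|^p)^(1/p) (w^l')^(1-1/p). The exponents match
    -- because of the identity relating l and l'.
    have hH : ∫⁻ x in S, (Ioo 0 K).indicator
          (fun r => ENNReal.ofReal (ρ * r ^ (ρ - 1) * ‖g x‖)) (w x) ≤
        ENNReal.ofReal ρ * (A ^ (1 / p) * (∫⁻ x in S, W x ^ l') ^ (1 - 1 / p)) := by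
      have hJm : AEMeasurable (fun x => ENNReal.ofReal (w x ^ m * ‖g x‖ ^ p))
          (volume.restrict S) := hJ.aestronglyMeasurable.aemeasurable.ennreal_ofReal.restrict
      have hpi : 0 ≤ 1 - 1 / p := by rw [sub_nonneg, div_le_one hp0]; exact hp.le
      refine le_trans ?_ (mul_le_mul_right (ENNReal.lintegral_mul_norm_pow_le hJm
        (hWm.pow_const l') (by positivity) hpi (by ring)) _)
      rw [← lintegral_const_mul' _ _ ENNReal.ofReal_ne_top]
      refine lintegral_mono fun x => ?_
      beta_reduce
      by_cases hx : w x ∈ Ioo 0 K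
      · rw [indicator_of_mem hx]
        have hWx : W x = ENNReal.ofReal (w x) := by rw [hW]; beta_reduce; rw [min_eq_left hx.2.le]
        have hJ0 : 0 ≤ w x ^ m * ‖g x‖ ^ p :=
          mul_nonneg (Real.rpow_nonneg (hw x) _) (Real.rpow_nonneg (norm_nonneg _) _)
        rw [hWx, ENNReal.ofReal_rpow_of_pos hx.1,
          ENNReal.ofReal_rpow_of_nonneg (Real.rpow_nonneg hx.1.le _) hpi,
          ENNReal.ofReal_rpow_of_nonneg hJ0 (by positivity),
          ← ENNReal.ofReal_mul (Real.rpow_nonneg hJ0 _), ← ENNReal.ofReal_mul hρ0.le]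
        refine le_of_eq (congrArg _ ?_)
        rw [Real.mul_rpow (Real.rpow_nonneg hx.1.le _) (Real.rpow_nonneg (norm_nonneg _) _),
          ← Real.rpow_mul (norm_nonneg _), mul_one_div_cancel hp0.ne', Real.rpow_one,
          ← Real.rpow_mul hx.1.le, ← Real.rpow_mul hx.1.le]
        have hexp : ρ - 1 = m * (1 / p) + l' * (1 - 1 / p) := by
          have : p * ρ = m + p + (p - 1) * l' := by rw [hρ, ← hll]; ring
          field_simp
          linarith
        rw [hexp, Real.rpow_add hx.1]
        ring
      · rw [indicator_of_notMem hx]; exact zero_le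
    have h1 : (∫⁻ x in S, W x ^ l) ^ (1 / (q : ℝ)) ≤
        c * (A ^ (1 / p) * (∫⁻ x in S, W x ^ l') ^ (1 - 1 / p)) := by
      refine hsob.trans ((mul_le_mul_right (mul_le_mul_right hH _) _).trans (le_of_eq ?_))
      rw [hc]; ring
    have h2 := lintegral_rpow_interpolate hWm hl'1 hl'l hl1
    have h3 := lintegral_rpow_interpolate hWm hr.le hrl hl1
    have hl0 : 0 < l - 1 := by linarith
    -- Interpolating both the l' and the R norms between l and 1 closes the estimate. The first
    -- remaining goal checks that the resulting power of the mass is p/N, the second is the balance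
    -- `haν`.
    have key := ennreal_absorb hXtop hp
      (by rw [div_le_one hl0]; linarith) (div_pos (by linarith) hl0)
      (by rw [div_le_one hl0]; linarith) (?_ : _ = (m + p + p / N - 1) / (l - 1)) h1 h2 h3
    · refine key.trans (mul_le_mul_right ?_ _)
      have : (1 - (l' - 1) / (l - 1)) * (p - 1) + (1 - (m + p + p / N - 1) / (l - 1)) = p / N := by
        have e : (p - 1) * l' = p * l * ((N - 1) / N) - (m + p) := by linarith
        field_simp
        field_simp at e
        linear_combination (-1 : ℝ) * e
      rw [this]
      exact ENNReal.rpow_le_rpow hE'E (by positivity)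
    · rw [hqv]
      have e : (p - 1) * l' = p * l * ((N - 1) / N) - (m + p) := by linarith
      have : (N : ℝ) - 1 ≠ 0 := by linarith
      field_simp
      field_simp at e
      linear_combination (-1 : ℝ) * e
  have hlim : Tendsto (fun k : ℕ => ∫⁻ x in S, ENNReal.ofReal (min (w x) ((k : ℝ) + 1)) ^
      (m + p + p / N)) atTop (𝓝 (∫⁻ x in S, ENNReal.ofReal (w x) ^ (m + p + p / N))) := by
    refine lintegral_tendsto_of_tendsto_of_monotone ?_ ?_ ?_
    · exact fun k => ((hwm.min aemeasurable_const).ennreal_ofReal.pow_const _).restrict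
    · refine Eventually.of_forall fun x i j hij => ENNReal.rpow_le_rpow
        (ENNReal.ofReal_le_ofReal (min_le_min_left _ ?_)) (by linarith)
      simpa using hij
    · refine Eventually.of_forall fun x => tendsto_const_nhds.congr' ?_
      obtain ⟨n, hn⟩ := exists_nat_ge (w x)
      filter_upwards [eventually_ge_atTop n] with k hk
      have : (n : ℝ) ≤ k := by exact_mod_cast hk
      rw [min_eq_left (by linarith)]
  exact le_of_tendsto' hlim fun k => trunc _ (by positivity)

end GagliardoNirenberg

/-! ### Integration by parts for the Poynting vector -/

section Poynting

variable {N : ℕ}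

/-- The components of the cross product. -/
def crossComp (i : Fin 3) (u v : Vec3) : ℝ := u (i + 1) * v (i + 2) - u (i + 2) * v (i + 1)

lemma abs_crossComp_le (i : Fin 3) (u v : Vec3) : |crossComp i u v| ≤ ‖u‖ ^ 2 + ‖v‖ ^ 2 := by
  have h : ∀ (x : Vec3), x (i + 1) ^ 2 + x (i + 2) ^ 2 ≤ ‖x‖ ^ 2 := by
    intro x
    rw [EuclideanSpace.real_norm_sq_eq, Fin.sum_univ_three]
    fin_cases i <;> simp <;> nlinarith [sq_nonneg (x 0), sq_nonneg (x 1), sq_nonneg (x 2)]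
  have hu := h u
  have hv := h v
  rw [crossComp, abs_le]
  constructor
  · nlinarith [sq_nonneg (u (i + 1) + v (i + 2)), sq_nonneg (u (i + 2) - v (i + 1))]
  · nlinarith [sq_nonneg (u (i + 1) - v (i + 2)), sq_nonneg (u (i + 2) + v (i + 1))]

/-- The identity div(u × v) = v·curl u − u·curl v, read off gradient values. For N = 2 the missing
third derivative contributes to neither side. -/
lemma sum_crossComp_eq (hN : N = 2 ∨ N = 3) (u v : Vec3) (Gu Gv : GradVal N) :
    ∑ j : Fin N, (crossComp (Fin.castLE (by omega) j) (Gu j) v +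
        crossComp (Fin.castLE (by omega) j) u (Gv j)) =
      inner ℝ v Gu.curl - inner ℝ u Gv.curl := by
  rcases hN with rfl | rfl
  · rw [Fin.sum_univ_two, PiLp.inner_apply, PiLp.inner_apply, Fin.sum_univ_three,
      Fin.sum_univ_three]
    simp [crossComp, GradVal.curl, GradVal.partial, Fin.castLE]
    ring
  · rw [Fin.sum_univ_three, PiLp.inner_apply, PiLp.inner_apply, Fin.sum_univ_three,
      Fin.sum_univ_three]
    simp [crossComp, GradVal.curl, GradVal.partial]
    ring

/-- A smooth function which is `1` on `(-∞, K]` and `0` on `[2 * K, ∞)`. -/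
noncomputable def downStep (K y : ℝ) : ℝ := Real.smoothTransition (2 - y / K)

lemma downStep_contDiff (K : ℝ) : ContDiff ℝ 1 (downStep K) :=
  Real.smoothTransition.contDiff.comp (contDiff_const.sub (contDiff_id.div_const K))

lemma downStep_nonneg (K y : ℝ) : 0 ≤ downStep K y := Real.smoothTransition.nonneg _

lemma downStep_le_one (K y : ℝ) : downStep K y ≤ 1 := Real.smoothTransition.le_one _

lemma downStep_eq_one {K y : ℝ} (hK : 0 < K) (hy : y ≤ K) : downStep K y = 1 := by
  refine Real.smoothTransition.one_of_one_le ?_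
  have : y / K ≤ 1 := (div_le_one hK).2 hy
  linarith

lemma downStep_eq_zero {K y : ℝ} (hK : 0 < K) (hy : 2 * K ≤ y) : downStep K y = 0 := by
  refine Real.smoothTransition.zero_of_nonpos ?_
  have : 2 ≤ y / K := (le_div_iff₀ hK).2 hy
  linarith

lemma deriv_downStep (K y : ℝ) :
    deriv (downStep K) y = - (deriv Real.smoothTransition (2 - y / K) / K) := by
  have h1 : HasDerivAt (fun y => 2 - y / K) (-(1 / K)) y := by
    simpa using ((hasDerivAt_id y).div_const K).const_sub 2
  have h2 := ((Real.smoothTransition.contDiff (n := 1)).differentiable (by simp)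
    (2 - y / K)).hasDerivAt.comp y h1
  have h3 : deriv (downStep K) y = _ := h2.deriv
  rw [h3]; ring

lemma deriv_downStep_eq_zero {K y : ℝ} (hK : 0 < K) (hy : 2 * K ≤ y) :
    deriv (downStep K) y = 0 := by
  rw [deriv_downStep, deriv_smoothTransition_of_nonpos, zero_div, neg_zero]
  have : 2 ≤ y / K := (le_div_iff₀ hK).2 hy
  linarith

/-- A compactly supported `C¹` function which is the identity on `[-R, R]`. -/
noncomputable def clampFun (R b : ℝ) : ℝ := b * downStep (R ^ 2) (b ^ 2)

lemma clampFun_contDiff (R : ℝ) : ContDiff ℝ 1 (clampFun R) :=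
  contDiff_id.mul ((downStep_contDiff _).comp (contDiff_id.pow 2))

lemma clampFun_eq {R b : ℝ} (hb : |b| < R) : clampFun R b = b := by
  have hR : 0 < R := (abs_nonneg b).trans_lt hb
  rw [clampFun, downStep_eq_one (by positivity), mul_one]
  rw [← sq_abs b]
  exact pow_le_pow_left₀ (abs_nonneg b) hb.le 2

lemma deriv_clampFun {R b : ℝ} (hb : |b| < R) : deriv (clampFun R) b = 1 := by
  have : clampFun R =ᶠ[𝓝 b] id := by
    filter_upwards [(isOpen_lt continuous_abs continuous_const).mem_nhds hb] with y hy
    exact clampFun_eq hy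
  rw [this.deriv_eq, deriv_id]

lemma clampFun_eq_zero {R b : ℝ} (hR : 0 < R) (hb : 2 * R ≤ |b|) : clampFun R b = 0 := by
  rw [clampFun, downStep_eq_zero (by positivity), mul_zero]
  rw [← sq_abs b]
  nlinarith

/-- The truncated component of `b (E × H)`. -/
noncomputable def truncPoynting (i : Fin 3) (K R : ℝ) (z : (Vec3 × Vec3) × ℝ) : ℝ :=
  clampFun R z.2 * downStep K (‖z.1.1‖ ^ 2 + ‖z.1.2‖ ^ 2) * crossComp i z.1.1 z.1.2

lemma truncPoynting_contDiff (i : Fin 3) (K R : ℝ) : ContDiff ℝ 1 (truncPoynting i K R) := by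
  have h1 : ∀ k : Fin 3, ContDiff ℝ 1 fun z : (Vec3 × Vec3) × ℝ => z.1.1 k := fun k =>
    (EuclideanSpace.proj (𝕜 := ℝ) k).contDiff.comp (contDiff_fst.comp contDiff_fst)
  have h2 : ∀ k : Fin 3, ContDiff ℝ 1 fun z : (Vec3 × Vec3) × ℝ => z.1.2 k := fun k =>
    (EuclideanSpace.proj (𝕜 := ℝ) k).contDiff.comp (contDiff_snd.comp contDiff_fst)
  refine (((clampFun_contDiff R).comp contDiff_snd).mul ((downStep_contDiff K).comp ?_)).mul ?_
  · exact ((contDiff_fst.comp contDiff_fst).norm_sq ℝ).add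
      ((contDiff_snd.comp contDiff_fst).norm_sq ℝ)
  · exact ((h1 _).mul (h2 _)).sub ((h1 _).mul (h2 _))

/-- Compact support bounds the function and its derivative, as `IsWeakDeriv.comp` demands: one
cutoff acts on large fields, the other on large coefficients. -/
lemma truncPoynting_hasCompactSupport (i : Fin 3) {K R : ℝ} (hK : 0 < K) (hR : 0 < R) :
    HasCompactSupport (truncPoynting i K R) := by
  refine HasCompactSupport.intro (K := Metric.closedBall 0 (2 * K + 2 * R + 1))
    (isCompact_closedBall _ _) fun z hz => ?_
  rw [Metric.mem_closedBall, dist_zero_right, not_le] at hz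
  have hz' : 2 * K + 2 * R + 1 < max (max ‖z.1.1‖ ‖z.1.2‖) |z.2| := hz
  rcases lt_max_iff.1 hz' with h | h
  · have : 2 * K ≤ ‖z.1.1‖ ^ 2 + ‖z.1.2‖ ^ 2 := by
      rcases lt_max_iff.1 h with h | h
      · nlinarith [sq_nonneg (‖z.1.1‖ - 1), sq_nonneg ‖z.1.2‖]
      · nlinarith [sq_nonneg (‖z.1.2‖ - 1), sq_nonneg ‖z.1.1‖]
    rw [truncPoynting, downStep_eq_zero hK this]; ring
  · rw [truncPoynting, clampFun_eq_zero hR (by linarith)]; ring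

lemma fderiv_truncPoynting (i : Fin 3) (K R : ℝ) (z dz : (Vec3 × Vec3) × ℝ) :
    fderiv ℝ (truncPoynting i K R) z dz =
      deriv (clampFun R) z.2 * dz.2 * downStep K (‖z.1.1‖ ^ 2 + ‖z.1.2‖ ^ 2) *
          crossComp i z.1.1 z.1.2 +
        clampFun R z.2 * (deriv (downStep K) (‖z.1.1‖ ^ 2 + ‖z.1.2‖ ^ 2) *
          (2 * (inner ℝ z.1.1 dz.1.1 + inner ℝ z.1.2 dz.1.2))) * crossComp i z.1.1 z.1.2 +
        clampFun R z.2 * downStep K (‖z.1.1‖ ^ 2 + ‖z.1.2‖ ^ 2) *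
          (crossComp i dz.1.1 z.1.2 + crossComp i z.1.1 dz.1.2) := by
  set A : (Vec3 × Vec3) × ℝ →L[ℝ] Vec3 :=
    (ContinuousLinearMap.fst ℝ Vec3 Vec3).comp (ContinuousLinearMap.fst ℝ (Vec3 × Vec3) ℝ) with hA
  set B : (Vec3 × Vec3) × ℝ →L[ℝ] Vec3 :=
    (ContinuousLinearMap.snd ℝ Vec3 Vec3).comp (ContinuousLinearMap.fst ℝ (Vec3 × Vec3) ℝ) with hB
  have d1 : HasFDerivAt (fun z : (Vec3 × Vec3) × ℝ => clampFun R z.2)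
      (deriv (clampFun R) z.2 • ContinuousLinearMap.snd ℝ (Vec3 × Vec3) ℝ) z :=
    ((clampFun_contDiff R).differentiable (by simp) z.2).hasDerivAt.comp_hasFDerivAt z
      hasFDerivAt_snd
  have dQ : HasFDerivAt (fun z : (Vec3 × Vec3) × ℝ => ‖z.1.1‖ ^ 2 + ‖z.1.2‖ ^ 2)
      ((2 • (innerSL ℝ z.1.1).comp A) + (2 • (innerSL ℝ z.1.2).comp B)) z :=
    ((hasStrictFDerivAt_norm_sq z.1.1).hasFDerivAt.comp z A.hasFDerivAt).add
      ((hasStrictFDerivAt_norm_sq z.1.2).hasFDerivAt.comp z B.hasFDerivAt)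
  have d2 := ((downStep_contDiff K).differentiable (by simp)
    (‖z.1.1‖ ^ 2 + ‖z.1.2‖ ^ 2)).hasDerivAt.comp_hasFDerivAt z dQ
  have eA : ∀ k : Fin 3, HasFDerivAt (fun z : (Vec3 × Vec3) × ℝ => z.1.1 k)
      ((EuclideanSpace.proj (𝕜 := ℝ) k).comp A) z := fun k =>
    ((EuclideanSpace.proj (𝕜 := ℝ) k).comp A).hasFDerivAt
  have eB : ∀ k : Fin 3, HasFDerivAt (fun z : (Vec3 × Vec3) × ℝ => z.1.2 k)
      ((EuclideanSpace.proj (𝕜 := ℝ) k).comp B) z := fun k =>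
    ((EuclideanSpace.proj (𝕜 := ℝ) k).comp B).hasFDerivAt
  have d3 := ((eA (i + 1)).mul (eB (i + 2))).sub ((eA (i + 2)).mul (eB (i + 1)))
  have d4 := ((d1.mul d2).mul d3).fderiv
  have d5 : fderiv ℝ (truncPoynting i K R) z = _ := d4
  rw [d5]
  simp [hA, hB, crossComp, two_mul]
  ring

lemma abs_inner_sum_le {c : ℝ} (G : Space N) (t : Fin N → ℝ) (ht : ∀ j, |t j| ≤ c) :
    |∑ j, G j * t j| ≤ N * (‖G‖ * c) := by
  calc |∑ j, G j * t j| ≤ ∑ j, |G j * t j| := Finset.abs_sum_le_sum_abs _ _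
    _ ≤ ∑ _j : Fin N, ‖G‖ * c := by
        refine Finset.sum_le_sum fun j _ => ?_
        rw [abs_mul]
        exact mul_le_mul (PiLp.norm_apply_le G j) (ht j) (abs_nonneg _) (norm_nonneg _)
    _ = _ := by simp

/-- The exchange of energy between the two fields, tested with `ζ`, is controlled by the gradient
of the energy density. -/
lemma exists_exchange_bound (hN : N = 2 ∨ N = 3) {n d₂ d₃ : ℝ} (hn : 1 < n) (hd₂ : 0 ≤ d₂)
    (hd₃ : 0 ≤ d₃) :
    ∃ C : ℝ, 0 ≤ C ∧ ∀ (u v : Space N → Vec3) (Gu Gv : Space N → GradVal N) (b : Space N → ℝ)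
      (Gb g : Space N → Space N) (w : Space N → ℝ),
      HasWeakVecGrad u Gu → HasWeakVecGrad v Gv → HasWeakGrad b Gb →
      (w = fun x => ‖u x‖ ^ 2 + ‖v x‖ ^ 2) →
      (g = fun x => WithLp.toLp 2 fun j =>
        2 * (inner ℝ (u x) (Gu x j) + inner ℝ (v x) (Gv x j))) →
      (∀ᵐ x, |b x| ≤ d₂ * w x ^ (n - 1)) →
      (∀ᵐ x, 0 < w x → ‖Gb x‖ ≤ d₃ * w x ^ (n - 2) * ‖g x‖) →
      ∀ ζ : Space N → ℝ, ContDiff ℝ ∞ ζ → HasCompactSupport ζ → (∀ x, 0 ≤ ζ x) →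
      Integrable (fun x => b x * (inner ℝ (v x) (Gu x).curl - inner ℝ (u x) (Gv x).curl) * ζ x) →
      Integrable (fun x => w x ^ (n - 1) * ‖g x‖ * ζ x) →
      Integrable (fun x => w x ^ n * ‖fderiv ℝ ζ x‖) →
      |∫ x, b x * (inner ℝ (v x) (Gu x).curl - inner ℝ (u x) (Gv x).curl) * ζ x| ≤
        C * ((∫ x, w x ^ (n - 1) * ‖g x‖ * ζ x) + ∫ x, w x ^ n * ‖fderiv ℝ ζ x‖) := by
  obtain ⟨B, hB0, hB⟩ := exists_deriv_smoothTransition_le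
  set C : ℝ := N * (d₂ + d₃ + 2 * B * d₂) with hC
  refine ⟨C, by positivity, fun u v Gu Gv b Gb g w hu hv hb hwdef hgdef hbb hGb ζ hζ hζc hζ0
    hi1 hi2 hi3 => ?_⟩
  have hw : ∀ x, 0 ≤ w x := fun x => by rw [hwdef]; positivity
  have hζ1 : ContDiff ℝ 1 ζ := hζ.of_le (by simp)
  set D : Space N → ℝ := fun x => inner ℝ (v x) (Gu x).curl - inner ℝ (u x) (Gv x).curl with hD
  have hU : ∀ j, IsWeakDeriv (coordDir j) (fun x => ((u x, v x), b x))
      (fun x => ((Gu x j, Gv x j), Gb x j)) := fun j =>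
    ((hu.isWeakDeriv j).prodMk (hv.isWeakDeriv j)).prodMk (hb.isWeakDeriv j)
  have hwm : AEStronglyMeasurable w volume := by
    rw [hwdef]
    have h1 := (continuous_norm.pow 2).comp_aestronglyMeasurable
      (((continuous_fst.comp continuous_fst).comp_aestronglyMeasurable
        (hU ⟨0, by omega⟩).1.aestronglyMeasurable))
    have h2 := (continuous_norm.pow 2).comp_aestronglyMeasurable
      (((continuous_snd.comp continuous_fst).comp_aestronglyMeasurable
        (hU ⟨0, by omega⟩).1.aestronglyMeasurable))
    exact h1.add h2
  have step : ∀ k : ℕ, |∫ x, downStep ((k : ℝ) + 1) (w x) * (b x * D x * ζ x)| ≤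
      C * ((∫ x, w x ^ (n - 1) * ‖g x‖ * ζ x) + ∫ x, w x ^ n * ‖fderiv ℝ ζ x‖) := by
    intro k
    set K : ℝ := (k : ℝ) + 1 with hKdef
    have hK : 0 < K := by positivity
    -- R exceeds the bound on b where w < 2K. Thus the clamp is the identity with derivative 1
    -- wherever the truncation in w is active, and it disappears from all formulas.
    set R : ℝ := d₂ * (2 * K) ^ (n - 1) + 1 with hRdef
    have hR : 0 < R := by positivity
    set ι : Fin N → Fin 3 := Fin.castLE (by omega) with hι
    set F : Fin N → Space N → ℝ := fun j x => truncPoynting (ι j) K R ((u x, v x), b x) with hF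
    set dF : Fin N → Space N → ℝ := fun j x =>
      fderiv ℝ (truncPoynting (ι j) K R) ((u x, v x), b x) ((Gu x j, Gv x j), Gb x j) with hdF
    have hwk : ∀ j, IsWeakDeriv (coordDir j) (F j) (dF j) := by
      intro j
      have hc := truncPoynting_contDiff (ι j) K R
      have hs := truncPoynting_hasCompactSupport (ι j) hK hR
      obtain ⟨C1, hC1⟩ := hc.continuous.bounded_above_of_compact_support hs
      obtain ⟨L, hL⟩ := (hc.continuous_fderiv (by simp)).bounded_above_of_compact_support
        (hs.fderiv (𝕜 := ℝ))
      exact (hU j).comp hc hC1 hL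
    have ia : ∀ j, Integrable (fun x => fderiv ℝ ζ x (coordDir j) * F j x) := fun j =>
      integrable_test_smul (hwk j).1 (continuous_fderiv_test hζ1 _)
        (hasCompactSupport_fderiv_test hζc _)
    have ib : ∀ j, Integrable (fun x => ζ x * dF j x) := fun j =>
      integrable_test_smul (hwk j).2.1 hζ.continuous hζc
    have iab : ∀ j, Integrable (fun x => fderiv ℝ ζ x (coordDir j) * F j x + ζ x * dF j x) :=
      fun j => (ia j).add (ib j)
    -- The divergence of ζ times the truncated Poynting vector has integral zero; subtracting it
    -- leaves only terms without derivatives of the individual fields.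
    have hzero : ∫ x, ∑ j, (fderiv ℝ ζ x (coordDir j) * F j x + ζ x * dF j x) = 0 := by
      rw [integral_finsetSum _ fun j _ => iab j]
      refine Finset.sum_eq_zero fun j _ => ?_
      rw [integral_add (ia j) (ib j)]
      have := (hwk j).2.2 ζ hζ hζc
      simp only [smul_eq_mul] at this
      rw [this, neg_add_cancel]
    have iθ : Integrable (fun x => downStep K (w x) * (b x * D x * ζ x)) :=
      hi1.bdd_mul (c := 1)
        ((downStep_contDiff K).continuous.comp_aestronglyMeasurable hwm)
        (Eventually.of_forall fun x => by
          rw [Real.norm_of_nonneg (downStep_nonneg _ _)]; exact downStep_le_one _ _)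
    have isum : Integrable (fun x => ∑ j, (fderiv ℝ ζ x (coordDir j) * F j x + ζ x * dF j x)) :=
      integrable_finsetSum _ fun j _ => iab j
    have hrest : ∫ x, downStep K (w x) * (b x * D x * ζ x) = ∫ x,
        (downStep K (w x) * (b x * D x * ζ x) -
          ∑ j, (fderiv ℝ ζ x (coordDir j) * F j x + ζ x * dF j x)) := by
      rw [integral_sub iθ isum, hzero, sub_zero]
    rw [hrest, ← integral_add hi2 hi3, ← integral_const_mul]
    have ibd : Integrable (fun x => C * (w x ^ (n - 1) * ‖g x‖ * ζ x +
        w x ^ n * ‖fderiv ℝ ζ x‖)) := (hi2.add hi3).const_mul C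
    rw [← Real.norm_eq_abs]
    refine norm_integral_le_of_norm_le ibd ?_
    filter_upwards [hbb, hGb] with x hbx hGbx
    have hwx : ‖u x‖ ^ 2 + ‖v x‖ ^ 2 = w x := by rw [hwdef]
    set cr : Fin N → ℝ := fun j => crossComp (ι j) (u x) (v x) with hcr
    have hcrw : ∀ j, |cr j| ≤ w x := fun j => hwx ▸ abs_crossComp_le _ _ _
    have hb0 : 0 ≤ w x ^ (n - 1) := Real.rpow_nonneg (hw x) _
    have hgj : ∀ j, 2 * (inner ℝ (u x) (Gu x j) + inner ℝ (v x) (Gv x j)) = g x j := fun j => by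
      rw [hgdef]
    have hclamp : w x < 2 * K → |b x| < R := by
      intro h
      have := Real.rpow_le_rpow (hw x) h.le (by linarith : 0 ≤ n - 1)
      have := mul_le_mul_of_nonneg_left this hd₂
      rw [hRdef]; linarith
    have hFx : ∀ j, F j x = b x * downStep K (w x) * cr j := by
      intro j
      simp only [hF, truncPoynting, hwx]
      rcases lt_or_ge (w x) (2 * K) with h | h
      · rw [clampFun_eq (hclamp h)]
      · rw [downStep_eq_zero hK h]; ring
    have hdFx : ∀ j, dF j x = Gb x j * downStep K (w x) * cr j +
        b x * (deriv (downStep K) (w x) * g x j) * cr j +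
        b x * downStep K (w x) * (crossComp (ι j) (Gu x j) (v x) +
          crossComp (ι j) (u x) (Gv x j)) := by
      intro j
      simp only [hdF, fderiv_truncPoynting, hwx, hgj]
      rcases lt_or_ge (w x) (2 * K) with h | h
      · rw [clampFun_eq (hclamp h), deriv_clampFun (hclamp h), one_mul]
      · rw [downStep_eq_zero hK h, deriv_downStep_eq_zero hK h]; ring
    have hDx : D x = ∑ j, (crossComp (ι j) (Gu x j) (v x) + crossComp (ι j) (u x) (Gv x j)) :=
      (sum_crossComp_eq hN (u x) (v x) (Gu x) (Gv x)).symm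
    have hdiff : downStep K (w x) * (b x * D x * ζ x) -
        ∑ j, (fderiv ℝ ζ x (coordDir j) * F j x + ζ x * dF j x) =
        -(b x * downStep K (w x) * ∑ j, fderiv ℝ ζ x (coordDir j) * cr j) -
          ζ x * downStep K (w x) * (∑ j, Gb x j * cr j) -
          ζ x * b x * deriv (downStep K) (w x) * ∑ j, g x j * cr j := by
      rw [hDx]
      simp only [hFx, hdFx, Finset.mul_sum, Finset.sum_mul, ← Finset.sum_neg_distrib,
        ← Finset.sum_sub_distrib]
      exact Finset.sum_congr rfl fun j _ => by ring
    rw [hdiff]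
    have hθ0 := downStep_nonneg K (w x)
    have hθ1 := downStep_le_one K (w x)
    -- Where w = 0 the bound on the gradient of b is not available, but the cross products vanish
    -- there.
    rcases (hw x).eq_or_lt with h0 | hpos
    · have hz : ∀ j, cr j = 0 := fun j => by
        have := hcrw j
        rw [← h0] at this
        exact abs_eq_zero.1 (le_antisymm this (abs_nonneg _))
      simp only [hz, mul_zero, Finset.sum_const_zero, neg_zero, sub_zero, norm_zero]
      have := hζ0 x
      have : 0 ≤ w x ^ n := Real.rpow_nonneg (hw x) _
      positivity
    have ew1 : w x ^ (n - 2) * w x = w x ^ (n - 1) := by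
      rw [← Real.rpow_add_one hpos.ne']; congr 1; ring
    have ew2 : w x ^ (n - 1) * w x = w x ^ n := by
      rw [← Real.rpow_add_one hpos.ne']; congr 1; ring
    have t1 : |b x * downStep K (w x) * ∑ j, fderiv ℝ ζ x (coordDir j) * cr j| ≤
        N * d₂ * (w x ^ n * ‖fderiv ℝ ζ x‖) := by
      have h1 : |∑ j, fderiv ℝ ζ x (coordDir j) * cr j| ≤ N * (‖fderiv ℝ ζ x‖ * w x) := by
        calc |∑ j, fderiv ℝ ζ x (coordDir j) * cr j|
            ≤ ∑ j, |fderiv ℝ ζ x (coordDir j) * cr j| := Finset.abs_sum_le_sum_abs _ _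
          _ ≤ ∑ _j : Fin N, ‖fderiv ℝ ζ x‖ * w x := by
              refine Finset.sum_le_sum fun j _ => ?_
              rw [abs_mul]
              refine mul_le_mul ?_ (hcrw j) (abs_nonneg _) (norm_nonneg _)
              exact ((fderiv ℝ ζ x).le_opNorm (coordDir j)).trans (by simp)
          _ = _ := by simp
      have h2 : |b x * downStep K (w x)| ≤ d₂ * w x ^ (n - 1) := by
        rw [abs_mul, abs_of_nonneg hθ0]
        exact (mul_le_of_le_one_right (abs_nonneg _) hθ1).trans hbx
      rw [abs_mul]
      refine (mul_le_mul h2 h1 (abs_nonneg _) (by positivity)).trans (le_of_eq ?_)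
      rw [← ew2]; ring
    have t2 : |ζ x * downStep K (w x) * ∑ j, Gb x j * cr j| ≤
        N * d₃ * (w x ^ (n - 1) * ‖g x‖ * ζ x) := by
      have h1 := abs_inner_sum_le (Gb x) cr hcrw
      have h2 : |ζ x * downStep K (w x)| ≤ ζ x := by
        rw [abs_mul, abs_of_nonneg hθ0, abs_of_nonneg (hζ0 x)]
        exact mul_le_of_le_one_right (hζ0 x) hθ1
      rw [abs_mul]
      refine (mul_le_mul h2 (h1.trans (mul_le_mul_of_nonneg_left
        (mul_le_mul_of_nonneg_right (hGbx hpos) hpos.le) (Nat.cast_nonneg N))) (abs_nonneg _)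
        (hζ0 x)).trans (le_of_eq ?_)
      rw [← ew1]; ring
    have t3 : |ζ x * b x * deriv (downStep K) (w x) * ∑ j, g x j * cr j| ≤
        N * (2 * B * d₂) * (w x ^ (n - 1) * ‖g x‖ * ζ x) := by
      have h1 := abs_inner_sum_le (g x) cr hcrw
      -- The derivative of the truncation is at most B/K and vanishes for w ≥ 2K, so its product
      -- with w is bounded uniformly in K. This error is absorbed in the convection term and need
      -- not tend to zero.
      have h2 : |deriv (downStep K) (w x)| * w x ≤ 2 * B := by
        rcases lt_or_ge (w x) (2 * K) with h | h
        · rw [deriv_downStep, abs_neg, abs_of_nonneg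
            (div_nonneg (deriv_smoothTransition_nonneg _) hK.le), div_mul_eq_mul_div,
            div_le_iff₀ hK]
          have := mul_le_mul (hB (2 - w x / K)) h.le hpos.le hB0
          linarith
        · rw [deriv_downStep_eq_zero hK h, abs_zero, zero_mul]; positivity
      rw [abs_mul, abs_mul, abs_mul, abs_of_nonneg (hζ0 x)]
      calc ζ x * |b x| * |deriv (downStep K) (w x)| * |∑ j, g x j * cr j|
          ≤ ζ x * |b x| * |deriv (downStep K) (w x)| * (N * (‖g x‖ * w x)) :=
            mul_le_mul_of_nonneg_left h1
              (mul_nonneg (mul_nonneg (hζ0 x) (abs_nonneg _)) (abs_nonneg _))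
        _ = N * (ζ x * ‖g x‖) * (|b x| * (|deriv (downStep K) (w x)| * w x)) := by ring
        _ ≤ N * (ζ x * ‖g x‖) * ((d₂ * w x ^ (n - 1)) * (2 * B)) := by
            refine mul_le_mul_of_nonneg_left (mul_le_mul hbx h2
              (mul_nonneg (abs_nonneg _) hpos.le) (by positivity)) ?_
            have := hζ0 x
            positivity
        _ = _ := by ring
    have p1 : 0 ≤ w x ^ n * ‖fderiv ℝ ζ x‖ :=
      mul_nonneg (Real.rpow_nonneg (hw x) _) (norm_nonneg _)
    have p2 : 0 ≤ w x ^ (n - 1) * ‖g x‖ * ζ x :=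
      mul_nonneg (mul_nonneg hb0 (norm_nonneg _)) (hζ0 x)
    rw [Real.norm_eq_abs]
    refine (abs_sub _ _).trans ((add_le_add (abs_sub _ _) le_rfl).trans ?_)
    rw [abs_neg]
    refine (add_le_add (add_le_add t1 t2) t3).trans ?_
    have q1 : 0 ≤ (N : ℝ) * (d₃ + 2 * B * d₂) * (w x ^ n * ‖fderiv ℝ ζ x‖) := by positivity
    have q2 : 0 ≤ (N : ℝ) * d₂ * (w x ^ (n - 1) * ‖g x‖ * ζ x) :=
      mul_nonneg (by positivity) p2
    rw [hC]
    linarith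
  have hlim : Tendsto (fun k : ℕ => ∫ x, downStep ((k : ℝ) + 1) (w x) * (b x * D x * ζ x)) atTop
      (𝓝 (∫ x, b x * D x * ζ x)) := by
    refine tendsto_integral_of_dominated_convergence (fun x => ‖b x * D x * ζ x‖) ?_ hi1.norm ?_ ?_
    · exact fun k => ((downStep_contDiff _).continuous.comp_aestronglyMeasurable hwm).mul
        hi1.aestronglyMeasurable
    · refine fun k => Eventually.of_forall fun x => ?_
      rw [norm_mul, Real.norm_of_nonneg (downStep_nonneg _ _)]
      exact mul_le_of_le_one_left (norm_nonneg _) (downStep_le_one _ _)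
    · refine Eventually.of_forall fun x => tendsto_const_nhds.congr' ?_
      obtain ⟨k0, hk0⟩ := exists_nat_ge (w x)
      filter_upwards [eventually_ge_atTop k0] with k hk
      have : (k0 : ℝ) ≤ k := by exact_mod_cast hk
      rw [downStep_eq_one (by positivity) (by linarith), one_mul]
  exact le_of_tendsto hlim.abs (Eventually.of_forall step)

end Poynting

/-! ### Space-time estimates -/

section SpaceTime

open scoped ENNReal

variable {N : ℕ}

lemma restrict_cyl (T : ℝ) : (volume : Measure (ℝ × Space N)).restrict (cyl N T) =
    (volume.restrict (Ioo 0 T)).prod volume := by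
  rw [cyl, Measure.volume_eq_prod, ← Measure.prod_restrict, Measure.restrict_univ]

lemma ae_slice {T : ℝ} {P : ℝ × Space N → Prop} (h : ∀ᵐ z ∂(volume.restrict (cyl N T)), P z) :
    ∀ᵐ t ∂(volume.restrict (Ioo 0 T)), ∀ᵐ x : Space N, P (t, x) := by
  rw [restrict_cyl] at h
  exact Measure.ae_ae_of_ae_prod h

lemma cyl_mono {s t : ℝ} (h : s ≤ t) : cyl N s ⊆ cyl N t :=
  prod_mono (Ioo_subset_Ioo_right h) subset_rfl

lemma measurableSet_cyl (t : ℝ) : MeasurableSet (cyl N t) :=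
  measurableSet_Ioo.prod MeasurableSet.univ

namespace EMField

variable (F : EMField N)

lemma w_nonneg (t : ℝ) (x : Space N) : 0 ≤ F.w t x := by unfold w; positivity

/-- Zero energy density makes both fields vanish. Hence, for p > 0, the dissipation density is zero
on {w = 0} even for negative m. -/
lemma gradw_eq_zero {t : ℝ} {x : Space N} (h : F.w t x = 0) : F.gradw t x = 0 := by
  have h1 : ‖F.E t x‖ ^ 2 = 0 := by
    unfold w at h; nlinarith [sq_nonneg ‖F.E t x‖, sq_nonneg ‖F.H t x‖]
  have h2 : ‖F.H t x‖ ^ 2 = 0 := by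
    unfold w at h; nlinarith [sq_nonneg ‖F.E t x‖, sq_nonneg ‖F.H t x‖]
  have e1 : F.E t x = 0 := by simpa using h1
  have e2 : F.H t x = 0 := by simpa using h2
  ext j
  simp [gradw, e1, e2]

/-- The dissipation density `w^m |∇w|^p`. -/
noncomputable def diss (p m : ℝ) (z : ℝ × Space N) : ℝ :=
  F.w z.1 z.2 ^ m * ‖F.gradw z.1 z.2‖ ^ p

lemma diss_nonneg (p m : ℝ) (z : ℝ × Space N) : 0 ≤ F.diss p m z :=
  mul_nonneg (Real.rpow_nonneg (F.w_nonneg _ _) _) (Real.rpow_nonneg (norm_nonneg _) _)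

end EMField

variable {T p m : ℝ} {a₁ a₂ b₁ b₂ : Coeff N} {E₀ H₀ : Space N → Vec3} {F : EMField N}

namespace IsGeneralizedSolution

lemma aestronglyMeasurable_w (hs : IsGeneralizedSolution T p m a₁ a₂ b₁ b₂ E₀ H₀ F) :
    AEStronglyMeasurable (fun z : ℝ × Space N => F.w z.1 z.2) (volume.restrict (cyl N T)) :=
  (hs.measE.norm.pow 2).add (hs.measH.norm.pow 2)

lemma aestronglyMeasurable_gradw (hs : IsGeneralizedSolution T p m a₁ a₂ b₁ b₂ E₀ H₀ F) :
    AEStronglyMeasurable (fun z : ℝ × Space N => F.gradw z.1 z.2) (volume.restrict (cyl N T)) := by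
  have h1 : ∀ j : Fin N, AEStronglyMeasurable (fun z : ℝ × Space N =>
      2 * (inner ℝ (F.E z.1 z.2) (F.gradE z.1 z.2 j) + inner ℝ (F.H z.1 z.2) (F.gradH z.1 z.2 j)))
      (volume.restrict (cyl N T)) := fun j =>
    ((hs.measE.inner ((continuous_apply j).comp_aestronglyMeasurable hs.measGradE)).add
      (hs.measH.inner ((continuous_apply j).comp_aestronglyMeasurable hs.measGradH))).const_mul 2
  exact (PiLp.continuous_toLp 2 (fun _ : Fin N => ℝ)).comp_aestronglyMeasurable
    (aemeasurable_pi_lambda _ fun j => (h1 j).aemeasurable).aestronglyMeasurable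

lemma aestronglyMeasurable_diss (hs : IsGeneralizedSolution T p m a₁ a₂ b₁ b₂ E₀ H₀ F) :
    AEStronglyMeasurable (F.diss p m) (volume.restrict (cyl N T)) :=
  ((hs.aestronglyMeasurable_w.aemeasurable.pow_const m).mul
    (hs.aestronglyMeasurable_gradw.norm.aemeasurable.pow_const p)).aestronglyMeasurable

lemma ae_hasTruncatedGrad (hs : IsGeneralizedSolution T p m a₁ a₂ b₁ b₂ E₀ H₀ F) :
    ∀ᵐ t ∂(volume.restrict (Ioo 0 T)), HasTruncatedGrad (F.w t) (F.gradw t) := by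
  filter_upwards [hs.weakGradE, hs.weakGradH] with t h1 h2
  exact hasTruncatedGrad_energy h1 h2

/-- With c = (m+p)/p the weak gradient G of w^c equals c w^(c-1) ∇w where w > 0, and (c-1)p = m. So
w^m |∇w|^p = c^(-p) |G|^p there, while the left side vanishes on {w = 0}. -/
lemma integrableOn_diss (hs : IsGeneralizedSolution T p m a₁ a₂ b₁ b₂ E₀ H₀ F) (hp : 1 < p)
    (hσ : 0 < m + p) : IntegrableOn (F.diss p m) (cyl N T) := by
  have hp0 : 0 < p := by linarith
  obtain ⟨G, hG, -, hGp⟩ := hs.powerSobolev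
  set c : ℝ := (m + p) / p with hc
  have hc0 : 0 < c := div_pos hσ hp0
  refine ⟨hs.aestronglyMeasurable_diss, ?_⟩
  have hfin : ∫⁻ z in cyl N T, ENNReal.ofReal (c ^ (-p)) * ‖G z.1 z.2‖ₑ ^ p < ⊤ := by
    rw [lintegral_const_mul' _ _ ENNReal.ofReal_ne_top]
    refine ENNReal.mul_lt_top ENNReal.ofReal_lt_top ?_
    have := lintegral_rpow_enorm_lt_top_of_eLpNorm_lt_top (by simpa using hp0)
      ENNReal.ofReal_ne_top hGp.2
    simpa [ENNReal.toReal_ofReal hp0.le] using this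
  refine lt_of_le_of_lt ?_ hfin
  have hm1 : AEMeasurable (fun z : ℝ × Space N => ‖F.diss p m z‖ₑ)
      ((volume.restrict (Ioo 0 T)).prod volume) := by
    rw [← restrict_cyl]; exact hs.aestronglyMeasurable_diss.enorm
  have hm2 : AEMeasurable (fun z : ℝ × Space N => ENNReal.ofReal (c ^ (-p)) * ‖G z.1 z.2‖ₑ ^ p)
      ((volume.restrict (Ioo 0 T)).prod volume) := by
    rw [← restrict_cyl]; exact (hGp.1.enorm.pow_const p).const_mul _
  rw [restrict_cyl, lintegral_prod _ hm1, lintegral_prod _ hm2]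
  refine lintegral_mono_ae ?_
  filter_upwards [hs.ae_hasTruncatedGrad, hG] with t h1 h2
  refine lintegral_mono_ae ?_
  filter_upwards [h1.grad_rpow (F.w_nonneg t) hc0 h2] with x hx
  rcases (F.w_nonneg t x).eq_or_lt with h0 | hpos
  · have : F.diss p m (t, x) = 0 := by
      rw [EMField.diss]; simp only [F.gradw_eq_zero h0.symm, norm_zero, Real.zero_rpow hp0.ne',
        mul_zero]
    rw [this]; simp
  · have hGx : G t x = (c * F.w t x ^ (c - 1)) • F.gradw t x := by
      ext j
      rw [hx hpos j]; simp
    have hpw : 0 ≤ F.w t x ^ (c - 1) := Real.rpow_nonneg hpos.le _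
    rw [Real.enorm_of_nonneg (F.diss_nonneg p m _), ← ofReal_norm,
      ENNReal.ofReal_rpow_of_nonneg (norm_nonneg _) hp0.le, ← ENNReal.ofReal_mul
        (Real.rpow_nonneg hc0.le _)]
    refine ENNReal.ofReal_le_ofReal (le_of_eq ?_)
    have e1 : (c - 1) * p = m := by rw [hc]; field_simp; ring
    rw [hGx, norm_smul, Real.norm_of_nonneg (mul_nonneg hc0.le hpw),
      Real.mul_rpow (mul_nonneg hc0.le hpw) (norm_nonneg _), Real.mul_rpow hc0.le hpw,
      ← Real.rpow_mul hpos.le, e1, ← mul_assoc, ← mul_assoc, ← Real.rpow_add hc0,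
      neg_add_cancel, Real.rpow_zero, one_mul, EMField.diss]

end IsGeneralizedSolution

/-- Half-spaces exhaust the space, so the whole-space version of an estimate is a limiting case of
the half-space one. -/
lemma lintegral_le_of_forall_upperHalf {f : Space N → ℝ≥0∞} (hf : AEMeasurable f volume)
    {c : ℝ≥0∞} (h : ∀ s, ∫⁻ x in upperHalf N s, f x ≤ c) : ∫⁻ x, f x ≤ c := by
  have hlim : Tendsto (fun k : ℕ => ∫⁻ x, (upperHalf N (-(k : ℝ))).indicator f x) atTop
      (𝓝 (∫⁻ x, f x)) := by
    refine lintegral_tendsto_of_tendsto_of_monotone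
      (fun k => hf.indicator (measurableSet_upperHalf _)) ?_ ?_
    · refine Eventually.of_forall fun x i j hij => ?_
      refine indicator_le_indicator_of_subset (fun y hy => ?_) (fun _ => zero_le) x
      have : (i : ℝ) ≤ j := by exact_mod_cast hij
      exact lt_of_le_of_lt (neg_le_neg this) hy
    · refine Eventually.of_forall fun x => tendsto_const_nhds.congr' ?_
      obtain ⟨k0, hk0⟩ := exists_nat_gt (-lastCoord x)
      filter_upwards [eventually_ge_atTop k0] with k hk
      have : (k0 : ℝ) ≤ k := by exact_mod_cast hk
      rw [indicator_of_mem]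
      change -(k : ℝ) < lastCoord x
      linarith
  refine le_of_tendsto' hlim fun k => ?_
  rw [lintegral_indicator (measurableSet_upperHalf _)]
  exact h _

/-- Interpolation in space and time. -/
lemma lintegral_prod_rpow_le {α β : Type*} [MeasurableSpace α] [MeasurableSpace β] {μ : Measure α}
    {ν : Measure β} [SFinite μ] [SFinite ν] {W J : α × β → ℝ≥0∞}
    (hW : AEMeasurable W (μ.prod ν)) (hJ : AEMeasurable J (μ.prod ν)) {r R k : ℝ} {C e : ℝ≥0∞}
    (hC : C ≠ ⊤) (he : e ≠ ⊤)
    (hk : 0 ≤ k) (hr : 1 ≤ r) (hrR : r ≤ R) (hR : 1 < R)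
    (hGN : ∀ᵐ t ∂μ, ∫⁻ x, W (t, x) ^ R ∂ν ≤ C * (∫⁻ x, J (t, x) ∂ν) * (∫⁻ x, W (t, x) ∂ν) ^ k)
    (hE : ∀ᵐ t ∂μ, ∫⁻ x, W (t, x) ∂ν ≤ e) :
    ∫⁻ z, W z ^ r ∂(μ.prod ν) ≤ (C * (∫⁻ z, J z ∂(μ.prod ν)) * e ^ k) ^ ((r - 1) / (R - 1)) *
      (e * μ univ) ^ (1 - (r - 1) / (R - 1)) := by
  have hR0 : 0 < R - 1 := by linarith
  -- One interpolation on the product space: the R-th power is then estimated slice by slice with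
  -- the spatial inequality, and the first power by the uniform mass bound times the total measure.
  refine (lintegral_rpow_interpolate hW hr hrR hR).trans (mul_le_mul' ?_ ?_)
  · refine ENNReal.rpow_le_rpow ?_ (div_nonneg (by linarith) hR0.le)
    rw [lintegral_prod _ (hW.pow_const R), lintegral_prod _ hJ, mul_right_comm,
      ← lintegral_const_mul' _ _ (ENNReal.mul_ne_top hC (ENNReal.rpow_ne_top_of_nonneg hk he))]
    refine lintegral_mono_ae ?_
    filter_upwards [hGN, hE] with t h1 h2
    refine h1.trans ?_
    rw [mul_right_comm]
    gcongr
  · refine ENNReal.rpow_le_rpow ?_ ?_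
    · rw [lintegral_prod _ hW, ← lintegral_const]
      exact lintegral_mono_ae hE
    · rw [sub_nonneg, div_le_one hR0]; linarith

end SpaceTime

/-! ### Young's inequality, integrability of the energy terms and time-independent test functions -/

section Energy

open scoped ENNReal

variable {N : ℕ}

/-- Young's inequality for the convection term. -/
lemma exists_young_convection {p n m : ℝ} (hp : 1 < p) (hn : 1 < n) {C δ : ℝ} (hC : 0 ≤ C)
    (hδ : 0 < δ) :
    ∃ C' : ℝ, 0 ≤ C' ∧ ∀ w g : ℝ, 0 ≤ w → 0 ≤ g →
      C * (w ^ (n - 1) * g) ≤ δ * (w ^ m * g ^ p) + C' * w ^ ((p * (n - 1) - m) / (p - 1)) := by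
  have hp0 : 0 < p := by linarith
  have hp1 : 0 < p - 1 := by linarith
  set l : ℝ := δ ^ (1 / p) with hl
  have hl0 : 0 < l := Real.rpow_pos_of_pos hδ _
  have hconj : p.HolderConjugate (p / (p - 1)) :=
    (Real.holderConjugate_iff_eq_conjExponent hp).2 rfl
  refine ⟨(C / l) ^ (p / (p - 1)), by positivity, fun w g hw hg => ?_⟩
  rcases hw.eq_or_lt with h0 | hpos
  · rw [← h0, Real.zero_rpow (by linarith : n - 1 ≠ 0), zero_mul, mul_zero]
    positivity
  set a : ℝ := l * (w ^ (m / p) * g) with ha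
  -- The split w^(n-1) g = (w^(m/p) g) · w^(n-1-m/p) makes the p-th power of the first factor the
  -- dissipation; the conjugate power of the second factor has exponent (p(n-1)-m)/(p-1). The weight
  -- l = δ^(1/p) produces the factor δ.
  set b : ℝ := C / l * w ^ (n - 1 - m / p) with hb
  have ha0 : 0 ≤ a := by positivity
  have hb0 : 0 ≤ b := by positivity
  have hab : C * (w ^ (n - 1) * g) = a * b := by
    have : w ^ (n - 1) = w ^ (m / p) * w ^ (n - 1 - m / p) := by
      rw [← Real.rpow_add hpos]; congr 1; ring
    rw [this, ha, hb]
    field_simp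
  have hap : a ^ p = δ * (w ^ m * g ^ p) := by
    rw [ha, Real.mul_rpow hl0.le (by positivity), Real.mul_rpow (by positivity) hg, hl,
      ← Real.rpow_mul hδ.le, ← Real.rpow_mul hpos.le, one_div_mul_cancel hp0.ne', Real.rpow_one,
      div_mul_cancel₀ _ hp0.ne']
  have hbq : b ^ (p / (p - 1)) = (C / l) ^ (p / (p - 1)) *
      w ^ ((p * (n - 1) - m) / (p - 1)) := by
    rw [hb, Real.mul_rpow (by positivity) (by positivity), ← Real.rpow_mul hpos.le]
    congr 2
    field_simp
  rw [hab, ← hap, ← hbq]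
  refine (Real.young_inequality_of_nonneg ha0 hb0 hconj).trans ?_
  refine add_le_add (div_le_self (by positivity) hp.le) (div_le_self (by positivity) ?_)
  rw [le_div_iff₀ hp1]; linarith

variable {T p n m : ℝ} {a₁ a₂ b₁ b₂ : Coeff N} {E₀ H₀ : Space N → Vec3} {F : EMField N}

namespace IsGeneralizedSolution

lemma continuousOn_setIntegral_w (hs : IsGeneralizedSolution T p m a₁ a₂ b₁ b₂ E₀ H₀ F)
    (S : Set (Space N)) : ContinuousOn (fun t => ∫ x in S, F.w t x) (Icc 0 T) := by
  intro s hsT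
  rw [ContinuousWithinAt, tendsto_iff_norm_sub_tendsto_zero]
  refine squeeze_zero' (Eventually.of_forall fun _ => norm_nonneg _) ?_
    (hs.energyContinuous s hsT)
  filter_upwards [self_mem_nhdsWithin] with t ht
  have i1 := hs.energyIntegrable t ht
  have i2 := hs.energyIntegrable s hsT
  rw [← integral_sub i1.integrableOn i2.integrableOn]
  refine (norm_integral_le_integral_norm _).trans ?_
  exact setIntegral_le_integral (i1.sub i2).norm (Eventually.of_forall fun _ => norm_nonneg _)

/-- A bound depending on the solution, used only for finiteness of integrals; the quantitative bound
comes later from the energy inequality. -/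
lemma exists_lintegral_w_le (hs : IsGeneralizedSolution T p m a₁ a₂ b₁ b₂ E₀ H₀ F) :
    ∃ e : ℝ≥0∞, e ≠ ⊤ ∧ ∀ t ∈ Icc 0 T, ∫⁻ x, ENNReal.ofReal (F.w t x) ≤ e := by
  obtain ⟨B, hB⟩ := isCompact_Icc.exists_bound_of_continuousOn (hs.continuousOn_setIntegral_w univ)
  refine ⟨ENNReal.ofReal B, ENNReal.ofReal_ne_top, fun t ht => ?_⟩
  rw [← ofReal_integral_eq_lintegral_ofReal (hs.energyIntegrable t ht)
    (Eventually.of_forall fun x => F.w_nonneg t x)]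
  refine ENNReal.ofReal_le_ofReal ?_
  have := hB t ht
  rw [Measure.restrict_univ] at this
  exact (le_abs_self _).trans this

/-- Almost every time slice is admissible in the Gagliardo–Nirenberg inequality. -/
lemma ae_slice_admissible (hs : IsGeneralizedSolution T p m a₁ a₂ b₁ b₂ E₀ H₀ F) (hp : 1 < p)
    (hσ : 0 < m + p) :
    ∀ᵐ t ∂(volume.restrict (Ioo 0 T)), HasTruncatedGrad (F.w t) (F.gradw t) ∧
      (∀ x, 0 ≤ F.w t x) ∧ Integrable (F.w t) ∧ AEStronglyMeasurable (F.gradw t) volume ∧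
      Integrable (fun x => F.w t x ^ m * ‖F.gradw t x‖ ^ p) := by
  have hJ := hs.integrableOn_diss hp hσ
  rw [IntegrableOn, restrict_cyl] at hJ
  have hg := hs.aestronglyMeasurable_gradw
  rw [restrict_cyl] at hg
  filter_upwards [hs.ae_hasTruncatedGrad, hJ.prod_right_ae, hg.prodMk_left,
    ae_restrict_mem measurableSet_Ioo] with t h1 h2 h3 ht
  exact ⟨h1, F.w_nonneg t, hs.energyIntegrable t ⟨ht.1.le, ht.2.le⟩, h3, h2⟩

/-- Qualitative integrability from space-time interpolation. It justifies the manipulations of the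
energy inequality; its bound is not uniform over solutions. -/
lemma integrableOn_rpow (hs : IsGeneralizedSolution T p m a₁ a₂ b₁ b₂ E₀ H₀ F)
    (hN : N = 2 ∨ N = 3) (hp : 1 < p) (hσ : 0 < m + p) (hR : 1 < m + p + p / N) {r : ℝ}
    (hr : 1 ≤ r) (hrR : r ≤ m + p + p / N) :
    IntegrableOn (fun z : ℝ × Space N => F.w z.1 z.2 ^ r) (cyl N T) := by
  obtain ⟨C, hC, hGN⟩ := exists_gagliardo_nirenberg hN hp hσ hR
  obtain ⟨e, he, hes⟩ := hs.exists_lintegral_w_le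
  refine ⟨(hs.aestronglyMeasurable_w.aemeasurable.pow_const r).aestronglyMeasurable, ?_⟩
  have hN0 : (0 : ℝ) < N := by rcases hN with rfl | rfl <;> norm_num
  have hk : 0 ≤ p / N := by positivity
  have hR0 : 0 < m + p + p / N - 1 := by linarith
  have hJi := hs.integrableOn_diss hp hσ
  have hWm : AEMeasurable (fun z : ℝ × Space N => ENNReal.ofReal (F.w z.1 z.2))
      ((volume.restrict (Ioo 0 T)).prod volume) := by
    rw [← restrict_cyl]; exact hs.aestronglyMeasurable_w.aemeasurable.ennreal_ofReal
  have hJm : AEMeasurable (fun z : ℝ × Space N => ENNReal.ofReal (F.diss p m z))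
      ((volume.restrict (Ioo 0 T)).prod volume) := by
    rw [← restrict_cyl]; exact hs.aestronglyMeasurable_diss.aemeasurable.ennreal_ofReal
  have key := lintegral_prod_rpow_le hWm hJm hC he hk hr hrR hR (by
    filter_upwards [hs.ae_slice_admissible hp hσ] with t ht
    refine lintegral_le_of_forall_upperHalf
      (ht.2.2.1.aestronglyMeasurable.aemeasurable.ennreal_ofReal.pow_const _) fun s => ?_
    refine (hGN _ _ ht.1 ht.2.1 ht.2.2.1 ht.2.2.2.1 ht.2.2.2.2 s).trans ?_
    exact mul_le_mul' (mul_le_mul_right (setLIntegral_le_lintegral _ _) _)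
      (ENNReal.rpow_le_rpow (setLIntegral_le_lintegral _ _) hk)) (by
    filter_upwards [ae_restrict_mem measurableSet_Ioo] with t ht
    exact hes t ⟨ht.1.le, ht.2.le⟩)
  have heq : ∫⁻ z in cyl N T, ‖F.w z.1 z.2 ^ r‖ₑ =
      ∫⁻ z, ENNReal.ofReal (F.w z.1 z.2) ^ r ∂((volume.restrict (Ioo 0 T)).prod volume) := by
    rw [restrict_cyl]
    refine lintegral_congr fun z => ?_
    rw [Real.enorm_of_nonneg (Real.rpow_nonneg (F.w_nonneg _ _) _),
      ENNReal.ofReal_rpow_of_nonneg (F.w_nonneg _ _) (by linarith)]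
  rw [HasFiniteIntegral, heq]
  refine key.trans_lt (ENNReal.mul_lt_top ?_ ?_)
  · refine ENNReal.rpow_lt_top_of_nonneg (div_nonneg (by linarith) hR0.le) (ENNReal.mul_ne_top
      (ENNReal.mul_ne_top hC ?_) (ENNReal.rpow_ne_top_of_nonneg hk he))
    have := hJi.lintegral_lt_top
    rw [restrict_cyl] at this
    exact this.ne
  · refine ENNReal.rpow_lt_top_of_nonneg ?_ (ENNReal.mul_ne_top he ?_)
    · rw [sub_nonneg, div_le_one hR0]; linarith
    · simp

lemma integrableOn_convection (hs : IsGeneralizedSolution T p m a₁ a₂ b₁ b₂ E₀ H₀ F)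
    (hp : 1 < p) (hn : 1 < n) (hJ : IntegrableOn (F.diss p m) (cyl N T))
    (hq : IntegrableOn (fun z : ℝ × Space N => F.w z.1 z.2 ^ ((p * (n - 1) - m) / (p - 1)))
      (cyl N T)) :
    IntegrableOn (fun z : ℝ × Space N => F.w z.1 z.2 ^ (n - 1) * ‖F.gradw z.1 z.2‖)
      (cyl N T) := by
  obtain ⟨C', hC', h⟩ := exists_young_convection (m := m) hp hn zero_le_one one_pos
  refine (hJ.add (hq.const_mul C')).mono'
    ((hs.aestronglyMeasurable_w.aemeasurable.pow_const (n - 1)).aestronglyMeasurable.mul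
      hs.aestronglyMeasurable_gradw.norm) (Eventually.of_forall fun z => ?_)
  have := h (F.w z.1 z.2) ‖F.gradw z.1 z.2‖ (F.w_nonneg _ _) (norm_nonneg _)
  rw [one_mul, one_mul] at this
  rw [Real.norm_of_nonneg (mul_nonneg (Real.rpow_nonneg (F.w_nonneg _ _) _) (norm_nonneg _))]
  exact this

end IsGeneralizedSolution

/-- Test functions which do not depend on time on the relevant time interval. -/
lemma exists_time_independent_test (T : ℝ) {ψ : Space N → ℝ} (hψ : ContDiff ℝ ∞ ψ)
    (hψc : HasCompactSupport ψ) :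
    ∃ η : ℝ × Space N → ℝ, ContDiff ℝ 1 η ∧ HasCompactSupport η ∧
      ∀ t ∈ Icc 0 T, ∀ x, η (t, x) = ψ x ∧ fderiv ℝ η (t, x) (1, 0) = 0 := by
  by_cases hT : 0 ≤ T
  swap
  · exact ⟨0, contDiff_const, HasCompactSupport.zero, fun t ht => absurd (ht.1.trans ht.2) hT⟩
  -- The plateau of radius T + 1 contains a neighbourhood of [0, T], so the time derivative vanishes
  -- at the endpoints too.
  let χ : ContDiffBump (0 : ℝ) := ⟨T + 1, T + 2, by linarith, by linarith⟩
  have hψ1 : ContDiff ℝ 1 ψ := hψ.of_le (by simp)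
  have hone : ∀ t : ℝ, |t| < T + 1 → χ t = 1 := fun t ht =>
    χ.one_of_mem_closedBall (by simpa using ht.le)
  have habs : ∀ t ∈ Icc 0 T, |t| < T + 1 := fun t ht => by
    rw [abs_of_nonneg ht.1]; linarith [ht.2]
  refine ⟨fun z => χ z.1 * ψ z.2, (χ.contDiff.comp contDiff_fst).mul (hψ1.comp contDiff_snd), ?_,
    fun t ht x => ⟨?_, ?_⟩⟩
  · refine HasCompactSupport.intro (χ.hasCompactSupport.isCompact.prod hψc.isCompact) fun z hz => ?_
    rw [mem_prod, not_and_or] at hz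
    rcases hz with hz | hz
    · rw [image_eq_zero_of_notMem_tsupport hz, zero_mul]
    · rw [image_eq_zero_of_notMem_tsupport hz, mul_zero]
  · simp only [hone t (habs t ht), one_mul]
  · have hev : (fun z : ℝ × Space N => χ z.1 * ψ z.2) =ᶠ[𝓝 (t, x)] fun z => ψ z.2 := by
      have : {z : ℝ × Space N | |z.1| < T + 1} ∈ 𝓝 (t, x) :=
        (isOpen_lt (continuous_abs.comp continuous_fst) continuous_const).mem_nhds (habs t ht)
      filter_upwards [this] with z hz
      rw [hone _ hz, one_mul]
    rw [hev.fderiv_eq]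
    have h1 := ((hψ1.differentiable (by simp) x).hasFDerivAt.comp (t, x)
      (hasFDerivAt_snd (𝕜 := ℝ) (E := ℝ) (F := Space N) (p := (t, x)))).fderiv
    simp only [Function.comp_def] at h1
    rw [h1]; simp

end Energy

/-! ### Energy inequality for compactly supported weights -/

section EnergyInequality

variable {N : ℕ}

/-- The energy inequality for test functions of the space variable. -/
theorem exists_energy_inequality (hN : N = 2 ∨ N = 3) {n d₁ d₂ d₃ : ℝ} (hn : 1 < n)
    (hd₂ : 0 ≤ d₂) (hd₃ : 0 ≤ d₃) :
    ∃ C : ℝ, 0 ≤ C ∧ ∀ (T p m : ℝ) (a₁ a₂ b₁ b₂ : Coeff N) (E₀ H₀ : Space N → Vec3) (F : EMField N),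
      1 < p → IsGeneralizedSolution T p m a₁ a₂ b₁ b₂ E₀ H₀ F →
      StructuralConditions T p n m d₁ d₂ d₃ a₁ a₂ b₁ b₂ F →
      IntegrableOn (F.diss p m) (cyl N T) →
      IntegrableOn (fun z : ℝ × Space N => F.w z.1 z.2 ^ (n - 1) * ‖F.gradw z.1 z.2‖) (cyl N T) →
      IntegrableOn (fun z : ℝ × Space N => F.w z.1 z.2 ^ n) (cyl N T) →
      ∀ᵐ τ ∂(volume.restrict (Ioo 0 T)), ∀ ψ : Space N → ℝ, ContDiff ℝ ∞ ψ → HasCompactSupport ψ →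
        (∀ x, 0 ≤ ψ x) →
        1 / 2 * (∫ x, F.w τ x * ψ x) + d₁ * (∫ z in cyl N τ, F.diss p m z * ψ z.2) ≤
          1 / 2 * (∫ x, F.w 0 x * ψ x) +
          C * ((∫ z in cyl N τ, F.w z.1 z.2 ^ (n - 1) * ‖F.gradw z.1 z.2‖ * ψ z.2) +
            ∫ z in cyl N τ, F.w z.1 z.2 ^ n * ‖fderiv ℝ ψ z.2‖) := by
  obtain ⟨C, hC0, hC⟩ := exists_exchange_bound hN hn hd₂ hd₃
  refine ⟨C, hC0, fun T p m a₁ a₂ b₁ b₂ E₀ H₀ F hp hs hstr hJ hconv hwn => ?_⟩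
  filter_upwards [hs.identities, ae_restrict_mem measurableSet_Ioo] with τ hid hτ ψ hψ hψc hψ0
  obtain ⟨η, hη, hηc, hηψ⟩ := exists_time_independent_test T hψ hψc
  obtain ⟨⟨ia1, ig1, e1⟩, ⟨ia2, ig2, e2⟩⟩ := hid η hη hηc
  have hsub : cyl N τ ⊆ cyl N T := cyl_mono hτ.2.le
  have hmem : ∀ z ∈ cyl N τ, z.1 ∈ Icc 0 T := fun z hz => ⟨hz.1.1.le, hz.1.2.le.trans hτ.2.le⟩
  have hηz : ∀ z ∈ cyl N τ, η z = ψ z.2 ∧ fderiv ℝ η z (1, 0) = 0 := fun z hz =>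
    hηψ z.1 (hmem z hz) z.2
  have mc := measurableSet_cyl (N := N) τ
  have h0T : (0 : ℝ) ∈ Icc 0 T := ⟨le_rfl, (hτ.1.trans hτ.2).le⟩
  have hτT : τ ∈ Icc 0 T := ⟨hτ.1.le, hτ.2.le⟩
  have z1 : ∫ z in cyl N τ, ‖F.E z.1 z.2‖ ^ 2 * fderiv ℝ η z (1, 0) = 0 := by
    rw [setIntegral_congr_fun (g := fun _ => (0 : ℝ)) mc fun z hz => by
      beta_reduce; rw [(hηz z hz).2, mul_zero]]
    simp
  have z2 : ∫ z in cyl N τ, ‖F.H z.1 z.2‖ ^ 2 * fderiv ℝ η z (1, 0) = 0 := by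
    rw [setIntegral_congr_fun (g := fun _ => (0 : ℝ)) mc fun z hz => by
      beta_reduce; rw [(hηz z hz).2, mul_zero]]
    simp
  rw [z1] at e1
  rw [z2] at e2
  have cη : ∀ f : ℝ × Space N → ℝ, EqOn (fun z => f z * η z) (fun z => f z * ψ z.2) (cyl N τ) :=
    fun f z hz => by beta_reduce; rw [(hηz z hz).1]
  rw [integrableOn_congr_fun (cη _) mc] at ia1 ia2 ig1 ig2
  rw [setIntegral_congr_fun mc (cη _), setIntegral_congr_fun mc (cη _)] at e1 e2
  simp only [(hηψ τ hτT _).1, (hηψ 0 h0T _).1] at e1 e2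
  have hψ1 : ContDiff ℝ 1 ψ := hψ.of_le (by simp)
  obtain ⟨Cψ, hCψ⟩ := hψ.continuous.bounded_above_of_compact_support hψc
  obtain ⟨Lψ, hLψ⟩ := (hψ1.continuous_fderiv (by simp)).bounded_above_of_compact_support
    (hψc.fderiv (𝕜 := ℝ))
  have half : ∀ (u v : Space N → Vec3), AEStronglyMeasurable u volume →
      AEStronglyMeasurable v volume → Integrable (fun x => ‖u x‖ ^ 2 + ‖v x‖ ^ 2) →
      (∫ x, ‖u x‖ ^ 2 * ψ x) + (∫ x, ‖v x‖ ^ 2 * ψ x)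
        = ∫ x, (‖u x‖ ^ 2 + ‖v x‖ ^ 2) * ψ x := by
    intro u v hu hv huv
    have i1 : Integrable (fun x => ‖u x‖ ^ 2) := huv.mono' (hu.norm.pow 2)
      (Eventually.of_forall fun x => by
        rw [Real.norm_of_nonneg (by positivity)]; nlinarith [sq_nonneg ‖v x‖])
    have i2 : Integrable (fun x => ‖v x‖ ^ 2) := huv.mono' (hv.norm.pow 2)
      (Eventually.of_forall fun x => by
        rw [Real.norm_of_nonneg (by positivity)]; nlinarith [sq_nonneg ‖u x‖])
    rw [← integral_add (i1.mul_bdd hψ.continuous.aestronglyMeasurable (Eventually.of_forall hCψ))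
      (i2.mul_bdd hψ.continuous.aestronglyMeasurable (Eventually.of_forall hCψ))]
    exact integral_congr_ae (Eventually.of_forall fun x => by ring)
  have hEτ := half _ _ (hs.measSliceE τ hτT) (hs.measSliceH τ hτT) (hs.energyIntegrable τ hτT)
  have hE0 := half _ _ (hs.measSliceE 0 h0T) (hs.measSliceH 0 h0T) (hs.energyIntegrable 0 h0T)
  have hinE : ∫ x, ‖E₀ x‖ ^ 2 * ψ x = ∫ x, ‖F.E 0 x‖ ^ 2 * ψ x :=
    integral_congr_ae (by filter_upwards [hs.initE] with x hx; rw [hx])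
  have hinH : ∫ x, ‖H₀ x‖ ^ 2 * ψ x = ∫ x, ‖F.H 0 x‖ ^ 2 * ψ x :=
    integral_congr_ae (by filter_upwards [hs.initH] with x hx; rw [hx])
  rw [hinE] at e1
  rw [hinH] at e2
  have hψc' : Continuous fun z : ℝ × Space N => ψ z.2 := hψ.continuous.comp continuous_snd
  have iJ : IntegrableOn (fun z : ℝ × Space N => F.diss p m z * ψ z.2) (cyl N τ) :=
    (hJ.mono_set hsub).mul_bdd hψc'.aestronglyMeasurable
      (Eventually.of_forall fun z => hCψ z.2)
  have hres := Measure.restrict_mono hsub (le_refl (volume : Measure (ℝ × Space N)))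
  -- The lower bound for the two damping coefficients is multiplied by |E|² and |H|² respectively;
  -- the sum of these squares restores the missing factor w. On {w = 0}, where the bound says
  -- nothing, both sides vanish.
  have hdiss : d₁ * (∫ z in cyl N τ, F.diss p m z * ψ z.2) ≤
      (∫ z in cyl N τ, F.along a₁ z.1 z.2 * ‖F.E z.1 z.2‖ ^ 2 * ψ z.2) +
      ∫ z in cyl N τ, F.along a₂ z.1 z.2 * ‖F.H z.1 z.2‖ ^ 2 * ψ z.2 := by
    rw [← integral_const_mul, ← integral_add ia1 ia2]
    refine integral_mono_ae (iJ.const_mul d₁) (ia1.add ia2) ?_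
    have l1 := ae_mono hres (hstr.lower a₁ (by simp))
    have l2 := ae_mono hres (hstr.lower a₂ (by simp))
    filter_upwards [l1, l2] with z h1 h2
    have hw := F.w_nonneg z.1 z.2
    rcases hw.eq_or_lt with h0 | hpos
    · have hd : F.diss p m z = 0 := by
        rw [EMField.diss, F.gradw_eq_zero h0.symm, norm_zero, Real.zero_rpow (by linarith),
          mul_zero]
      have hE : ‖F.E z.1 z.2‖ ^ 2 = 0 := by
        unfold EMField.w at h0
        nlinarith [sq_nonneg ‖F.E z.1 z.2‖, sq_nonneg ‖F.H z.1 z.2‖]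
      have hH : ‖F.H z.1 z.2‖ ^ 2 = 0 := by
        unfold EMField.w at h0
        nlinarith [sq_nonneg ‖F.E z.1 z.2‖, sq_nonneg ‖F.H z.1 z.2‖]
      rw [hd, hE, hH]; simp
    · have hd : F.diss p m z = F.w z.1 z.2 ^ (m - 1) * ‖F.gradw z.1 z.2‖ ^ p *
          (‖F.E z.1 z.2‖ ^ 2 + ‖F.H z.1 z.2‖ ^ 2) := by
        have : F.w z.1 z.2 ^ m = F.w z.1 z.2 ^ (m - 1) * F.w z.1 z.2 := by
          rw [← Real.rpow_add_one hpos.ne', sub_add_cancel]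
        rw [EMField.diss, this]
        conv_lhs => rw [mul_right_comm]
        rfl
      have k1 := mul_le_mul_of_nonneg_right (h1 hpos)
        (mul_nonneg (sq_nonneg ‖F.E z.1 z.2‖) (hψ0 z.2))
      have k2 := mul_le_mul_of_nonneg_right (h2 hpos)
        (mul_nonneg (sq_nonneg ‖F.H z.1 z.2‖) (hψ0 z.2))
      rw [hd]
      calc _ = d₁ * F.w z.1 z.2 ^ (m - 1) * ‖F.gradw z.1 z.2‖ ^ p *
            (‖F.E z.1 z.2‖ ^ 2 * ψ z.2) + d₁ * F.w z.1 z.2 ^ (m - 1) * ‖F.gradw z.1 z.2‖ ^ p *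
            (‖F.H z.1 z.2‖ ^ 2 * ψ z.2) := by ring
        _ ≤ _ := add_le_add k1 k2
        _ = _ := by ring
  -- Equality of the coefficients along the fields merges both exchange terms into b div(E × H).
  set X : ℝ × Space N → ℝ := fun z => F.along b₁ z.1 z.2 *
    (inner ℝ (F.H z.1 z.2) (F.gradE z.1 z.2).curl - inner ℝ (F.E z.1 z.2) (F.gradH z.1 z.2).curl) *
      ψ z.2 with hX
  have hXeq : ∀ᵐ z ∂(volume.restrict (cyl N τ)),
      -(F.along b₁ z.1 z.2 * inner ℝ (F.E z.1 z.2) (F.gradH z.1 z.2).curl) * ψ z.2 +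
        F.along b₂ z.1 z.2 * inner ℝ (F.H z.1 z.2) (F.gradE z.1 z.2).curl * ψ z.2 = X z := by
    filter_upwards [ae_mono hres hstr.equal] with z hz
    rw [hX, ← hz]; ring
  have iX : IntegrableOn X (cyl N τ) := (ig1.add ig2).congr hXeq
  have hexch : (∫ z in cyl N τ, -(F.along b₁ z.1 z.2 *
        inner ℝ (F.E z.1 z.2) (F.gradH z.1 z.2).curl) * ψ z.2) +
      (∫ z in cyl N τ, F.along b₂ z.1 z.2 *
        inner ℝ (F.H z.1 z.2) (F.gradE z.1 z.2).curl * ψ z.2) = ∫ z in cyl N τ, X z := by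
    rw [← integral_add ig1 ig2]
    exact integral_congr_ae hXeq
  have ic1 : IntegrableOn (fun z : ℝ × Space N =>
      F.w z.1 z.2 ^ (n - 1) * ‖F.gradw z.1 z.2‖ * ψ z.2) (cyl N τ) :=
    (hconv.mono_set hsub).mul_bdd hψc'.aestronglyMeasurable (Eventually.of_forall fun z => hCψ z.2)
  have hLc : Continuous fun z : ℝ × Space N => ‖fderiv ℝ ψ z.2‖ :=
    ((hψ1.continuous_fderiv (by simp)).comp continuous_snd).norm
  have ic2 : IntegrableOn (fun z : ℝ × Space N => F.w z.1 z.2 ^ n * ‖fderiv ℝ ψ z.2‖)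
      (cyl N τ) :=
    (hwn.mono_set hsub).mul_bdd hLc.aestronglyMeasurable
      (Eventually.of_forall fun z => by rw [norm_norm]; exact hLψ z.2)
  -- The spatial integration by parts is applied on almost every time slice and integrated in time.
  have hXbound : |∫ z in cyl N τ, X z| ≤ C * ((∫ z in cyl N τ,
      F.w z.1 z.2 ^ (n - 1) * ‖F.gradw z.1 z.2‖ * ψ z.2) +
        ∫ z in cyl N τ, F.w z.1 z.2 ^ n * ‖fderiv ℝ ψ z.2‖) := by
    obtain ⟨Gb, hGb, hGbb⟩ := hstr.gradBound b₁ (by simp)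
    have hbb := ae_slice (ae_mono hres (hstr.bound b₁ (by simp)))
    have hGbb' := ae_slice (ae_mono hres hGbb)
    have hres1 : (volume : Measure ℝ).restrict (Ioo 0 τ) ≤ volume.restrict (Ioo 0 T) :=
      Measure.restrict_mono (Ioo_subset_Ioo_right hτ.2.le) le_rfl
    rw [IntegrableOn, restrict_cyl] at iX ic1 ic2
    rw [restrict_cyl, integral_prod _ iX, integral_prod _ ic1, integral_prod _ ic2,
      ← integral_add ic1.integral_prod_left ic2.integral_prod_left, ← integral_const_mul,
      ← Real.norm_eq_abs]
    have ibd : Integrable (fun t => C * ((∫ x, F.w t x ^ (n - 1) * ‖F.gradw t x‖ * ψ x) +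
        ∫ x, F.w t x ^ n * ‖fderiv ℝ ψ x‖)) (volume.restrict (Ioo 0 τ)) :=
      (ic1.integral_prod_left.add ic2.integral_prod_left).const_mul C
    refine norm_integral_le_of_norm_le ibd ?_
    filter_upwards [hbb, hGbb', ae_mono hres1 hGb, ae_mono hres1 hs.weakGradE,
      ae_mono hres1 hs.weakGradH, iX.prod_right_ae, ic1.prod_right_ae, ic2.prod_right_ae]
      with t t1 t2 t3 t4 t5 t6 t7 t8
    exact hC (F.E t) (F.H t) (F.gradE t) (F.gradH t) (F.along b₁ t) (Gb t) (F.gradw t) (F.w t)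
      t4 t5 t3 rfl rfl t1 t2 ψ hψ hψc hψ0 t6 t7 t8
  have hXl := (abs_le.1 hXbound).1
  have hwτ : ∫ x, F.w τ x * ψ x = ∫ x, (‖F.E τ x‖ ^ 2 + ‖F.H τ x‖ ^ 2) * ψ x := rfl
  have hw0 : ∫ x, F.w 0 x * ψ x = ∫ x, (‖F.E 0 x‖ ^ 2 + ‖F.H 0 x‖ ^ 2) * ψ x := rfl
  rw [hwτ, hw0, ← hEτ, ← hE0]
  linarith

end EnergyInequality

/-! ### Weights without compact support -/

section HalfSpaceEnergy

variable {N : ℕ}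

lemma tendsto_setIntegral_mul_cutoff {A : Set (ℝ × Space N)} {f : ℝ × Space N → ℝ}
    (hf : IntegrableOn f A) :
    Tendsto (fun k => ∫ z in A, f z * cutoff (Space N) k z.2) atTop (𝓝 (∫ z in A, f z)) := by
  have hc : ∀ k, Continuous fun z : ℝ × Space N => cutoff (Space N) k z.2 := fun k =>
    (cutoff_contDiff k).continuous.comp continuous_snd
  refine tendsto_integral_of_dominated_convergence (fun z => ‖f z‖) ?_ hf.norm ?_ ?_
  · exact fun k => hf.aestronglyMeasurable.mul (hc k).aestronglyMeasurable
  · refine fun k => Eventually.of_forall fun z => ?_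
    rw [norm_mul, Real.norm_of_nonneg (cutoff_nonneg k z.2)]
    exact mul_le_of_le_one_right (norm_nonneg _) (cutoff_le_one k z.2)
  · exact Eventually.of_forall fun z => by simpa using (cutoff_tendsto z.2).const_mul (f z)

/-- The energy inequality with bounded smooth weights. -/
theorem exists_weighted_energy_inequality (hN : N = 2 ∨ N = 3) {p n m d₁ d₂ d₃ : ℝ} (hp : 1 < p)
    (hn : 1 < n) (hσ : 0 < m + p) (hnR : n ≤ m + p + p / N)
    (hq : 1 ≤ (p * (n - 1) - m) / (p - 1)) (hqR : (p * (n - 1) - m) / (p - 1) ≤ m + p + p / N)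
    (hd₁ : 0 < d₁) (hd₂ : 0 ≤ d₂) (hd₃ : 0 ≤ d₃) :
    ∃ C : ℝ, 0 ≤ C ∧ ∀ (T : ℝ) (a₁ a₂ b₁ b₂ : Coeff N) (E₀ H₀ : Space N → Vec3) (F : EMField N),
      IsGeneralizedSolution T p m a₁ a₂ b₁ b₂ E₀ H₀ F →
      StructuralConditions T p n m d₁ d₂ d₃ a₁ a₂ b₁ b₂ F →
      ∀ᵐ τ ∂(volume.restrict (Ioo 0 T)), ∀ (ζ : Space N → ℝ) (L : ℝ), ContDiff ℝ ∞ ζ →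
        (∀ x, 0 ≤ ζ x) → (∀ x, ζ x ≤ 1) → (∀ x, ‖fderiv ℝ ζ x‖ ≤ L) →
        1 / 2 * (∫ x, F.w τ x * ζ x) + d₁ / 2 * (∫ z in cyl N τ, F.diss p m z * ζ z.2) ≤
          1 / 2 * (∫ x, F.w 0 x * ζ x) +
          C * ((∫ z in cyl N τ, F.w z.1 z.2 ^ ((p * (n - 1) - m) / (p - 1)) * ζ z.2) +
            ∫ z in cyl N τ, F.w z.1 z.2 ^ n * ‖fderiv ℝ ζ z.2‖) := by
  obtain ⟨C₁, hC₁, hE⟩ := exists_energy_inequality (d₁ := d₁) hN hn hd₂ hd₃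
  -- Young's inequality with weight d₁/2 spends half of the dissipation and keeps the other half on
  -- the left.
  obtain ⟨C₂, hC₂, hY⟩ := exists_young_convection (m := m) hp hn hC₁ (half_pos hd₁)
  obtain ⟨B, hB0, hB⟩ := exists_cutoff_fderiv_bound (Space N)
  refine ⟨C₁ + C₂, by positivity, fun T a₁ a₂ b₁ b₂ E₀ H₀ F hs hstr => ?_⟩
  set q := (p * (n - 1) - m) / (p - 1) with hqdef
  have hR : 1 < m + p + p / N := hn.trans_le hnR
  have hJ := hs.integrableOn_diss hp hσ
  have hwq := hs.integrableOn_rpow hN hp hσ hR hq hqR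
  have hwn := hs.integrableOn_rpow hN hp hσ hR hn.le hnR
  have hcv := hs.integrableOn_convection hp hn hJ hwq
  filter_upwards [hE T p m a₁ a₂ b₁ b₂ E₀ H₀ F hp hs hstr hJ hcv hwn,
    ae_restrict_mem measurableSet_Ioo] with τ hτE hτ ζ L hζ hζ0 hζ1 hL
  have hsub : cyl N τ ⊆ cyl N T := cyl_mono hτ.2.le
  have hζ' : ContDiff ℝ 1 ζ := hζ.of_le (by simp)
  have hζb : ∀ x, ‖ζ x‖ ≤ 1 := fun x => by rw [Real.norm_of_nonneg (hζ0 x)]; exact hζ1 x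
  have hζc : Continuous fun z : ℝ × Space N => ζ z.2 := hζ.continuous.comp continuous_snd
  have hLc : Continuous fun z : ℝ × Space N => ‖fderiv ℝ ζ z.2‖ :=
    ((hζ'.continuous_fderiv (by simp)).comp continuous_snd).norm
  have iw : ∀ t ∈ Icc 0 T, Integrable fun x => F.w t x * ζ x := fun t ht =>
    (hs.energyIntegrable t ht).mul_bdd hζ.continuous.aestronglyMeasurable
      (Eventually.of_forall hζb)
  have iζ : ∀ f : ℝ × Space N → ℝ, IntegrableOn f (cyl N T) →
      IntegrableOn (fun z => f z * ζ z.2) (cyl N τ) := fun f hf =>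
    (hf.mono_set hsub).mul_bdd hζc.aestronglyMeasurable (Eventually.of_forall fun z => hζb z.2)
  have iL : IntegrableOn (fun z : ℝ × Space N => F.w z.1 z.2 ^ n * ‖fderiv ℝ ζ z.2‖) (cyl N τ) :=
    (hwn.mono_set hsub).mul_bdd hLc.aestronglyMeasurable
      (Eventually.of_forall fun z => by rw [norm_norm]; exact hL z.2)
  have hwn' := hwn.mono_set hsub
  -- The weight ζ is multiplied by a spatial cutoff whose gradient costs B/(k+1) times the integral
  -- of w^n, which is finite and so disappears in the limit.
  have step : ∀ k : ℕ, 1 / 2 * (∫ x, F.w τ x * ζ x * cutoff (Space N) k x) +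
      d₁ / 2 * (∫ z in cyl N τ, F.diss p m z * ζ z.2 * cutoff (Space N) k z.2) ≤
      1 / 2 * (∫ x, F.w 0 x * ζ x * cutoff (Space N) k x) +
      (C₁ + C₂) * ((∫ z in cyl N τ, F.w z.1 z.2 ^ q * ζ z.2 * cutoff (Space N) k z.2) +
        ((∫ z in cyl N τ, F.w z.1 z.2 ^ n * ‖fderiv ℝ ζ z.2‖) +
          B / ((k : ℝ) + 1) * ∫ z in cyl N τ, F.w z.1 z.2 ^ n)) := by
    intro k
    have hχ := cutoff_contDiff (X := Space N) k
    have hχ0 := cutoff_nonneg (X := Space N) k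
    have hχ1 := cutoff_le_one (X := Space N) k
    have hχc : Continuous fun z : ℝ × Space N => cutoff (Space N) k z.2 :=
      hχ.continuous.comp continuous_snd
    have iχ : ∀ f : ℝ × Space N → ℝ, IntegrableOn f (cyl N τ) →
        IntegrableOn (fun z => f z * cutoff (Space N) k z.2) (cyl N τ) := fun f hf =>
      hf.mul_bdd hχc.aestronglyMeasurable (Eventually.of_forall fun z => by
        rw [Real.norm_of_nonneg (hχ0 _)]; exact hχ1 _)
    have key := hτE (fun x => ζ x * cutoff (Space N) k x) (hζ.mul hχ)
      (cutoff_hasCompactSupport k).mul_left (fun x => mul_nonneg (hζ0 x) (hχ0 x))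
    simp only [← mul_assoc] at key
    have k1 : C₁ * (∫ z in cyl N τ, F.w z.1 z.2 ^ (n - 1) * ‖F.gradw z.1 z.2‖ * ζ z.2 *
        cutoff (Space N) k z.2) ≤
        d₁ / 2 * (∫ z in cyl N τ, F.diss p m z * ζ z.2 * cutoff (Space N) k z.2) +
        C₂ * ∫ z in cyl N τ, F.w z.1 z.2 ^ q * ζ z.2 * cutoff (Space N) k z.2 := by
      have j1 := iχ _ (iζ _ hcv)
      have j2 := iχ _ (iζ _ hJ)
      have j3 := iχ _ (iζ _ hwq)
      rw [← integral_const_mul, ← integral_const_mul, ← integral_const_mul,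
        ← integral_add (j2.const_mul _) (j3.const_mul _)]
      refine integral_mono (j1.const_mul _) ((j2.const_mul _).add (j3.const_mul _)) fun z => ?_
      have := mul_le_mul_of_nonneg_right (hY (F.w z.1 z.2) ‖F.gradw z.1 z.2‖ (F.w_nonneg _ _)
        (norm_nonneg _)) (mul_nonneg (hζ0 z.2) (hχ0 z.2))
      calc _ = C₁ * (F.w z.1 z.2 ^ (n - 1) * ‖F.gradw z.1 z.2‖) *
            (ζ z.2 * cutoff (Space N) k z.2) := by ring
        _ ≤ _ := this
        _ = _ := by simp only [EMField.diss]; ring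
    have k2 : ∫ z in cyl N τ, F.w z.1 z.2 ^ n *
          ‖fderiv ℝ (fun x => ζ x * cutoff (Space N) k x) z.2‖ ≤
        (∫ z in cyl N τ, F.w z.1 z.2 ^ n * ‖fderiv ℝ ζ z.2‖) +
          B / ((k : ℝ) + 1) * ∫ z in cyl N τ, F.w z.1 z.2 ^ n := by
      rw [← integral_const_mul, ← integral_add iL (hwn'.const_mul _)]
      have hfd : ∀ x, ‖fderiv ℝ (fun x => ζ x * cutoff (Space N) k x) x‖ ≤
          ‖fderiv ℝ ζ x‖ + B / ((k : ℝ) + 1) := by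
        intro x
        have h1 : fderiv ℝ (fun x => ζ x * cutoff (Space N) k x) x = _ :=
          ((hζ'.differentiable (by simp) x).hasFDerivAt.mul
            (hχ.differentiable (by simp) x).hasFDerivAt).fderiv
        rw [h1]
        refine (norm_add_le _ _).trans ?_
        rw [norm_smul, norm_smul, Real.norm_of_nonneg (hχ0 x), add_comm]
        exact add_le_add (mul_le_of_le_one_left (norm_nonneg _) (hχ1 x))
          ((mul_le_of_le_one_left (norm_nonneg _) (hζb x)).trans (hB k x))
      refine integral_mono_of_nonneg (Eventually.of_forall fun z => mul_nonneg
        (Real.rpow_nonneg (F.w_nonneg _ _) _) (norm_nonneg _)) (iL.add (hwn'.const_mul _))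
        (Eventually.of_forall fun z => ?_)
      calc _ ≤ F.w z.1 z.2 ^ n * (‖fderiv ℝ ζ z.2‖ + B / ((k : ℝ) + 1)) :=
            mul_le_mul_of_nonneg_left (hfd z.2) (Real.rpow_nonneg (F.w_nonneg _ _) _)
        _ = _ := by beta_reduce; ring
    have p1 : 0 ≤ ∫ z in cyl N τ, F.w z.1 z.2 ^ q * ζ z.2 * cutoff (Space N) k z.2 :=
      integral_nonneg fun z => mul_nonneg (mul_nonneg (Real.rpow_nonneg (F.w_nonneg _ _) _)
        (hζ0 _)) (hχ0 _)
    have p2 : 0 ≤ (∫ z in cyl N τ, F.w z.1 z.2 ^ n * ‖fderiv ℝ ζ z.2‖) +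
          B / ((k : ℝ) + 1) * ∫ z in cyl N τ, F.w z.1 z.2 ^ n :=
      add_nonneg (integral_nonneg fun z => mul_nonneg (Real.rpow_nonneg (F.w_nonneg _ _) _)
        (norm_nonneg _)) (mul_nonneg (by positivity)
        (integral_nonneg fun z => Real.rpow_nonneg (F.w_nonneg _ _) _))
    have k3 := mul_le_mul_of_nonneg_left k2 hC₁
    have p3 := mul_nonneg hC₁ p1
    have p4 := mul_nonneg hC₂ p2
    linarith
  have hzero : Tendsto (fun k : ℕ => B / ((k : ℝ) + 1) * ∫ z in cyl N τ, F.w z.1 z.2 ^ n) atTop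
      (𝓝 0) := by
    have h := ((tendsto_one_div_add_atTop_nhds_zero_nat (𝕜 := ℝ)).const_mul B).mul_const
      (∫ z in cyl N τ, F.w z.1 z.2 ^ n)
    simpa [div_eq_mul_inv] using h
  have h0T : (0 : ℝ) ∈ Icc 0 T := ⟨le_rfl, (hτ.1.trans hτ.2).le⟩
  have hτT : τ ∈ Icc 0 T := ⟨hτ.1.le, hτ.2.le⟩
  have lhs := ((tendsto_mul_cutoff_integral (iw τ hτT)).const_mul (1 / 2)).add
    ((tendsto_setIntegral_mul_cutoff (iζ _ hJ)).const_mul (d₁ / 2))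
  have rhs := ((tendsto_mul_cutoff_integral (iw 0 h0T)).const_mul (1 / 2)).add
    (((tendsto_setIntegral_mul_cutoff (iζ _ hwq)).add (hzero.const_add
      (∫ z in cyl N τ, F.w z.1 z.2 ^ n * ‖fderiv ℝ ζ z.2‖))).const_mul (C₁ + C₂))
  rw [add_zero] at rhs
  exact le_of_tendsto_of_tendsto' lhs rhs step

end HalfSpaceEnergy

/-! ### Localized energy inequality and parabolic interpolation -/

section LocalizedEnergy

variable {N : ℕ}

/-- Integrability is not needed: a nonintegrable function has Bochner integral 0. The converse
estimate `setLIntegral_le_ofReal_integral` does need it. -/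
lemma ofReal_integral_le_lintegral {α : Type*} [MeasurableSpace α] {μ : Measure α} {f : α → ℝ}
    (hf : ∀ x, 0 ≤ f x) : ENNReal.ofReal (∫ x, f x ∂μ) ≤ ∫⁻ x, ENNReal.ofReal (f x) ∂μ := by
  have h := enorm_integral_le_lintegral_enorm (μ := μ) f
  rw [Real.enorm_of_nonneg (integral_nonneg hf)] at h
  exact h.trans_eq (lintegral_congr fun x => Real.enorm_of_nonneg (hf x))

lemma setLIntegral_le_ofReal_integral {α : Type*} [MeasurableSpace α] {μ : Measure α} {f ζ : α → ℝ}
    {A B : Set α} (hAB : A ⊆ B) (hA : MeasurableSet A) (hζ : ∀ x, 0 ≤ ζ x) (hf : ∀ x, 0 ≤ f x)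
    (h1 : ∀ x ∈ A, ζ x = 1) (hi : IntegrableOn (fun x => f x * ζ x) B μ) :
    ∫⁻ x in A, ENNReal.ofReal (f x) ∂μ ≤ ENNReal.ofReal (∫ x in B, f x * ζ x ∂μ) := by
  rw [ofReal_integral_eq_lintegral_ofReal hi
    (Eventually.of_forall fun x => mul_nonneg (hf x) (hζ x))]
  refine le_trans (le_of_eq ?_) (lintegral_mono_set hAB)
  exact setLIntegral_congr_fun hA fun x hx => by simp [h1 x hx]

lemma ofReal_integral_cyl_le {f ζ : ℝ × Space N → ℝ} {τ L : ℝ} {S : Set (Space N)}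
    (hS : MeasurableSet S) (hf : ∀ z, 0 ≤ f z) (hζ : ∀ z, 0 ≤ ζ z) (hL : ∀ z, ζ z ≤ L)
    (h0 : ∀ z, z.2 ∉ S → ζ z = 0) :
    ENNReal.ofReal (∫ z in cyl N τ, f z * ζ z) ≤
      ENNReal.ofReal L * ∫⁻ z in Ioo 0 τ ×ˢ S, ENNReal.ofReal (f z) := by
  refine (ofReal_integral_le_lintegral fun z => mul_nonneg (hf z) (hζ z)).trans ?_
  have hm : MeasurableSet (Ioo 0 τ ×ˢ S) := measurableSet_Ioo.prod hS
  rw [← lintegral_const_mul' _ _ ENNReal.ofReal_ne_top, ← lintegral_indicator hm,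
    ← lintegral_indicator (measurableSet_cyl τ)]
  refine lintegral_mono fun z => ?_
  by_cases hz : z ∈ Ioo 0 τ ×ˢ S
  · rw [indicator_of_mem hz, indicator_of_mem (show z ∈ cyl N τ from ⟨hz.1, mem_univ _⟩),
      mul_comm (f z), ENNReal.ofReal_mul (hζ z)]
    exact mul_le_mul' (ENNReal.ofReal_le_ofReal (hL z)) le_rfl
  · rw [indicator_of_notMem hz]
    by_cases hzc : z ∈ cyl N τ
    · rw [indicator_of_mem hzc, h0 z fun h => hz ⟨hzc.1, h⟩]; simp
    · rw [indicator_of_notMem hzc]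

/-- The energy inequality localized by a cut-off function which is `1` on `S'` and supported
in `S`. -/
theorem exists_localized_energy_inequality (hN : N = 2 ∨ N = 3) {p n m d₁ d₂ d₃ : ℝ} (hp : 1 < p)
    (hn : 1 < n) (hσ : 0 < m + p) (hnR : n ≤ m + p + p / N)
    (hq : 1 ≤ (p * (n - 1) - m) / (p - 1)) (hqR : (p * (n - 1) - m) / (p - 1) ≤ m + p + p / N)
    (hd₁ : 0 < d₁) (hd₂ : 0 ≤ d₂) (hd₃ : 0 ≤ d₃) :
    ∃ C : ℝ, 0 ≤ C ∧ ∀ (T : ℝ) (a₁ a₂ b₁ b₂ : Coeff N) (E₀ H₀ : Space N → Vec3) (F : EMField N),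
      IsGeneralizedSolution T p m a₁ a₂ b₁ b₂ E₀ H₀ F →
      StructuralConditions T p n m d₁ d₂ d₃ a₁ a₂ b₁ b₂ F →
      ∀ᵐ τ ∂(volume.restrict (Ioo 0 T)), ∀ (S S' : Set (Space N)) (ζ : Space N → ℝ) (L : ℝ),
        MeasurableSet S → MeasurableSet S' → ContDiff ℝ ∞ ζ →
        (∀ x, 0 ≤ ζ x) → (∀ x, ζ x ≤ 1) → (∀ x, ‖fderiv ℝ ζ x‖ ≤ L) → (∀ x ∈ S', ζ x = 1) →
        (∀ x, x ∉ S → ζ x = 0 ∧ fderiv ℝ ζ x = 0) →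
        (∫⁻ x in S', ENNReal.ofReal (F.w τ x)) +
            ENNReal.ofReal d₁ * (∫⁻ z in Ioo 0 τ ×ˢ S', ENNReal.ofReal (F.diss p m z)) ≤
          ENNReal.ofReal (∫ x, F.w 0 x * ζ x) + ENNReal.ofReal C *
            ((∫⁻ z in Ioo 0 τ ×ˢ S,
                ENNReal.ofReal (F.w z.1 z.2) ^ ((p * (n - 1) - m) / (p - 1))) +
              ENNReal.ofReal L * ∫⁻ z in Ioo 0 τ ×ˢ S, ENNReal.ofReal (F.w z.1 z.2) ^ n) := by
  obtain ⟨C, hC, hCi⟩ :=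
    exists_weighted_energy_inequality hN hp hn hσ hnR hq hqR hd₁ hd₂ hd₃
  -- Doubling removes the factors 1/2 in front of the energies and in front of d₁.
  refine ⟨2 * C, by positivity, fun T a₁ a₂ b₁ b₂ E₀ H₀ F hs hc => ?_⟩
  filter_upwards [hCi T a₁ a₂ b₁ b₂ E₀ H₀ F hs hc, ae_restrict_mem measurableSet_Ioo] with
    τ hτ hτT S S' ζ L hS hS' hζ hζ0 hζ1 hζL h1 h0
  have key := hτ ζ L hζ hζ0 hζ1 hζL
  have hζb : ∀ x, ‖ζ x‖ ≤ 1 := fun x => by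
    rw [Real.norm_of_nonneg (hζ0 x)]; exact hζ1 x
  have hwi := hs.energyIntegrable τ ⟨hτT.1.le, hτT.2.le⟩
  have hdi : IntegrableOn (F.diss p m) (cyl N τ) :=
    (hs.integrableOn_diss hp hσ).mono_set (cyl_mono hτT.2.le)
  have e1 : (∫⁻ x in S', ENNReal.ofReal (F.w τ x)) ≤ ENNReal.ofReal (∫ x, F.w τ x * ζ x) := by
    have := setLIntegral_le_ofReal_integral (μ := volume) (subset_univ S') hS' hζ0 (F.w_nonneg τ) h1
      (by
        rw [integrableOn_univ]
        exact hwi.mul_bdd hζ.continuous.aestronglyMeasurable (Eventually.of_forall hζb))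
    rwa [setIntegral_univ] at this
  have e2 : (∫⁻ z in Ioo 0 τ ×ˢ S', ENNReal.ofReal (F.diss p m z)) ≤
      ENNReal.ofReal (∫ z in cyl N τ, F.diss p m z * ζ z.2) :=
    setLIntegral_le_ofReal_integral (ζ := fun z : ℝ × Space N => ζ z.2)
      (prod_mono_right (subset_univ S')) (measurableSet_Ioo.prod hS')
      (fun z => hζ0 _) (F.diss_nonneg p m) (fun z hz => h1 _ hz.2)
      (hdi.mul_bdd (hζ.continuous.comp continuous_snd).aestronglyMeasurable
        (Eventually.of_forall fun z => hζb _))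
  have e3 := ofReal_integral_cyl_le (τ := τ) (ζ := fun z => ζ z.2)
    (f := fun z => F.w z.1 z.2 ^ ((p * (n - 1) - m) / (p - 1))) hS
    (fun z => Real.rpow_nonneg (F.w_nonneg _ _) _) (fun z => hζ0 _) (fun z => hζ1 _)
    (fun z hz => (h0 _ hz).1)
  have e4 := ofReal_integral_cyl_le (τ := τ) (ζ := fun z => ‖fderiv ℝ ζ z.2‖)
    (f := fun z => F.w z.1 z.2 ^ n) hS
    (fun z => Real.rpow_nonneg (F.w_nonneg _ _) _) (fun z => norm_nonneg _) (fun z => hζL _)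
    (fun z hz => by simp [(h0 _ hz).2])
  simp only [ENNReal.ofReal_one, one_mul] at e3
  have r1 : ∀ r : ℝ, 0 ≤ r → ∀ z : ℝ × Space N,
      ENNReal.ofReal (F.w z.1 z.2 ^ r) = ENNReal.ofReal (F.w z.1 z.2) ^ r := fun r hr z =>
    (ENNReal.ofReal_rpow_of_nonneg (F.w_nonneg _ _) hr).symm
  simp only [r1 _ (zero_le_one.trans hq)] at e3
  simp only [r1 n (by linarith)] at e4
  have i1 : 0 ≤ ∫ x, F.w τ x * ζ x := integral_nonneg fun x => mul_nonneg (F.w_nonneg _ _) (hζ0 x)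
  have i2 : 0 ≤ ∫ z in cyl N τ, F.diss p m z * ζ z.2 :=
    integral_nonneg fun z => mul_nonneg (F.diss_nonneg p m z) (hζ0 _)
  have i3 : 0 ≤ ∫ z in cyl N τ, F.w z.1 z.2 ^ ((p * (n - 1) - m) / (p - 1)) * ζ z.2 :=
    integral_nonneg fun z => mul_nonneg (Real.rpow_nonneg (F.w_nonneg _ _) _) (hζ0 _)
  have i4 : 0 ≤ ∫ z in cyl N τ, F.w z.1 z.2 ^ n * ‖fderiv ℝ ζ z.2‖ :=
    integral_nonneg fun z => mul_nonneg (Real.rpow_nonneg (F.w_nonneg _ _) _) (norm_nonneg _)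
  have i0 : 0 ≤ ∫ x, F.w 0 x * ζ x := integral_nonneg fun x => mul_nonneg (F.w_nonneg _ _) (hζ0 x)
  calc _ ≤ ENNReal.ofReal (∫ x, F.w τ x * ζ x) +
        ENNReal.ofReal d₁ * ENNReal.ofReal (∫ z in cyl N τ, F.diss p m z * ζ z.2) :=
      add_le_add e1 (mul_le_mul' le_rfl e2)
    _ = ENNReal.ofReal ((∫ x, F.w τ x * ζ x) +
        d₁ * (∫ z in cyl N τ, F.diss p m z * ζ z.2)) := by
      rw [ENNReal.ofReal_add i1 (by positivity), ENNReal.ofReal_mul hd₁.le]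
    _ ≤ ENNReal.ofReal ((∫ x, F.w 0 x * ζ x) + 2 * C *
        ((∫ z in cyl N τ, F.w z.1 z.2 ^ ((p * (n - 1) - m) / (p - 1)) * ζ z.2) +
          ∫ z in cyl N τ, F.w z.1 z.2 ^ n * ‖fderiv ℝ ζ z.2‖)) :=
      ENNReal.ofReal_le_ofReal (by linarith)
    _ = ENNReal.ofReal (∫ x, F.w 0 x * ζ x) + ENNReal.ofReal (2 * C) *
        (ENNReal.ofReal (∫ z in cyl N τ, F.w z.1 z.2 ^ ((p * (n - 1) - m) / (p - 1)) * ζ z.2) +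
          ENNReal.ofReal (∫ z in cyl N τ, F.w z.1 z.2 ^ n * ‖fderiv ℝ ζ z.2‖)) := by
      rw [ENNReal.ofReal_add i0 (by positivity), ENNReal.ofReal_mul (by positivity),
        ENNReal.ofReal_add i3 i4]
    _ ≤ _ := add_le_add le_rfl (mul_le_mul' le_rfl (add_le_add e3 e4))

/-- The parabolic interpolation inequality along a generalized solution, on the whole space or on a
half-space. -/
theorem exists_parabolic_interpolation (hN : N = 2 ∨ N = 3) {p m : ℝ} (hp : 1 < p)
    (hσ : 0 < m + p) (hR : 1 < m + p + p / N) :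
    ∃ C : ℝ, 0 < C ∧ ∀ (T : ℝ) (a₁ a₂ b₁ b₂ : Coeff N) (E₀ H₀ : Space N → Vec3) (F : EMField N),
      IsGeneralizedSolution T p m a₁ a₂ b₁ b₂ E₀ H₀ F →
      ∀ (S : Set (Space N)), (S = univ ∨ ∃ s, S = upperHalf N s) → ∀ (τ r e j : ℝ),
        0 ≤ τ → τ ≤ T → 1 ≤ r → r ≤ m + p + p / N → 0 ≤ e → 0 ≤ j →
        (∀ᵐ t ∂(volume.restrict (Ioo 0 τ)),
          ∫⁻ x in S, ENNReal.ofReal (F.w t x) ≤ ENNReal.ofReal e) →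
        (∫⁻ z in Ioo 0 τ ×ˢ S, ENNReal.ofReal (F.diss p m z)) ≤ ENNReal.ofReal j →
        ∫⁻ z in Ioo 0 τ ×ˢ S, ENNReal.ofReal (F.w z.1 z.2) ^ r ≤
          ENNReal.ofReal ((C * j * e ^ (p / N)) ^ ((r - 1) / (m + p + p / N - 1)) *
            (e * τ) ^ (1 - (r - 1) / (m + p + p / N - 1))) := by
  obtain ⟨C, hC, hGN⟩ := exists_gagliardo_nirenberg hN hp hσ hR
  have hN0 : (0 : ℝ) < N := by rcases hN with rfl | rfl <;> norm_num
  have hk : 0 ≤ p / N := by positivity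
  have hR0 : 0 < m + p + p / N - 1 := by linarith
  -- Adding 1 makes the constant positive.
  refine ⟨C.toReal + 1, by positivity, fun T a₁ a₂ b₁ b₂ E₀ H₀ F hs S hS τ r e j hτ hτT hr hrR
    he hj hE hJ => ?_⟩
  have hSm : MeasurableSet S := by
    rcases hS with rfl | ⟨s, rfl⟩
    exacts [MeasurableSet.univ, measurableSet_upperHalf s]
  have hsub : Ioo 0 τ ×ˢ S ⊆ cyl N T :=
    prod_mono (Ioo_subset_Ioo_right hτT) (subset_univ S)
  have hprod : (volume.restrict (Ioo 0 τ)).prod (volume.restrict S) =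
      (volume : Measure (ℝ × Space N)).restrict (Ioo 0 τ ×ˢ S) := Measure.prod_restrict _ _
  have hθ1 : (r - 1) / (m + p + p / N - 1) ≤ 1 := by rw [div_le_one hR0]; linarith
  have hθ0 : 0 ≤ (r - 1) / (m + p + p / N - 1) := div_nonneg (by linarith) hR0.le
  have key := lintegral_prod_rpow_le (μ := volume.restrict (Ioo 0 τ)) (ν := volume.restrict S)
    (W := fun z => ENNReal.ofReal (F.w z.1 z.2)) (J := fun z => ENNReal.ofReal (F.diss p m z))
    (by rw [hprod]
        exact (hs.aestronglyMeasurable_w.aemeasurable.ennreal_ofReal).mono_set hsub)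
    (by rw [hprod]
        exact (hs.aestronglyMeasurable_diss.aemeasurable.ennreal_ofReal).mono_set hsub)
    hC (e := ENNReal.ofReal e) ENNReal.ofReal_ne_top hk hr hrR hR (by
      filter_upwards [ae_restrict_of_ae_restrict_of_subset (Ioo_subset_Ioo_right hτT)
        (hs.ae_slice_admissible hp hσ)] with t ht
      have h := hGN _ _ ht.1 ht.2.1 ht.2.2.1 ht.2.2.2.1 ht.2.2.2.2
      rcases hS with rfl | ⟨s, rfl⟩
      · rw [Measure.restrict_univ]
        refine lintegral_le_of_forall_upperHalf
          (ht.2.2.1.aestronglyMeasurable.aemeasurable.ennreal_ofReal.pow_const _) fun s => ?_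
        refine (h s).trans ?_
        exact mul_le_mul' (mul_le_mul_right (setLIntegral_le_lintegral _ _) _)
          (ENNReal.rpow_le_rpow (setLIntegral_le_lintegral _ _) hk)
      · exact h s) hE
  rw [hprod] at key
  refine key.trans ?_
  rw [ENNReal.ofReal_mul (by positivity), ← ENNReal.ofReal_rpow_of_nonneg (by positivity) hθ0,
    ← ENNReal.ofReal_rpow_of_nonneg (by positivity) (by linarith),
    ENNReal.ofReal_mul (by positivity), ENNReal.ofReal_mul (by positivity), ENNReal.ofReal_mul he,
    ← ENNReal.ofReal_rpow_of_nonneg he hk, Measure.restrict_apply_univ, Real.volume_Ioo, sub_zero]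
  refine mul_le_mul' (ENNReal.rpow_le_rpow (mul_le_mul' (mul_le_mul' ?_ hJ) le_rfl) hθ0) le_rfl
  rw [ENNReal.ofReal_add ENNReal.toReal_nonneg zero_le_one, ENNReal.ofReal_toReal hC]
  exact le_self_add

end LocalizedEnergy

/-! ### Uniform bound for mass and dissipation on a short time interval -/

section GlobalBound

variable {N : ℕ}

/-- If f exceeded c at t, it would do so on an interval to the left of t, which has positive
measure. This turns statements for almost every time into statements at a given time. -/
lemma ContinuousOn.le_of_ae_le_left {f : ℝ → ℝ} {T t c : ℝ} (hf : ContinuousOn f (Icc 0 T))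
    (ht : t ∈ Ioc 0 T) (h : ∀ᵐ τ ∂(volume.restrict (Ioo 0 t)), f τ ≤ c) : f t ≤ c := by
  by_contra! hc
  have h1 : ∀ᶠ s in 𝓝[Icc 0 T] t, c < f s :=
    (hf t ⟨ht.1.le, ht.2⟩).eventually (lt_mem_nhds hc)
  have hmem : Ioo 0 t ∈ 𝓝[<] t := Ioo_mem_nhdsLT ht.1
  have h2 : ∀ᶠ s in 𝓝[<] t, c < f s := by
    have : 𝓝[<] t ≤ 𝓝[Icc 0 T] t := by
      refine le_inf nhdsWithin_le_nhds (le_principal_iff.2 (mem_of_superset hmem ?_))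
      exact fun s hs => ⟨hs.1.le, hs.2.le.trans ht.2⟩
    exact this h1
  obtain ⟨l, hl, hls⟩ := (mem_nhdsLT_iff_exists_Ioo_subset).1 (h2.and hmem)
  rw [ae_restrict_iff' measurableSet_Ioo] at h
  have h0 : volume (Ioo l t) = 0 := by
    refine measure_mono_null (fun s hs => ?_) h
    have := hls hs
    simp only [mem_compl_iff, mem_ofPred_eq, not_forall, not_le]
    exact ⟨this.2, this.1⟩
  rw [Real.volume_Ioo, ENNReal.ofReal_eq_zero] at h0
  have : l < t := hl
  linarith

/-- By compactness there is a first time at which f reaches b. Before it f stays below b, so the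
hypothesis contradicts the choice of that time. -/
lemma ContinuousOn.lt_of_forall_first_exit {f : ℝ → ℝ} {T b : ℝ} (hf : ContinuousOn f (Icc 0 T))
    (h0 : f 0 < b) (h : ∀ t ∈ Ioc 0 T, (∀ s ∈ Ico 0 t, f s ≤ b) → f t < b) :
    ∀ t ∈ Icc 0 T, f t < b := by
  by_contra! hne
  obtain ⟨t₀, ht₀, hbt₀⟩ := hne
  have hcl : IsCompact (Icc 0 T ∩ f ⁻¹' Ici b) :=
    isCompact_Icc.of_isClosed_subset (hf.preimage_isClosed_of_isClosed isClosed_Icc isClosed_Ici)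
      inter_subset_left
  obtain ⟨t, ⟨htT, htb⟩, hmin⟩ := hcl.exists_isLeast ⟨t₀, ht₀, hbt₀⟩
  have htb' : b ≤ f t := htb
  have ht0 : t ≠ 0 := by rintro rfl; linarith
  have := h t ⟨lt_of_le_of_ne htT.1 ht0.symm, htT.2⟩ fun s hs => by
    by_contra! hb
    have := hmin ⟨⟨hs.1, hs.2.le.trans htT.2⟩, hb.le⟩
    exact absurd hs.2 (not_lt.2 this)
  linarith

lemma exists_pos_mul_rpow_le {A β ε : ℝ} (hA : 0 ≤ A) (hβ : 0 < β) (hε : 0 < ε) :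
    ∃ T > 0, ∀ t, 0 ≤ t → t ≤ T → A * t ^ β ≤ ε := by
  refine ⟨(ε / (A + 1)) ^ (1 / β), by positivity, fun t ht htT => ?_⟩
  have h1 : t ^ β ≤ ε / (A + 1) := by
    refine (Real.rpow_le_rpow ht htT hβ.le).trans_eq ?_
    rw [← Real.rpow_mul (by positivity), one_div_mul_cancel hβ.ne', Real.rpow_one]
  calc A * t ^ β ≤ (A + 1) * (ε / (A + 1)) :=
        mul_le_mul (by linarith) h1 (by positivity) (by positivity)
    _ = ε := by field_simp

/-- The total energy and the total dissipation are bounded on a time interval whose length depends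
only on the data. -/
theorem exists_global_bound (hN : N = 2 ∨ N = 3) {p n m d₁ d₂ d₃ M : ℝ} (hp : 1 < p)
    (hn : 1 < n) (hσ : 0 < m + p) (hnR : n ≤ m + p + p / N)
    (hq : 1 < (p * (n - 1) - m) / (p - 1)) (hqR : (p * (n - 1) - m) / (p - 1) < m + p + p / N)
    (hd₁ : 0 < d₁) (hd₂ : 0 ≤ d₂) (hd₃ : 0 ≤ d₃) (hM : 0 ≤ M) :
    ∃ Tstar > 0, ∃ Y > 0, ∀ (T : ℝ) (a₁ a₂ b₁ b₂ : Coeff N) (E₀ H₀ : Space N → Vec3)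
      (F : EMField N), 0 < T →
      IsGeneralizedSolution T p m a₁ a₂ b₁ b₂ E₀ H₀ F →
      StructuralConditions T p n m d₁ d₂ d₃ a₁ a₂ b₁ b₂ F → ∫ x, F.w 0 x = M →
      ∀ᵐ τ ∂(volume.restrict (Ioo 0 (min Tstar T))),
        (∫⁻ x, ENNReal.ofReal (F.w τ x)) ≤ ENNReal.ofReal Y ∧
        (∫⁻ z in Ioo 0 τ ×ˢ univ, ENNReal.ofReal (F.diss p m z)) ≤ ENNReal.ofReal Y := by
  have hN0 : (0 : ℝ) < N := by rcases hN with rfl | rfl <;> norm_num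
  have hk : 0 ≤ p / N := by positivity
  set R := m + p + p / N with hR
  set q := (p * (n - 1) - m) / (p - 1) with hqdef
  obtain ⟨C, hC, hCi⟩ :=
    exists_localized_energy_inequality hN hp hn hσ hnR hq.le hqR.le hd₁ hd₂ hd₃
  obtain ⟨D, hD, hDi⟩ := exists_parabolic_interpolation hN hp hσ (by linarith : 1 < R)
  set θ := (q - 1) / (R - 1) with hθdef
  have hR0 : 0 < R - 1 := by linarith
  have hθ0 : 0 < θ := div_pos (by linarith) hR0
  have hθ1 : θ < 1 := by rw [hθdef, div_lt_one hR0]; linarith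
  -- Threshold of the continuity argument: as long as the mass is at most M + 1, the estimate below
  -- improves this to M + 1/2.
  set b := M + 1 with hb
  have hb0 : 0 < b := by linarith
  set A := C * ((D * b ^ (p / N)) ^ θ * b ^ (1 - θ)) with hA
  have hA0 : 0 ≤ A := by positivity
  set Yj := 2 * M / d₁ + 1 with hYj
  have hYj0 : 0 < Yj := by positivity
  -- The bound d₁/2 absorbs the dissipation and yields j ≤ 2M/d₁ + 1 = Yj; the second bound then
  -- gives ε(1 + j) ≤ 1/2, the gain in the mass.
  set ε := min (d₁ / 2) (1 / (2 * (1 + Yj))) with hε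
  have hε0 : 0 < ε := lt_min (by positivity) (by positivity)
  obtain ⟨Ts, hTs, hTsi⟩ := exists_pos_mul_rpow_le hA0 (by linarith : 0 < 1 - θ) hε0
  refine ⟨Ts, hTs, b + Yj, by positivity, fun T a₁ a₂ b₁ b₂ E₀ H₀ F hT hs hc hM0 => ?_⟩
  have hlw : ∀ τ ∈ Icc 0 T, ∫⁻ x, ENNReal.ofReal (F.w τ x) = ENNReal.ofReal (∫ x, F.w τ x) :=
    fun τ hτ => (ofReal_integral_eq_lintegral_ofReal (hs.energyIntegrable τ hτ)
      (Eventually.of_forall (F.w_nonneg τ))).symm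
  have hmain : ∀ᵐ τ ∂(volume.restrict (Ioo 0 T)), τ ≤ Ts →
      (∀ s ∈ Ico 0 τ, ∫ x, F.w s x ≤ b) → ∫ x, F.w τ x ≤ M + 1 / 2 ∧
        (∫⁻ z in Ioo 0 τ ×ˢ univ, ENNReal.ofReal (F.diss p m z)) ≤ ENNReal.ofReal Yj := by
    filter_upwards [hCi T a₁ a₂ b₁ b₂ E₀ H₀ F hs hc, ae_restrict_mem measurableSet_Ioo] with
      τ hτ hτT hτs hle
    -- The constant weight has zero gradient, so the term with w^n is absent and only the power q
    -- has to be estimated.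
    have h1 := hτ univ univ (fun _ => 1) 0 MeasurableSet.univ MeasurableSet.univ contDiff_const
      (fun _ => zero_le_one) (fun _ => le_rfl) (fun x => by simp) (fun _ _ => rfl)
      (fun x hx => absurd (mem_univ x) hx)
    simp only [ENNReal.ofReal_zero, zero_mul, add_zero, mul_one, hM0, Measure.restrict_univ,
      hlw τ ⟨hτT.1.le, hτT.2.le⟩] at h1
    set J := ∫⁻ z in Ioo 0 τ ×ˢ univ, ENNReal.ofReal (F.diss p m z) with hJ
    have hJt : J ≠ ⊤ := by
      have := ((hs.integrableOn_diss hp hσ).mono_set (cyl_mono hτT.2.le)).lintegral_lt_top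
      exact this.ne
    set j := J.toReal with hj
    have hj0 : 0 ≤ j := ENNReal.toReal_nonneg
    have hJj : J = ENNReal.ofReal j := (ENNReal.ofReal_toReal hJt).symm
    have h2 := hDi T a₁ a₂ b₁ b₂ E₀ H₀ F hs univ (Or.inl rfl) τ q b j hτT.1.le hτT.2.le hq.le
      hqR.le hb0.le hj0 (by
        filter_upwards [ae_restrict_mem measurableSet_Ioo] with s hs'
        rw [Measure.restrict_univ, hlw s ⟨hs'.1.le, (hs'.2.trans hτT.2).le⟩]
        exact ENNReal.ofReal_le_ofReal (hle s ⟨hs'.1.le, hs'.2⟩)) hJj.le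
    have hτ0 : 0 ≤ τ := hτT.1.le
    have hi0 : 0 ≤ ∫ x, F.w τ x := integral_nonneg (F.w_nonneg τ)
    have h3 : (D * j * b ^ (p / N)) ^ θ * (b * τ) ^ (1 - θ) =
        (D * b ^ (p / N)) ^ θ * b ^ (1 - θ) * (τ ^ (1 - θ) * j ^ θ) := by
      rw [show D * j * b ^ (p / N) = D * b ^ (p / N) * j by ring,
        Real.mul_rpow (by positivity) hj0, Real.mul_rpow hb0.le hτ0]
      ring
    have h4 : (∫ x, F.w τ x) + d₁ * j ≤ M + ε * (1 + j) := by
      have h5 : ENNReal.ofReal ((∫ x, F.w τ x) + d₁ * j) ≤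
          ENNReal.ofReal (M + C * ((D * j * b ^ (p / N)) ^ θ * (b * τ) ^ (1 - θ))) := by
        rw [ENNReal.ofReal_add hi0 (by positivity), ENNReal.ofReal_mul hd₁.le,
          ENNReal.ofReal_add hM (by positivity), ENNReal.ofReal_mul hC, ← hJj]
        exact h1.trans (add_le_add le_rfl (mul_le_mul' le_rfl h2))
      refine ((ENNReal.ofReal_le_ofReal_iff (by positivity)).1 h5).trans ?_
      have h6 : j ^ θ ≤ 1 + j := by
        rcases le_total j 1 with h | h
        · exact (Real.rpow_le_one hj0 h hθ0.le).trans (by linarith)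
        · have := Real.rpow_le_rpow_of_exponent_le h hθ1.le
          rw [Real.rpow_one] at this
          linarith
      have h7 : C * ((D * j * b ^ (p / N)) ^ θ * (b * τ) ^ (1 - θ)) =
          A * τ ^ (1 - θ) * j ^ θ := by rw [h3, hA]; ring
      rw [h7]
      have := mul_le_mul (hTsi τ hτ0 hτs) h6 (by positivity) hε0.le
      linarith
    have h8 : j ≤ Yj := by
      have : ε * (1 + j) ≤ d₁ / 2 * (1 + j) :=
        mul_le_mul_of_nonneg_right (min_le_left _ _) (by linarith)
      have h9 : d₁ * j ≤ d₁ * Yj := by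
        have : d₁ * Yj = 2 * M + d₁ := by rw [hYj]; field_simp
        linarith
      exact le_of_mul_le_mul_left h9 hd₁
    refine ⟨?_, hJj ▸ ENNReal.ofReal_le_ofReal h8⟩
    have h10 : ε * (1 + j) ≤ 1 / (2 * (1 + Yj)) * (1 + Yj) :=
      mul_le_mul (min_le_right _ _) (by linarith) (by linarith) (by positivity)
    have h11 : 1 / (2 * (1 + Yj)) * (1 + Yj) = 1 / 2 := by field_simp
    have : 0 ≤ d₁ * j := by positivity
    linarith
  have hcont : ContinuousOn (fun t => ∫ x, F.w t x) (Icc 0 T) := by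
    simpa using hs.continuousOn_setIntegral_w univ
  have hsub : Icc 0 (min Ts T) ⊆ Icc 0 T := Icc_subset_Icc_right (min_le_right _ _)
  have hlt : ∀ t ∈ Icc 0 (min Ts T), ∫ x, F.w t x < b := by
    refine (hcont.mono hsub).lt_of_forall_first_exit (by simp only [hM0]; linarith) fun t ht hle => ?_
    have htT : t ∈ Ioc 0 T := ⟨ht.1, ht.2.trans (min_le_right _ _)⟩
    refine (hcont.le_of_ae_le_left htT (c := M + 1 / 2) ?_).trans_lt (by linarith)
    filter_upwards [ae_restrict_of_ae_restrict_of_subset (Ioo_subset_Ioo_right htT.2) hmain,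
      ae_restrict_mem measurableSet_Ioo] with τ h1 h2
    exact (h1 (h2.2.le.trans (ht.2.trans (min_le_left _ _)))
      fun s hs => hle s ⟨hs.1, hs.2.trans h2.2⟩).1
  filter_upwards [ae_restrict_of_ae_restrict_of_subset (Ioo_subset_Ioo_right (min_le_right Ts T))
    hmain, ae_restrict_mem measurableSet_Ioo] with τ h1 h2
  have h3 := h1 (h2.2.le.trans (min_le_left _ _)) fun s hs =>
    (hlt s ⟨hs.1, (hs.2.trans h2.2).le⟩).le
  refine ⟨?_, h3.2.trans (ENNReal.ofReal_le_ofReal (by linarith))⟩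
  rw [hlw τ (hsub ⟨h2.1.le, h2.2.le⟩)]
  exact ENNReal.ofReal_le_ofReal (by linarith [h3.1])

end GlobalBound

/-! ### Iteration over half-spaces -/

section FinitePropagation

variable {N : ℕ}

/-- Beyond one factor a, the interpolation bound carries the extra power a^(kθ). This superlinear
gain drives the iteration. -/
lemma rpow_interpolation_split {D a t k θ : ℝ} (hD : 0 ≤ D) (ha : 0 < a) (ht : 0 ≤ t) :
    (D * a * a ^ k) ^ θ * (a * t) ^ (1 - θ) = a * (D ^ θ * a ^ (k * θ) * t ^ (1 - θ)) := by
  rw [Real.mul_rpow (by positivity) (by positivity), Real.mul_rpow hD ha.le,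
    Real.mul_rpow ha.le ht, ← Real.rpow_mul ha.le]
  have : a ^ θ * a ^ (1 - θ) = a := by rw [← Real.rpow_add ha]; simp
  calc _ = (a ^ θ * a ^ (1 - θ)) * (D ^ θ * a ^ (k * θ) * t ^ (1 - θ)) := by ring
    _ = _ := by rw [this]

/-- Finite speed of propagation: energy which is initially absent from the upper half-space stays
below the height `K t ^ α`. -/
theorem exists_propagation_bound (hN : N = 2 ∨ N = 3) {p n m d₁ d₂ d₃ M : ℝ} (hp : 1 < p)
    (hn : 1 < n) (hσ : 0 < m + p) (hnR : n < m + p + p / N)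
    (hq : 1 < (p * (n - 1) - m) / (p - 1)) (hqR : (p * (n - 1) - m) / (p - 1) < m + p + p / N)
    (hd₁ : 0 < d₁) (hd₂ : 0 ≤ d₂) (hd₃ : 0 ≤ d₃) (hM : 0 ≤ M) :
    ∃ Tstar > 0, ∃ K > 0, ∀ (T : ℝ) (a₁ a₂ b₁ b₂ : Coeff N) (E₀ H₀ : Space N → Vec3)
      (F : EMField N), 0 < T →
      IsGeneralizedSolution T p m a₁ a₂ b₁ b₂ E₀ H₀ F →
      StructuralConditions T p n m d₁ d₂ d₃ a₁ a₂ b₁ b₂ F → ∫ x, F.w 0 x = M →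
      (∀ᵐ x, 0 ≤ lastCoord x → F.w 0 x = 0) → ∀ t, 0 < t → t < Tstar → t < T →
      ∀ᵐ x, K * t ^ (1 - (n - 1) / (m + p + p / N - 1)) < lastCoord x → F.w t x = 0 := by
  have hN0 : (0 : ℝ) < N := by rcases hN with rfl | rfl <;> norm_num
  have hk : 0 < p / N := by positivity
  obtain ⟨B, hB, hBi⟩ := exists_fderiv_halfCutoff_bound N
  obtain ⟨T₁, hT₁, Y, hY, hYi⟩ :=
    exists_global_bound hN hp hn hσ hnR.le hq hqR hd₁ hd₂ hd₃ hM
  set R := m + p + p / N with hR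
  set q := (p * (n - 1) - m) / (p - 1) with hqdef
  obtain ⟨C, hC, hCi⟩ :=
    exists_localized_energy_inequality hN hp hn hσ hnR.le hq.le hqR.le hd₁ hd₂ hd₃
  obtain ⟨D, hD, hDi⟩ := exists_parabolic_interpolation hN hp hσ (by linarith : 1 < R)
  have hR0 : 0 < R - 1 := by linarith
  set θ := (q - 1) / (R - 1) with hθdef
  have hθ0 : 0 < θ := div_pos (by linarith) hR0
  have hθ1 : θ < 1 := by rw [hθdef, div_lt_one hR0]; linarith
  set ν := (n - 1) / (R - 1) with hνdef
  have hν0 : 0 < ν := div_pos (by linarith) hR0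
  have hν1 : ν < 1 := by rw [hνdef, div_lt_one hR0]; linarith
  set k := p / N with hkdef
  -- A bound c₀ y for mass plus d₁ times dissipation bounds each of the two quantities by y.
  set c₀ := min 1 d₁ with hc₀
  have hc₀0 : 0 < c₀ := lt_min one_pos hd₁
  -- The decay rate is chosen so that the extra power of a_i = Y ρ^i equals a constant times 2^(-i),
  -- which offsets the doubling of the cutoff slope at each step.
  set ρ := (1 / 2 : ℝ) ^ (1 / (k * ν)) with hρ
  have hρ0 : 0 < ρ := by positivity
  have hρ1 : ρ < 1 := Real.rpow_lt_one (by norm_num) (by norm_num) (by positivity)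
  have hρk : ∀ i : ℕ, (ρ ^ i) ^ (k * ν) = (1 / 2) ^ i := fun i => by
    rw [← Real.rpow_pow_comm hρ0.le, hρ, ← Real.rpow_mul (by norm_num),
      one_div_mul_cancel (by positivity), Real.rpow_one]
  obtain ⟨T₂, hT₂, hT₂i⟩ := exists_pos_mul_rpow_le (A := C * (D ^ θ * Y ^ (k * θ)))
    (by positivity) (by linarith : 0 < 1 - θ) (by positivity : 0 < ρ * c₀ / 2)
  -- Large enough that the convective term takes at most half of the factor ρ c₀ allowed per step;
  -- the final 1 makes K₁ positive. The other half is covered by the smallness of `T₂`.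
  set K₁ := 4 * C * B * (D ^ ν * Y ^ (k * ν)) / (ρ * c₀) + 1 with hK₁
  have hK₁0 : 0 < K₁ := by positivity
  refine ⟨min T₁ T₂, lt_min hT₁ hT₂, K₁ * 2 ^ (1 - ν), by positivity,
    fun T a₁ a₂ b₁ b₂ E₀ H₀ F hT hs hc hM0 hinit t ht0 htT htT' => ?_⟩
  set T' := min (min T₁ T₂) T with hT'
  have htT₁ : t < T' := lt_min htT htT'
  have hgood : ∀ᵐ τ ∂(volume.restrict (Ioo 0 T')), _ :=
    (ae_restrict_of_ae_restrict_of_subset (Ioo_subset_Ioo_right (min_le_right _ _))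
      (hCi T a₁ a₂ b₁ b₂ E₀ H₀ F hs hc)).and
    (ae_restrict_of_ae_restrict_of_subset
      (Ioo_subset_Ioo_right (min_le_min_right T (min_le_left T₁ T₂)))
      (hYi T a₁ a₂ b₁ b₂ E₀ H₀ F hT hs hc hM0))
  -- The energy inequality is available at almost every time only, so the argument runs up to a good
  -- time t' with t < t' < 2t. This costs the factor 2^(1-ν) in the final constant.
  obtain ⟨t', ⟨htt', hs_lt⟩, hsC, hsY⟩ : ∃ t' ∈ Ioo t (min (2 * t) T'), _ := by
    have hsub : Ioo t (min (2 * t) T') ⊆ Ioo 0 T' :=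
      Ioo_subset_Ioo ht0.le (min_le_right _ _)
    have h := ae_restrict_of_ae_restrict_of_subset hsub hgood
    have hpos : volume (Ioo t (min (2 * t) T')) ≠ 0 := by
      rw [Real.volume_Ioo, ne_eq, ENNReal.ofReal_eq_zero, not_le, sub_pos]
      exact lt_min (by linarith) htT₁
    have : (ae (volume.restrict (Ioo t (min (2 * t) T')))).NeBot := by
      rwa [ae_neBot, ne_eq, Measure.restrict_eq_zero]
    obtain ⟨t', h1, h2⟩ := (h.and (ae_restrict_mem measurableSet_Ioo)).exists
    exact ⟨t', h2, h1⟩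
  have hsT' : t' < T' := hs_lt.trans_le (min_le_right _ _)
  have hsT : t' < T := hsT'.trans_le (min_le_right _ _)
  have hsT₂ : t' ≤ T₂ := (hsT'.trans_le ((min_le_left _ _).trans (min_le_right _ _))).le
  have hs_pos : 0 < t' := ht0.trans htt'
  set h := K₁ * t' ^ (1 - ν) with hh
  have hh0 : 0 < h := by positivity
  have hh1 : h ≤ K₁ * 2 ^ (1 - ν) * t ^ (1 - ν) := by
    rw [hh, mul_assoc, ← Real.mul_rpow (by norm_num) ht0.le]
    exact mul_le_mul_of_nonneg_left (Real.rpow_le_rpow hs_pos.le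
      (hs_lt.trans_le (min_le_left _ _)).le (by linarith)) hK₁0.le
  have hgood' := ae_restrict_of_ae_restrict_of_subset (Ioo_subset_Ioo_right hsT'.le) hgood
  -- Mass and dissipation must decay together, because the interpolation at the next level uses
  -- both. The heights h(1 - 2^(-i)) increase to h.
  have hdecay : ∀ i : ℕ,
      (∀ᵐ τ ∂(volume.restrict (Ioo 0 t')),
        ∫⁻ x in upperHalf N (h * (1 - (1 / 2) ^ i)), ENNReal.ofReal (F.w τ x) ≤
          ENNReal.ofReal (Y * ρ ^ i)) ∧
      (∫⁻ z in Ioo 0 t' ×ˢ upperHalf N (h * (1 - (1 / 2) ^ i)), ENNReal.ofReal (F.diss p m z)) ≤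
          ENNReal.ofReal (Y * ρ ^ i) := by
    intro i
    induction i with
    | zero =>
      constructor
      · filter_upwards [hgood'] with τ hτ
        simpa using (setLIntegral_le_lintegral _ _).trans hτ.2.1
      · simpa using (lintegral_mono_set (prod_mono_right (subset_univ _))).trans hsY.2
    | succ i ih =>
      set s := h * (1 - (1 / 2) ^ i) with hsdef
      set δ := h * (1 / 2) ^ (i + 1) with hδ
      have hδ0 : 0 < δ := by positivity
      have hs0 : 0 ≤ s := mul_nonneg hh0.le (by
        have : (1 / 2 : ℝ) ^ i ≤ 1 := pow_le_one₀ (by norm_num) (by norm_num)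
        linarith)
      have hsδ : h * (1 - (1 / 2) ^ (i + 1)) = s + δ := by rw [hsdef, hδ, pow_succ]; ring
      rw [hsδ]
      set a := Y * ρ ^ i with ha
      have ha0 : 0 < a := by positivity
      have haY : a ≤ Y := mul_le_of_le_one_right hY.le (pow_le_one₀ hρ0.le hρ1.le)
      have hint := fun r hr hrR => hDi T a₁ a₂ b₁ b₂ E₀ H₀ F hs (upperHalf N s) (Or.inr ⟨s, rfl⟩)
        t' r a a hs_pos.le hsT.le hr hrR ha0.le ha0.le ih.1 ih.2
      have hIq := hint q hq.le hqR.le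
      have hIn := hint n hn.le hnR.le
      rw [rpow_interpolation_split hD.le ha0 hs_pos.le] at hIq hIn
      have hsmallq : C * (D ^ θ * a ^ (k * θ) * t' ^ (1 - θ)) ≤ ρ * c₀ / 2 := by
        refine le_trans ?_ (hT₂i t' hs_pos.le hsT₂)
        have : a ^ (k * θ) ≤ Y ^ (k * θ) := Real.rpow_le_rpow ha0.le haY (by positivity)
        rw [mul_assoc C]
        gcongr
      -- With δ = h/2^(i+1) and h = K₁ t'^(1-ν), all powers of 2^i and of t' cancel, leaving a
      -- quantity independent of i that K₁ makes small.
      have hsmalln : C * (B / δ * (D ^ ν * a ^ (k * ν) * t' ^ (1 - ν))) ≤ ρ * c₀ / 2 := by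
        have e1 : a ^ (k * ν) = Y ^ (k * ν) * (1 / 2) ^ i := by
          rw [ha, Real.mul_rpow hY.le (by positivity), hρk]
        have e2 : C * (B / δ * (D ^ ν * a ^ (k * ν) * t' ^ (1 - ν))) =
            2 * C * B * (D ^ ν * Y ^ (k * ν)) / K₁ := by
          rw [e1, hδ, hh, pow_succ]
          have : t' ^ (1 - ν) ≠ 0 := by positivity
          field_simp
        rw [e2, div_le_iff₀ hK₁0, hK₁]
        have : ρ * c₀ / 2 * (4 * C * B * (D ^ ν * Y ^ (k * ν)) / (ρ * c₀) + 1) =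
            2 * C * B * (D ^ ν * Y ^ (k * ν)) + ρ * c₀ / 2 := by field_simp; ring
        rw [this]
        have : 0 < ρ * c₀ := by positivity
        linarith
      have hstep : ∀ τ ∈ Ioc 0 t', (∀ (S S' : Set (Space N)) (ζ : Space N → ℝ) (L : ℝ),
          MeasurableSet S → MeasurableSet S' → ContDiff ℝ ∞ ζ →
          (∀ x, 0 ≤ ζ x) → (∀ x, ζ x ≤ 1) → (∀ x, ‖fderiv ℝ ζ x‖ ≤ L) → (∀ x ∈ S', ζ x = 1) →
          (∀ x, x ∉ S → ζ x = 0 ∧ fderiv ℝ ζ x = 0) →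
          (∫⁻ x in S', ENNReal.ofReal (F.w τ x)) +
            ENNReal.ofReal d₁ * (∫⁻ z in Ioo 0 τ ×ˢ S', ENNReal.ofReal (F.diss p m z)) ≤
          ENNReal.ofReal (∫ x, F.w 0 x * ζ x) + ENNReal.ofReal C *
            ((∫⁻ z in Ioo 0 τ ×ˢ S, ENNReal.ofReal (F.w z.1 z.2) ^ q) +
              ENNReal.ofReal L * ∫⁻ z in Ioo 0 τ ×ˢ S, ENNReal.ofReal (F.w z.1 z.2) ^ n)) →
          (∫⁻ x in upperHalf N (s + δ), ENNReal.ofReal (F.w τ x)) +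
            ENNReal.ofReal d₁ * (∫⁻ z in Ioo 0 τ ×ˢ upperHalf N (s + δ),
              ENNReal.ofReal (F.diss p m z)) ≤ ENNReal.ofReal (c₀ * (Y * ρ ^ (i + 1))) := by
        intro τ hτ hτi
        have h1 := hτi (upperHalf N s) (upperHalf N (s + δ)) (halfCutoff N s δ) (B / δ)
          (measurableSet_upperHalf _) (measurableSet_upperHalf _) (halfCutoff_contDiff _ _)
          (halfCutoff_nonneg _ _) (halfCutoff_le_one _ _) (hBi s δ hδ0)
          (fun x hx => halfCutoff_eq_one hδ0 (le_of_lt hx))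
          (fun x hx => ⟨halfCutoff_eq_zero hδ0 (not_lt.1 hx),
            fderiv_halfCutoff_eq_zero hδ0 (not_lt.1 hx)⟩)
        -- The levels are nonnegative, so the cutoff lives where there is no initial energy.
        have h0 : ∫ x, F.w 0 x * halfCutoff N s δ x = 0 := by
          refine integral_eq_zero_of_ae ?_
          filter_upwards [hinit] with x hx
          rcases le_total (lastCoord x) s with h' | h'
          · simp [halfCutoff_eq_zero hδ0 h']
          · simp [hx (hs0.trans h')]
        rw [h0, ENNReal.ofReal_zero, zero_add] at h1
        have hmono : Ioo 0 τ ×ˢ upperHalf N s ⊆ Ioo 0 t' ×ˢ upperHalf N s :=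
          prod_mono_left (Ioo_subset_Ioo_right hτ.2)
        refine h1.trans ((mul_le_mul' le_rfl (add_le_add ((lintegral_mono_set hmono).trans hIq)
          (mul_le_mul' le_rfl ((lintegral_mono_set hmono).trans hIn)))).trans ?_)
        rw [← ENNReal.ofReal_mul (by positivity), ← ENNReal.ofReal_add (by positivity)
          (by positivity), ← ENNReal.ofReal_mul hC]
        refine ENNReal.ofReal_le_ofReal ?_
        have h2 : c₀ * (Y * ρ ^ (i + 1)) = a * (ρ * c₀ / 2) + a * (ρ * c₀ / 2) := by
          rw [ha, pow_succ]; ring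
        rw [h2]
        have h3 := mul_le_mul_of_nonneg_left hsmallq ha0.le
        have h4 := mul_le_mul_of_nonneg_left hsmalln ha0.le
        refine le_trans (le_of_eq ?_) (add_le_add h3 h4)
        ring
      have hpos : 0 ≤ Y * ρ ^ (i + 1) := by positivity
      constructor
      · filter_upwards [hgood', ae_restrict_mem measurableSet_Ioo] with τ hτ hτt
        refine (le_self_add.trans (hstep τ ⟨hτt.1, hτt.2.le⟩ hτ.1)).trans
          (ENNReal.ofReal_le_ofReal ?_)
        exact mul_le_of_le_one_left hpos (min_le_left _ _)
      · have h1 := le_add_self.trans (hstep t' ⟨hs_pos, le_rfl⟩ hsC)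
        have h2 : ENNReal.ofReal (c₀ * (Y * ρ ^ (i + 1))) ≤
            ENNReal.ofReal d₁ * ENNReal.ofReal (Y * ρ ^ (i + 1)) := by
          rw [← ENNReal.ofReal_mul hd₁.le]
          exact ENNReal.ofReal_le_ofReal (mul_le_mul_of_nonneg_right (min_le_right _ _) hpos)
        exact (ENNReal.mul_le_mul_iff_right (by simpa using hd₁) ENNReal.ofReal_ne_top).1
          (h1.trans h2)
  -- The half-space above h lies in all the half-spaces of the iteration, so its energy is below
  -- every Y ρ^i.
  have hzero : ∀ᵐ τ ∂(volume.restrict (Ioo 0 t')), ∫ x in upperHalf N h, F.w τ x ≤ 0 := by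
    filter_upwards [ae_all_iff.2 fun i => (hdecay i).1, ae_restrict_mem measurableSet_Ioo] with
      τ hτ hτt
    have hlim : Tendsto (fun i : ℕ => ENNReal.ofReal (Y * ρ ^ i)) atTop (𝓝 0) := by
      have := (tendsto_pow_atTop_nhds_zero_of_lt_one hρ0.le hρ1).const_mul Y
      simpa using ENNReal.tendsto_ofReal this
    have h1 : ∫⁻ x in upperHalf N h, ENNReal.ofReal (F.w τ x) ≤ 0 := by
      refine ge_of_tendsto' hlim fun i => le_trans (lintegral_mono_set fun x hx => ?_) (hτ i)
      have hx' : h < lastCoord x := hx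
      refine lt_of_le_of_lt ?_ hx'
      have : (0 : ℝ) ≤ (1 / 2) ^ i := by positivity
      nlinarith
    have h2 := (ofReal_integral_le_lintegral (μ := volume.restrict (upperHalf N h))
      (F.w_nonneg τ)).trans h1
    simpa using h2
  -- Continuity in L¹ passes from almost every time before t' to the given time t.
  have ht : ∫ x in upperHalf N h, F.w t x ≤ 0 :=
    (hs.continuousOn_setIntegral_w (upperHalf N h)).le_of_ae_le_left ⟨ht0, htT'.le⟩
      (ae_restrict_of_ae_restrict_of_subset (Ioo_subset_Ioo_right htt'.le) hzero)
  have ht0' : ∫ x in upperHalf N h, F.w t x = 0 :=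
    le_antisymm ht (integral_nonneg (F.w_nonneg t))
  rw [integral_eq_zero_iff_of_nonneg (F.w_nonneg t)
    (hs.energyIntegrable t ⟨ht0.le, htT'.le⟩).integrableOn, EventuallyEq,
    ae_restrict_iff' (measurableSet_upperHalf h)] at ht0'
  filter_upwards [ht0'] with x hx hx'
  exact hx (lt_of_le_of_lt hh1 hx')

end FinitePropagation

/-! ### Essential supports and half-spaces -/

section EssentialSupport

variable {N : ℕ}

lemma essSupport_subset_of_ae {u : Space N → ℝ} {c : ℝ}
    (h : ∀ᵐ x, c < lastCoord x → u x = 0) : essSupport u ⊆ {x | lastCoord x ≤ c} := by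
  refine Measure.support_subset_of_isClosed
    (isClosed_le continuous_lastCoord continuous_const) ?_
  have hc : {x : Space N | lastCoord x ≤ c}ᶜ = upperHalf N c := by
    ext x; simp [upperHalf]
  rw [mem_ae_iff, hc, Measure.restrict_apply (measurableSet_upperHalf c)]
  refine measure_mono_null (fun x hx => ?_) (ae_iff.1 h)
  rw [mem_ofPred_eq, Classical.not_imp]
  exact hx

/-- The complement of the support of a measure on this space is a null set for it, and the closed
half-space lies in that complement. -/
lemma ae_eq_zero_of_essSupport_subset {u : Space N → ℝ} {c : ℝ}
    (h : essSupport u ⊆ {x | lastCoord x < c}) : ∀ᵐ x, c ≤ lastCoord x → u x = 0 := by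
  have h0 : (volume.restrict {x | u x ≠ 0}) {x : Space N | c ≤ lastCoord x} = 0 := by
    refine measure_mono_null (fun x hx => ?_)
      (Measure.measure_compl_support (μ := volume.restrict {x | u x ≠ 0}))
    rw [mem_compl_iff]
    intro hx'
    have h1 : lastCoord x < c := h hx'
    exact absurd hx (not_le.2 h1)
  rw [Measure.restrict_apply (isClosed_le continuous_const continuous_lastCoord).measurableSet] at h0
  rw [ae_iff]
  refine measure_mono_null (fun x hx => ?_) h0
  simpa using hx

end EssentialSupport

/-! ### The conditions on the exponents and the conclusion -/

theorem theorem1 (N : ℕ) (hN : N = 2 ∨ N = 3) (p n m : ℝ) (hp : 1 < p) (hn : 1 < n)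
    (hnp : p < 2 → n < 1 + (p - 1) * (p + N) / (p * N * (2 - p)))
    (hm_lower : max (-p) (max (-p * (1 + 1 / N - n / p)) (-p * (1 + 1 / N - (n - 1) / (p - 1)))) < m)
    (hm_upper : m < p * (n - 2) + 1)
    (hm_kappa : n - p - (p - 1) / N < m)
    (d₁ d₂ d₃ : ℝ) (hd₁ : 0 < d₁) (hd₂ : 0 < d₂) (hd₃ : 0 < d₃)
    (M : ℝ) (hM : 0 ≤ M) :
    ∃ Tstar > 0, ∃ K > 0, ∃ Γ : ℝ → ℝ,
      ContinuousOn Γ (Ici 0) ∧ Γ 0 = 0 ∧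
      (∀ t, 0 ≤ t → Γ t = K * max (t ^ alphaExp N p n m) (t ^ kappaExp N p n m)) ∧
      ∀ (T : ℝ) (_ : 0 < T) (a₁ a₂ b₁ b₂ : Coeff N) (E₀ H₀ : Space N → Vec3) (F : EMField N),
        IsGeneralizedSolution T p m a₁ a₂ b₁ b₂ E₀ H₀ F →
        StructuralConditions T p n m d₁ d₂ d₃ a₁ a₂ b₁ b₂ F →
        essSupport (fun x => ‖E₀ x‖ ^ 2 + ‖H₀ x‖ ^ 2) ⊆ {x | lastCoord x < 0} →
        ∫ x, (‖E₀ x‖ ^ 2 + ‖H₀ x‖ ^ 2) = M →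
        ∀ t, 0 < t → t < Tstar → t < T →
          essSupport (F.w t) ⊆ {x | lastCoord x < Γ t} ∧
          ∀ᵐ x, Γ t ≤ lastCoord x → F.E t x = 0 ∧ F.H t x = 0 := by
  have hN0 : (0 : ℝ) < N := by rcases hN with rfl | rfl <;> norm_num
  have hp0 : 0 < p := by linarith
  have hp1 : 0 < p - 1 := by linarith
  simp only [max_lt_iff] at hm_lower
  obtain ⟨hm1, hm2, -⟩ := hm_lower
  have hσ : 0 < m + p := by linarith
  -- The second entry of the maximum in the lower bound for m is exactly this inequality; the upper
  -- bound for m likewise amounts to q > 1.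
  have hnR : n < m + p + p / N := by
    have : -p * (1 + 1 / N - n / p) = -p - p / N + n := by field_simp; ring
    linarith
  have hq : 1 < (p * (n - 1) - m) / (p - 1) := by rw [lt_div_iff₀ hp1]; linarith
  have hκ : 0 < p - 1 + N * (m + p - n) := by
    have h1 : 0 < (p - 1) / N + (m + p - n) := by linarith
    have h2 : p - 1 + N * (m + p - n) = N * ((p - 1) / N + (m + p - n)) := by field_simp
    rw [h2]; positivity
  -- The difference of the two sides, multiplied by p - 1, is p/N times p - 1 + N(m+p-n), the factor
  -- of the numerator of κ that `hm_kappa` makes positive.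
  have hqR : (p * (n - 1) - m) / (p - 1) < m + p + p / N := by
    rw [div_lt_iff₀ hp1]
    have h2 : (m + p + p / N) * (p - 1) - (p * (n - 1) - m) =
        p / N * (p - 1 + N * (m + p - n)) := by field_simp; ring
    have : 0 < p / N * (p - 1 + N * (m + p - n)) := by positivity
    linarith
  have hlam : 0 < p + N * (m + p - 1) := by
    have : p + N * (m + p - 1) = N * (m + p + p / N - 1) := by field_simp; ring
    rw [this]
    exact mul_pos hN0 (by linarith)
  have hα : 1 - (n - 1) / (m + p + p / N - 1) = alphaExp N p n m := by
    have h1 : m + p + p / N - 1 = (p + N * (m + p - 1)) / N := by field_simp; ring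
    rw [h1, alphaExp]
    field_simp
    ring
  have hα0 : 0 < alphaExp N p n m := div_pos (by nlinarith) hlam
  have hκ0 : 0 < kappaExp N p n m := by
    have h1 : 0 < n * p + N * (m + p - 1) := by nlinarith
    have h2 : 0 < p * (p * (n - 1) - m) + N * (p - 1) * (m + p - 1) := by
      rw [lt_div_iff₀ hp1] at hq
      have : 0 < (p - 1) * (p + N * (m + p - 1)) := mul_pos hp1 hlam
      nlinarith
    exact div_pos (mul_pos (mul_pos hp0 hκ) h1) (mul_pos hlam h2)
  obtain ⟨Ts, hTs, K, hK, hprop⟩ :=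
    exists_propagation_bound hN hp hn hσ hnR hq hqR hd₁ hd₂.le hd₃.le hM
  rw [hα] at hprop
  -- Vanishing is known above K t^α. The larger constant leaves a strict gap for t > 0, which turns
  -- the closed bound on the support into the open one.
  refine ⟨Ts, hTs, K + 1, by linarith,
    fun t => (K + 1) * max (t ^ alphaExp N p n m) (t ^ kappaExp N p n m), ?_, ?_,
    fun t _ => rfl, ?_⟩
  · exact (continuous_const.mul ((Real.continuous_rpow_const hα0.le).max
      (Real.continuous_rpow_const hκ0.le))).continuousOn
  · simp [Real.zero_rpow hα0.ne', Real.zero_rpow hκ0.ne']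
  intro T hT a₁ a₂ b₁ b₂ E₀ H₀ F hs hc hsupp hmass t ht htTs htT
  have hw0 : F.w 0 =ᵐ[volume] fun x => ‖E₀ x‖ ^ 2 + ‖H₀ x‖ ^ 2 := by
    filter_upwards [hs.initE, hs.initH] with x h1 h2
    simp [EMField.w, h1, h2]
  have hzero := hprop T a₁ a₂ b₁ b₂ E₀ H₀ F hT hs hc ((integral_congr_ae hw0).trans hmass)
    (by
      filter_upwards [hw0, ae_eq_zero_of_essSupport_subset hsupp] with x h1 h2 h3
      exact h1.trans (h2 h3)) t ht htTs htT
  have hlt : K * t ^ alphaExp N p n m <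
      (K + 1) * max (t ^ alphaExp N p n m) (t ^ kappaExp N p n m) := by
    have h1 : 0 < t ^ alphaExp N p n m := Real.rpow_pos_of_pos ht _
    have h2 := mul_le_mul_of_nonneg_left
      (le_max_left (t ^ alphaExp N p n m) (t ^ kappaExp N p n m)) (by linarith : 0 ≤ K + 1)
    linarith
  refine ⟨(essSupport_subset_of_ae hzero).trans fun x hx => lt_of_le_of_lt hx hlt, ?_⟩
  filter_upwards [hzero] with x hx hΓ
  have h1 : ‖F.E t x‖ ^ 2 + ‖F.H t x‖ ^ 2 = 0 := hx (hlt.trans_le hΓ)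
  have h2 := sq_nonneg ‖F.E t x‖
  have h3 := sq_nonneg ‖F.H t x‖
  exact ⟨norm_eq_zero.1 (pow_eq_zero_iff two_ne_zero |>.1 (by linarith)),
    norm_eq_zero.1 (pow_eq_zero_iff two_ne_zero |>.1 (by linarith))⟩
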